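/- **Model.** Base stations (BSs) and a typical mobile terminal (MT) at the origin of $\mathbb R^2$. Let $\mathsf S$ be a finite set of link states, $\lambda_{BS},\lambda_{MT},P_{BS},G^{(0)}>0$, $\sigma_N^2\ge 0$, $N_{RB}\in\{1,2,\dots\}$, $P_{RB}=P_{BS}/N_{RB}$. For $s\in\mathsf S$ let $\kappa_s>0$, $\alpha_s>2$ (path-loss $\kappa_s r^{\alpha_s}$), $m_s,\Omega_s>0$ (gamma fading with parameter $m_s$ and mean $\Omega_s$), $\mu_s,\sigma_s$ (mean and standard deviation of the log-normal shadowing in dB), and $\Theta_s=\exp(2\tilde\mu_s/\alpha_s+2\tilde\sigma_s^2/\alpha_s^2)$ with $\tilde\mu_s=\mu_s\ln(10)/10$, $\tilde\sigma_s=\sigma_s\ln(10)/10$. Let $0=D_0<D_1<\dots<D_B<D_{B+1}=\infty$ and let $q_{s,b}\ge0$ ($1\le b\le B+1$) be the probability that a link of length in $[D_{b-1},D_b)$ is in state $s$, with $\sum_s q_{s,b}\le 1$ (a deficit is the probability of outage) and $\sum_s q_{s,B+1}>0$; put $p_s(r)=q_{s,b}$ for $r\in[D_{b-1},D_b)$.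 The BSs in state $s$ form independent (over $s$) Poisson point processes on $\mathbb R^2$ with densities $\lambda_{BS}\Theta_s p_s(|y|)$; thus the path-losses $\kappa_s|y|^{\alpha_s}$ form a Poisson process on $[0,\infty)$ with $\widehat\Lambda_s([0,\xi))=2\pi\lambda_{BS}\Theta_s\int_0^{(\xi/\kappa_s)^{1/\alpha_s}}p_s(r)\,r\,dr$. The links carry independent marks: the fading gain $g$; an activity indicator with $\Pr\{\text{active}\}=1-p_{off}$; two uniform angles $\theta_{BS},\theta_{MT}$ on $[-\pi,\pi)$, giving the directivity gain $G=G_{BS}(\theta_{BS})G_{MT}(\theta_{MT})$, where $G_q(\theta)=\gamma_q^{(l)}\geq 0$ for $|\theta|\in[\varphi_q^{(l-1)},\varphi_q^{(l)})$, $0=\varphi_q^{(0)}<\dots<\varphi_q^{(K_q)}=\pi$, and $\omega_q^{(l)}=2(\varphi_q^{(l)}-\varphi_q^{(l-1)})$. *Load.* Let the area $A$ of a cell be gamma distributed with shape $3.5$ and mean $1/\lambda_{BS}$; let $N$ be mixed Poisson with parameter $\lambda_{MT}A$ and let $N'$ be mixed Poisson with parameter $\lambda_{MT}A'$, where $A'$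 has the area-biased law $\lambda_{BS}\,a\Pr\{A\in da\}$. Then $p_{off}=\sum_{n=0}^{N_{RB}}(1-n/N_{RB})\Pr\{N=n\}$ and $p_{sel}=\Pr\{N'<N_{RB}\}+\sum_{n\ge N_{RB}}\frac{N_{RB}}{n+1}\Pr\{N'=n\}$. *Potential throughput.* The MT is served by the BS of smallest path-loss $L^{(0)}$, whose fading gain is $g^{(0)}$, and $\mathrm{SINR}=\frac{P_{RB}G^{(0)}g^{(0)}/L^{(0)}}{\sigma_N^2+I}$, where $I$ is the sum of $P_{RB}Gg/L$ over all active BSs with path-loss $L>L^{(0)}$. For $T>0$, $\mathrm{PT}=\lambda_{MT}\,p_{sel}\log_2(1+T)\Pr\{\mathrm{SINR}\ge T\}$. **Statement.** For every $T>0$, $$\mathrm{PT}=\lambda_{MT}\,p_{sel}\log_2(1+T)\Big(\frac12-\frac{\bar{\mathcal C}(T)}{\pi}\Big),$$ $$\bar{\mathcal C}(T)=\sum_{s\in\mathsf S}\int_0^\infty\!\!\int_0^\infty \mathrm{Im}\Big\{\exp\Big(\frac{\mathrm jzx\sigma_N^2T}{G^{(0)}P_{RB}}\Big)\mathcal M_{s}(\mathrm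 jz)\,\mathcal M_I\Big(-\frac{\mathrm jzT}{G^{(0)}}\Big|x\Big)\Big\}\mathcal L_s(x)\,\frac{dz\,dx}{z},$$ and these double integrals converge absolutely. Here $\mathcal M_s(z)=(1+z\Omega_s/m_s)^{-m_s}$; $\mathcal L_s(x)=\widehat\Lambda_s^{(1)}(x)\exp(-\sum_r\widehat\Lambda_r([0,x)))$ with $\widehat\Lambda_s^{(1)}(x)=\pi\lambda_{BS}\Theta_s\frac{2}{\alpha_s}\kappa_s^{-2/\alpha_s}x^{2/\alpha_s-1}p_s((x/\kappa_s)^{1/\alpha_s})$ and $\widehat\Lambda_s$ in closed form; $\mathcal M_I(z|x)=\exp(\sum_r\widehat{\mathcal T}_r(z,x))$; and, with $\mathcal H$ the indicator of $[0,\infty)$, $\overline{\mathcal H}=1-\mathcal H$, $\ell_{r,b}=\kappa_rD_b^{\alpha_r}$ and $\lambda^{(I)}=(1-p_{off})\lambda_{BS}$, $$\begin{aligned}\widehat{\mathcal T}_r(z,x)=\pi\lambda^{(I)}\Theta_r\Big[&\big(\tfrac{x}{\kappa_r}\big)^{2/\alpha_r}\mathcal F_r(z)\sum_{b=1}^{B}q_{r,b}\overline{\mathcal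 H}(x-\ell_{r,b})\mathcal H(x-\ell_{r,b-1})\\&+\sum_{b=1}^{B}q_{r,b}\Big(D_{b-1}^2\mathcal F_r\big(\tfrac{xz}{\ell_{r,b-1}}\big)\overline{\mathcal H}(x-\ell_{r,b-1})-D_b^2\mathcal F_r\big(\tfrac{xz}{\ell_{r,b}}\big)\overline{\mathcal H}(x-\ell_{r,b})\Big)\\&+q_{r,B+1}\Big(D_B^2\mathcal F_r\big(\tfrac{xz}{\ell_{r,B}}\big)\overline{\mathcal H}(x-\ell_{r,B})+\big(\tfrac{x}{\kappa_r}\big)^{2/\alpha_r}\mathcal F_r(z)\mathcal H(x-\ell_{r,B})\Big)\Big]\end{aligned}$$ (terms with $D_0=0$ vanish), where $\mathcal F_r(z)=1-\sum_{l_1,l_2}\frac{\omega_{BS}^{(l_1)}}{2\pi}\frac{\omega_{MT}^{(l_2)}}{2\pi}\,{}_2F_1\big(m_r,-\tfrac2{\alpha_r};1-\tfrac2{\alpha_r};-z\tfrac{\Omega_r}{m_r}\gamma_{BS}^{(l_1)}\gamma_{MT}^{(l_2)}\big)$, with ${}_2F_1$ the principal branch on $\mathbb C\setminus[1,\infty)$.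 -/

import Mathlib

open MeasureTheory ProbabilityTheory Set
open scoped ENNReal NNReal

noncomputable section

namespace Cellular

/-! ### Gauss hypergeometric function on the cut plane -/

/-- The complex plane cut along `[1, ∞)`. -/
def cutPlane : Set ℂ := {z | ¬ (1 ≤ z.re ∧ z.im = 0)}

/-- The principal branch of the Gauss hypergeometric function `₂F₁(a, b; c; ·)`: the (unique)
holomorphic function on `ℂ \ [1, ∞)` that is given by the hypergeometric series in the unit disc.
It exists whenever `c` is not a non-positive integer. -/
def gaussHyp (a b c : ℂ) : ℂ → ℂ :=
  Classical.epsilon fun f : ℂ → ℂ =>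
    DifferentiableOn ℂ f cutPlane ∧ ∀ z ∈ Metric.ball (0 : ℂ) 1, f z = ordinaryHypergeometric a b c z

/-! ### Poisson point processes -/

/-- The number of points of the random set `Φ` that fall in `A`. -/
def count {Ω E : Type*} (Φ : Ω → Set E) (A : Set E) (ω : Ω) : ℕ∞ := (Φ ω ∩ A).encard

/-- `Φ` is a Poisson point process with intensity measure `μ`: a random countable set such that
the number of points in a measurable set `A` is Poisson distributed with mean `μ A` (almost surely
infinite if `μ A = ∞`) and the numbers of points in disjoint measurable sets are independent. -/
structure IsPoissonProcess {Ω E : Type*} [MeasurableSpace Ω] [MeasurableSpace E]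
    (Φ : Ω → Set E) (μ : Measure E) (P : Measure Ω) : Prop where
  countable : ∀ ω, (Φ ω).Countable
  measurable_count : ∀ A, MeasurableSet A → Measurable (count Φ A)
  poisson : ∀ A, MeasurableSet A → μ A ≠ ∞ → ∀ k : ℕ,
    P {ω | count Φ A ω = k} = poissonMeasure (μ A).toNNReal {k}
  infinite : ∀ A, MeasurableSet A → μ A = ∞ → ∀ᵐ ω ∂P, count Φ A ω = ⊤
  indep : ∀ (n : ℕ) (A : Fin n → Set E), (∀ i, MeasurableSet (A i)) →
    Pairwise (fun i j => Disjoint (A i) (A j)) → iIndepFun (fun i => count Φ (A i)) P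

/-- The σ-algebra generated by a point process, i.e. by all its counting variables. -/
abbrev generatedBy {Ω E : Type*} [MeasurableSpace E] (Φ : Ω → Set E) : MeasurableSpace Ω :=
  ⨆ (A : Set E) (_ : MeasurableSet A), MeasurableSpace.comap (count Φ A) inferInstance

/-! ### Parameters of the network -/

/-- A multi-lobe antenna radiation pattern with `K` lobes: the gain is `γ l` if the absolute value
of the angle lies in `[φ_{l-1}, φ_l)`, where `0 = φ_0 < φ_1 < ⋯ < φ_K = π`. -/
structure Antenna where
  K : ℕ
  φ : Fin (K + 1) → ℝ
  γ : Fin K → ℝ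
  φ_zero : φ 0 = 0
  φ_last : φ (Fin.last K) = Real.pi
  φ_strictMono : StrictMono φ
  γ_nonneg : ∀ l, 0 ≤ γ l

/-- The gain of the antenna in the direction `θ`. -/
def Antenna.gain (A : Antenna) (θ : ℝ) : ℝ :=
  ∑ l : Fin A.K, A.γ l * (Ico (A.φ l.castSucc) (A.φ l.succ)).indicator (fun _ => 1) |θ|

/-- The angular width `2 (φ_l - φ_{l-1})` of a lobe. -/
def Antenna.width (A : Antenna) (l : Fin A.K) : ℝ := 2 * (A.φ l.succ - A.φ l.castSucc)

/-- The parameters of the (approximated) cellular network. The finite type `S` is the set of link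
states (other than outage, in which nothing is received) and `B` is the number of balls. The radii
are `0 = D 0 < D 1 < ⋯ < D B`; for `b < B`, `q s b` is the probability that a link whose length is
in `[D b, D (b + 1))` is in state `s`, and `q s (Fin.last B)` is this probability for the lengths
in `[D B, ∞)`. A possible deficit `1 - ∑ s, q s b` is the probability of outage; the outage is not
almost sure at large distances. -/
structure Network (S : Type*) [Fintype S] (B : ℕ) where
  /-- density of base stations -/
  lamBS : ℝ
  /-- density of mobile terminals -/
  lamMT : ℝ
  /-- number of resource blocks of a base station -/
  NRB : ℕ
  /-- power budget of a base station -/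
  PBS : ℝ
  /-- noise power in a resource block -/
  noise : ℝ
  /-- directivity gain of the intended link -/
  G0 : ℝ
  antBS : Antenna
  antMT : Antenna
  /-- path-loss constants -/
  κ : S → ℝ
  /-- path-loss slopes -/
  α : S → ℝ
  /-- means of the log-normal shadowing, in dB -/
  μdB : S → ℝ
  /-- standard deviations of the log-normal shadowing, in dB -/
  σdB : S → ℝ
  /-- fading parameters -/
  m : S → ℝ
  /-- mean fading gains -/
  Om : S → ℝ
  /-- radii of the balls -/
  D : Fin (B + 1) → ℝ
  /-- link state probabilities -/
  q : S → Fin (B + 1) → ℝ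
  lamBS_pos : 0 < lamBS
  lamMT_pos : 0 < lamMT
  NRB_pos : 0 < NRB
  PBS_pos : 0 < PBS
  noise_nonneg : 0 ≤ noise
  G0_pos : 0 < G0
  κ_pos : ∀ s, 0 < κ s
  two_lt_α : ∀ s, 2 < α s
  m_pos : ∀ s, 0 < m s
  Om_pos : ∀ s, 0 < Om s
  D_zero : D 0 = 0
  D_strictMono : StrictMono D
  q_nonneg : ∀ s b, 0 ≤ q s b
  q_sum_le : ∀ b, ∑ s, q s b ≤ 1
  q_last_pos : 0 < ∑ s, q s (Fin.last B)

namespace Network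

variable {S : Type*} [Fintype S] {B : ℕ} (net : Network S B)

/-- Transmit power per resource block. -/
def PRB : ℝ := net.PBS / net.NRB

/-! ### Load model -/

/-- Law of the area of a cell: gamma with shape `3.5` and mean `1 / lamBS`. -/
def areaLaw : Measure ℝ := gammaMeasure (7 / 2) (7 / 2 * net.lamBS)

/-- Probability that a region of area `a` contains `n` mobile terminals. -/
def mtProb (n : ℕ) (a : ℝ) : ℝ :=
  Real.exp (-(net.lamMT * a)) * (net.lamMT * a) ^ n / (n.factorial : ℝ)

/-- Probability that `n` mobile terminals are associated to a generic base station. -/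
def loadProb (n : ℕ) : ℝ := ∫ a, net.mtProb n a ∂net.areaLaw

/-- Probability that the base station of a given mobile terminal serves `n` other mobile terminals;
the cell that contains a given terminal has the area-biased law `(a / 𝔼 area) · areaLaw(da)`. -/
def otherLoadProb (n : ℕ) : ℝ := ∫ a, net.mtProb n a * (net.lamBS * a) ∂net.areaLaw

/-- Probability that a base station is not active on a resource block. -/
def pOff : ℝ := ∑ n ∈ Finset.range (net.NRB + 1), (1 - (n : ℝ) / net.NRB) * net.loadProb n

/-- Probability that a mobile terminal is scheduled for transmission: it is if at most
`NRB - 1` others compete with it, and with probability `NRB / (n + 1)` if `n ≥ NRB` others do. -/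
def pSel : ℝ :=
  ∑ n ∈ Finset.range net.NRB, net.otherLoadProb n +
    ∑' k : ℕ, (net.NRB : ℝ) / ((net.NRB + k : ℕ) + 1) * net.otherLoadProb (net.NRB + k)

/-! ### The point processes of the base stations -/

/-- Multi-ball link state model: the probability that a link of length `r` is in state `s`. -/
def stateProb (s : S) (r : ℝ) : ℝ :=
  ∑ b : Fin B, net.q s b.castSucc * (Ico (net.D b.castSucc) (net.D b.succ)).indicator (fun _ => 1) r
    + net.q s (Fin.last B) * (Ici (net.D (Fin.last B))).indicator (fun _ => 1) r

/-- The factor `Θ_s = 𝔼 [X_s ^ (2 / α_s)]`, a fractional moment of the log-normal shadowing. -/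
def Theta (s : S) : ℝ :=
  Real.exp (2 * (net.μdB s * Real.log 10 / 10) / net.α s
    + 2 * (net.σdB s * Real.log 10 / 10) ^ 2 / net.α s ^ 2)

/-- A link between a base station and the typical mobile terminal (at the origin): the location of
the base station, its activity on the resource block, the fading gain of the link and the angles of
the link with respect to the boresights of the base station and of the mobile terminal. -/
abbrev Link : Type := EuclideanSpace ℝ (Fin 2) × Bool × ℝ × ℝ × ℝ

/-- Intensity measure of the locations of the base stations whose links are in state `s`. -/
def locationIntensity (s : S) : Measure (EuclideanSpace ℝ (Fin 2)) :=
  volume.withDensity fun y => ENNReal.ofReal (net.lamBS * net.stateProb s ‖y‖ * net.Theta s)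

/-- Law of the activity of a base station. -/
def activityLaw : Measure Bool :=
  ENNReal.ofReal (1 - net.pOff) • Measure.dirac true + ENNReal.ofReal net.pOff • Measure.dirac false

/-- The uniform distribution on `[-π, π)`. -/
def angleLaw : Measure ℝ :=
  (ENNReal.ofReal (2 * Real.pi))⁻¹ • volume.restrict (Ico (-Real.pi) Real.pi)

/-- Law of the marks of a link in state `s`: activity, fading (gamma distribution with shape `m s`
and mean `Om s`) and the two angles are independent. -/
def markLaw (s : S) : Measure (Bool × ℝ × ℝ × ℝ) :=
  net.activityLaw.prod ((gammaMeasure (net.m s) (net.m s / net.Om s)).prod (angleLaw.prod angleLaw))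

/-- Intensity measure of the independently marked Poisson process of the links in state `s`. -/
def linkIntensity (s : S) : Measure Link := (net.locationIntensity s).prod (net.markLaw s)

/-- The random links of the network: for every state, the links in this state are an independently
marked Poisson process, and the processes of the different states are independent. -/
structure IsRealization {Ω : Type*} [MeasurableSpace Ω] (P : Measure Ω) (Φ : S → Ω → Set Link) :
    Prop where
  poisson : ∀ s, IsPoissonProcess (Φ s) (net.linkIntensity s) P
  indep : iIndep (fun s => generatedBy (Φ s)) P

/-! ### SINR and potential throughput -/

/-- Path-loss of a link in state `s`, i.e. the inverse of its average received power. -/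
def pathLoss (s : S) (p : Link) : ℝ := net.κ s * ‖p.1‖ ^ net.α s

/-- Interfering power received over a link in state `s` when the serving link has path-loss `x`:
only the active base stations of larger path-loss interfere. -/
def interferingPower (x : ℝ) (s : S) (p : Link) : ℝ≥0∞ :=
  if p.2.1 = true ∧ x < net.pathLoss s p then
    ENNReal.ofReal (net.PRB * (net.antBS.gain p.2.2.2.1 * net.antMT.gain p.2.2.2.2) * p.2.2.1
      / net.pathLoss s p)
  else 0

/-- Aggregate other-cell interference of the configuration `φ` of links. -/
def interference (φ : S → Set Link) (x : ℝ) : ℝ≥0∞ :=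
  ∑ s, ∑' p : φ s, net.interferingPower x s p

/-- The base station of the link `p` in state `s` offers the smallest path-loss. -/
def IsServing (φ : S → Set Link) (s : S) (p : Link) : Prop :=
  ∀ r, ∀ p' ∈ φ r, net.pathLoss s p ≤ net.pathLoss r p'

/-- SINR at the typical mobile terminal if it is served over the link `p` in state `s`. -/
def linkSINR (φ : S → Set Link) (s : S) (p : Link) : ℝ≥0∞ :=
  ENNReal.ofReal (net.PRB * net.G0 * p.2.2.1 / net.pathLoss s p) /
    (ENNReal.ofReal net.noise + net.interference φ (net.pathLoss s p))

/-- SINR at the typical mobile terminal: the SINR of the serving link, which is almost surely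
unique (formally: the supremum over the serving links). -/
def SINR (φ : S → Set Link) : ℝ≥0∞ :=
  ⨆ s, ⨆ p ∈ φ s, ⨆ _ : net.IsServing φ s p, net.linkSINR φ s p

/-- Potential throughput for the decoding threshold `T`. -/
def potentialThroughput {Ω : Type*} [MeasurableSpace Ω] (P : Measure Ω) (Φ : S → Ω → Set Link)
    (T : ℝ) : ℝ :=
  net.lamMT * net.pSel * Real.logb 2 (1 + T) *
    P.real {ω | ENNReal.ofReal T ≤ net.SINR fun s => Φ s ω}

/-! ### The functions of the closed-form expression -/

/-- Heaviside function. -/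
def heav (x : ℝ) : ℝ := if 0 ≤ x then 1 else 0

/-- Complementary Heaviside function. -/
def heavC (x : ℝ) : ℝ := 1 - heav x

/-- `κ_s D_b ^ α_s`, the path-loss in state `s` at the distance `D_b`. -/
def lossAt (s : S) (b : Fin (B + 1)) : ℝ := net.κ s * net.D b ^ net.α s

/-- The approximated intensity measure of `[0, ξ)` of the path-loss process in state `s`. -/
def LamHat (s : S) (ξ : ℝ) : ℝ :=
  Real.pi * net.lamBS * net.Theta s * ∑ b : Fin B, net.q s b.castSucc
      * heavC (ξ - net.lossAt s b.succ) * heav (ξ - net.lossAt s b.castSucc)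
      * ((ξ / net.κ s) ^ (2 / net.α s) - net.D b.castSucc ^ 2)
    + Real.pi * net.lamBS * net.Theta s * ∑ b : Fin B, net.q s b.castSucc
      * heav (ξ - net.lossAt s b.succ) * (net.D b.succ ^ 2 - net.D b.castSucc ^ 2)
    + Real.pi * net.lamBS * net.Theta s * net.q s (Fin.last B)
      * heav (ξ - net.lossAt s (Fin.last B))
      * ((ξ / net.κ s) ^ (2 / net.α s) - net.D (Fin.last B) ^ 2)

/-- The first derivative of the approximated intensity measure. -/
def LamHat' (s : S) (ξ : ℝ) : ℝ :=
  Real.pi * net.lamBS * net.Theta s * (2 / net.α s) * net.κ s ^ (-(2 / net.α s))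
      * ξ ^ (2 / net.α s - 1)
      * ∑ b : Fin B, net.q s b.castSucc
        * heavC (ξ - net.lossAt s b.succ) * heav (ξ - net.lossAt s b.castSucc)
    + Real.pi * net.lamBS * net.Theta s * (2 / net.α s) * net.κ s ^ (-(2 / net.α s))
      * ξ ^ (2 / net.α s - 1)
      * net.q s (Fin.last B) * heav (ξ - net.lossAt s (Fin.last B))

/-- The function `ℒ_s`. -/
def ell (s : S) (x : ℝ) : ℝ := net.LamHat' s x * Real.exp (-∑ r, net.LamHat r x)

/-- The moment generating function of the fading gain in state `s`. -/
def fadingMGF (s : S) (z : ℂ) : ℂ := (1 + z * net.Om s / net.m s) ^ (-(net.m s : ℂ))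

/-- The function `ℱ_s`. -/
def calF (s : S) (z : ℂ) : ℂ :=
  1 - ∑ l₁ : Fin net.antBS.K, ∑ l₂ : Fin net.antMT.K,
    (net.antBS.width l₁ / (2 * Real.pi) : ℝ) * (net.antMT.width l₂ / (2 * Real.pi) : ℝ) *
      gaussHyp (net.m s) (-(2 / net.α s)) (1 - 2 / net.α s)
        (-(z * (net.Om s / net.m s) * (net.antBS.γ l₁ * net.antMT.γ l₂)))

/-- Density of the base stations that are active on a resource block. -/
def lamI : ℝ := (1 - net.pOff) * net.lamBS

/-- The exponent `𝒯_r(z, x)` of the moment generating function of the interference. -/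
def calT (r : S) (z : ℂ) (x : ℝ) : ℂ :=
  (Real.pi * net.lamI * net.Theta r * (x / net.κ r) ^ (2 / net.α r) : ℝ) * net.calF r z
      * ∑ b : Fin B, ((net.q r b.castSucc * (heavC (x - net.lossAt r b.succ)
          * heav (x - net.lossAt r b.castSucc)) : ℝ) : ℂ)
    + (Real.pi * net.lamI * net.Theta r : ℝ)
      * ∑ b : Fin B, (net.q r b.castSucc : ℂ)
        * ((net.D b.castSucc ^ 2 : ℝ) * net.calF r (x * z / (net.lossAt r b.castSucc : ℝ))
            * (heavC (x - net.lossAt r b.castSucc) : ℝ)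
          - (net.D b.succ ^ 2 : ℝ) * net.calF r (x * z / (net.lossAt r b.succ : ℝ))
            * (heavC (x - net.lossAt r b.succ) : ℝ))
    + (Real.pi * net.lamI * net.Theta r : ℝ) * net.q r (Fin.last B)
      * ((net.D (Fin.last B) ^ 2 : ℝ) * net.calF r (x * z / (net.lossAt r (Fin.last B) : ℝ))
          * (heavC (x - net.lossAt r (Fin.last B)) : ℝ)
        + ((x / net.κ r) ^ (2 / net.α r) : ℝ) * net.calF r z
          * (heav (x - net.lossAt r (Fin.last B)) : ℝ))

/-- The (normalized) moment generating function of the interference given the serving path-loss. -/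
def interferenceMGF (z : ℂ) (x : ℝ) : ℂ := Complex.exp (∑ r, net.calT r z x)

/-- The integrand of the two-fold integral, for the state `s`. -/
def integrand (T : ℝ) (s : S) (x z : ℝ) : ℝ :=
  (Complex.exp (Complex.I * (z * x * net.noise * T / (net.G0 * net.PRB) : ℝ))
      * net.fadingMGF s (Complex.I * z)
      * net.interferenceMGF (-(Complex.I * (z * T / net.G0 : ℝ))) x).im
    * net.ell s x / z

/-- The two-fold integral `C̄(T)`. -/
def Cbar (T : ℝ) : ℝ :=
  ∑ s, ∫ x in Ioi (0 : ℝ), ∫ z in Ioi (0 : ℝ), net.integrand T s x z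

end Network

end Cellular

end

namespace Cellular

/-! ### The Gauss hypergeometric function as an integral -/

section Hypergeometric

open Filter Topology

/-! The argument conditions on the serving link and inverts a characteristic function.

The links of all states together form one Poisson process on `S × Link`, and the serving link is its
point of smallest path-loss. By the void probability, this point lies in state `s` at path-loss `x`
with density `ell s x`. Its fading is still gamma distributed, and the points beyond `x` are
independent of it and still Poisson (`measure_first`). Given `s` and `x`, coverage means `X ≤ g`,
where `g` is the fading gain of the serving link and `X = x T (noise + I) / (G0 * PRB)` is
`requiredGain`. Since `X` and `g` are independent and `g` has no atoms, the Gil-Pelaez formula for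
`X - g` (`gilPelaez`) expresses the probability of `X ≤ g` as `1/2` minus `1/π` times the integral
of `Im φ(z) / z`. Here `φ` is `sinrFactor`: a phase from the noise, the characteristic function of
the interference, and `fadingMGF` on the imaginary axis. Integration against `ell` and summation
over `s` give the claim, because the functions `ell s` have total mass one (`sum_integral_ell`).

Two computations make `φ` explicit. The characteristic functional of a Poisson process
(`integral_cexp_lintegral`) turns the interference into the exponential of an integral over
path-losses `L > x`. Averaging over fading and angles leaves terms `(1 - W / L) ^ (-m) - 1`, with
`W` purely imaginary, against a power of `L`. Their integral over a half-line is a value of `₂F₁(m,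
-δ; 1 - δ; ·)` with `δ = 2 / α` (`gaussHyp_eq_integral`), and the link-state bands contribute
differences of such half-line integrals.

Absolute convergence combines three bounds. For small `z`, `|Im φ(z)| ≤ z E|X - g|`, and this mean
grows at most linearly in `x`. For large `z`, `fadingMGF` decays like `z ^ (-m)`. Finally `(1 + x) *
ell s x` is integrable, because the intensity of path-losses in `[0, x]` grows at least like a power
of `x`; this uses that outage is not certain at large distances.

The scheduling probability `pSel` is a common factor on both sides; of the load model, only `0 ≤
pOff ≤ 1` matters. -/

theorem isOpen_cutPlane : IsOpen cutPlane := by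
  have : cutPlane = (fun z : ℂ => 1 - z) ⁻¹' Complex.slitPlane := by
    ext z
    simp only [cutPlane, mem_ofPred_eq, mem_preimage, Complex.mem_slitPlane_iff, Complex.sub_re,
      Complex.one_re, Complex.sub_im, Complex.one_im, zero_sub, neg_ne_zero, sub_pos]
    rw [not_and_or, not_le]
  rw [this]
  exact Complex.isOpen_slitPlane.preimage (by fun_prop)

theorem one_sub_mul_mem_slitPlane {w : ℂ} (hw : w ∈ cutPlane) {u : ℝ} (h0 : 0 ≤ u) (h1 : u ≤ 1) :
    1 - w * u ∈ Complex.slitPlane := by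
  simp only [Complex.mem_slitPlane_iff, Complex.sub_re, Complex.one_re, Complex.mul_re,
    Complex.ofReal_re, Complex.ofReal_im, mul_zero, sub_zero, Complex.sub_im, Complex.one_im,
    Complex.mul_im, zero_add, zero_sub]
  simp only [cutPlane, mem_ofPred_eq, not_and_or, not_le] at hw
  rcases eq_or_lt_of_le h0 with rfl | hu
  · simp
  rcases hw with h | h
  · left
    by_cases hre : w.re ≤ 0
    · nlinarith
    · nlinarith
  · right
    simp [h, hu.ne']

/-- The cut plane is star-shaped about the origin: shrinking a point towards `0` cannot move it onto
the ray `[1, ∞)`. -/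
theorem isPreconnected_cutPlane : IsPreconnected cutPlane := by
  have : StarConvex ℝ (0 : ℂ) cutPlane := by
    rw [starConvex_zero_iff]
    intro z hz a ha0 ha1
    have := one_sub_mul_mem_slitPlane hz ha0 ha1
    simp only [Complex.mem_slitPlane_iff, Complex.sub_re, Complex.one_re, Complex.mul_re,
      Complex.ofReal_re, Complex.ofReal_im, mul_zero, sub_zero, Complex.sub_im, Complex.one_im,
      Complex.mul_im, zero_add, zero_sub] at this
    simp only [cutPlane, mem_ofPred_eq, not_and_or, not_le, Complex.smul_re, Complex.smul_im,
      smul_eq_mul]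
    rcases this with h | h
    · left; linarith
    · right; intro h'; apply h; rw [mul_comm, h', neg_zero]
  exact (this.isPathConnected (by simp [cutPlane])).isConnected.isPreconnected

/-- The choice operator in `gaussHyp` carries information only once some branch exists. A candidate
`f` supplies existence, and the identity theorem on the connected cut plane then forces the chosen
function to agree with `f`. -/
theorem gaussHyp_eqOn {a b c : ℂ} {f : ℂ → ℂ} (hf : DifferentiableOn ℂ f cutPlane)
    (hs : ∀ z ∈ Metric.ball (0 : ℂ) 1, f z = ordinaryHypergeometric a b c z) :
    EqOn (gaussHyp a b c) f cutPlane := by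
  have hg := Classical.epsilon_spec (p := fun f : ℂ → ℂ =>
    DifferentiableOn ℂ f cutPlane ∧
      ∀ z ∈ Metric.ball (0 : ℂ) 1, f z = ordinaryHypergeometric a b c z) ⟨f, hf, hs⟩
  refine (hg.1.analyticOnNhd isOpen_cutPlane).eqOn_of_preconnected_of_eventuallyEq
    (hf.analyticOnNhd isOpen_cutPlane) isPreconnected_cutPlane (z₀ := 0)
    (by simp [cutPlane]) ?_
  filter_upwards [Metric.ball_mem_nhds (0 : ℂ) one_pos] with z hz
  rw [hs z hz]
  exact hg.2 z hz

/-- The integrand in the integral representation of `₂F₁(m, -d; 1 - d; w)`. -/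
noncomputable def hypKernel (m : ℂ) (d : ℝ) (w : ℂ) (t : ℝ) : ℂ :=
  (1 - (1 - w / t) ^ (-m)) * ((d * t ^ (d - 1) : ℝ) : ℂ)

/-- Compactness of a closed ball times `[0, 1]`, on which `1 - w u` avoids the cut of the power.
With `u = 1 / t` this gives uniformity over all `t > 1`, as needed to differentiate under the
integral sign. -/
theorem exists_bound_cpow (m w₀ : ℂ) (hw : w₀ ∈ cutPlane) :
    ∃ ε > 0, Metric.closedBall w₀ ε ⊆ cutPlane ∧ ∃ C, 0 ≤ C ∧
      ∀ w ∈ Metric.closedBall w₀ ε, ∀ u ∈ Icc (0 : ℝ) 1, ‖(1 - w * u) ^ m‖ ≤ C := by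
  obtain ⟨ε, hε, hb⟩ := Metric.nhds_basis_closedBall.mem_iff.1 (isOpen_cutPlane.mem_nhds hw)
  refine ⟨ε, hε, hb, ?_⟩
  have hc : ContinuousOn (fun p : ℂ × ℝ => (1 - p.1 * p.2) ^ m)
      (Metric.closedBall w₀ ε ×ˢ Icc (0 : ℝ) 1) := by
    apply ContinuousOn.cpow_const (by fun_prop)
    rintro ⟨w, u⟩ ⟨h1, h2⟩
    exact one_sub_mul_mem_slitPlane (hb h1) h2.1 h2.2
  obtain ⟨C, hC⟩ := ((isCompact_closedBall w₀ ε).prod isCompact_Icc).exists_bound_of_continuousOn hc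
  refine ⟨max C 0, le_max_right _ _, fun w h1 u h2 => (hC (w, u) ⟨h1, h2⟩).trans (le_max_left _ _)⟩

theorem hasDerivAt_one_sub_mul_cpow (m : ℂ) {w : ℂ} (hw : w ∈ cutPlane) {u : ℝ}
    (h0 : 0 ≤ u) (h1 : u ≤ 1) :
    HasDerivAt (fun w : ℂ => (1 - w * u) ^ (-m)) (m * u * (1 - w * u) ^ (-m - 1)) w := by
  have h : HasDerivAt (fun w : ℂ => 1 - w * u) (-(1 * (u : ℂ))) w :=
    ((hasDerivAt_id w).mul_const (u : ℂ)).const_sub 1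
  convert h.cpow_const (c := -m) (one_sub_mul_mem_slitPlane hw h0 h1) using 1
  ring

/-- Mean value inequality in `u`, starting from `u = 0`. The factor `u = 1 / t` improves the decay
of `hypKernel` from `t ^ (d - 1)` to `t ^ (d - 2)`, which is integrable at infinity for `d < 1`. -/
theorem norm_one_sub_cpow_le {m w : ℂ} (hw : w ∈ cutPlane) {C : ℝ}
    (hC : ∀ u ∈ Icc (0 : ℝ) 1, ‖(1 - w * u) ^ (-m - 1)‖ ≤ C) {u : ℝ} (hu : u ∈ Icc (0 : ℝ) 1) :
    ‖1 - (1 - w * u) ^ (-m)‖ ≤ ‖m‖ * ‖w‖ * C * u := by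
  have hd : ∀ v ∈ Icc (0 : ℝ) 1, HasDerivWithinAt (fun v : ℝ => (1 - w * v) ^ (-m))
      (m * w * (1 - w * v) ^ (-m - 1)) (Icc 0 1) v := by
    intro v hv
    have h : HasDerivAt (fun v : ℝ => 1 - w * (v : ℂ)) (-(w * 1)) v :=
      ((Complex.ofRealCLM.hasDerivAt (x := v)).const_mul w).const_sub 1
    have h2 := (hasDerivAt_id' (1 - w * (v : ℂ))).cpow_const (c := -m)
      (one_sub_mul_mem_slitPlane hw hv.1 hv.2)
    have h3 := (h2.scomp v h).hasDerivWithinAt (s := Icc 0 1)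
    have h4 : m * w * (1 - w * v) ^ (-m - 1) = -(w * 1) • (-m * (1 - w * v) ^ (-m - 1) * 1) := by
      rw [smul_eq_mul]
      ring
    rw [h4]
    exact h3
  have hb : ∀ v ∈ Icc (0 : ℝ) 1, ‖m * w * (1 - w * v) ^ (-m - 1)‖ ≤ ‖m‖ * ‖w‖ * C := by
    intro v hv
    rw [norm_mul, norm_mul]
    gcongr
    exact hC v hv
  have := (convex_Icc (0 : ℝ) 1).norm_image_sub_le_of_norm_hasDerivWithin_le hd hb
    (x := u) (y := 0) hu (by simp)
  simpa [abs_of_nonneg hu.1] using this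

theorem inv_mem_Icc {t : ℝ} (ht : 1 < t) : t⁻¹ ∈ Icc (0 : ℝ) 1 :=
  ⟨by positivity, inv_le_one_of_one_le₀ ht.le⟩

theorem aestronglyMeasurable_hypKernel {m w : ℂ} (d : ℝ) :
    AEStronglyMeasurable (hypKernel m d w) (volume.restrict (Ioi 1)) := by
  unfold hypKernel
  exact Measurable.aestronglyMeasurable (by fun_prop)

theorem rpow_sub_one_mul_inv {d t : ℝ} (ht : 1 < t) : t ^ (d - 1) * t⁻¹ = t ^ (d - 2) := by
  have h0 : 0 < t := by linarith
  rw [← Real.rpow_neg_one, ← Real.rpow_add h0]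
  congr 1
  ring

theorem integrableOn_hypKernel {m w : ℂ} {d : ℝ} (hd0 : 0 < d) (hd : d < 1) (hw : w ∈ cutPlane) :
    IntegrableOn (hypKernel m d w) (Ioi 1) := by
  obtain ⟨ε, hε, hb, C, hC0, hC⟩ := exists_bound_cpow (-m - 1) w hw
  have hC' := hC w (Metric.mem_closedBall_self hε.le)
  refine Integrable.mono' (g := fun t => ‖m‖ * ‖w‖ * C * d * t ^ (d - 2))
    ((integrableOn_Ioi_rpow_of_lt (by linarith) one_pos).const_mul _)
    (aestronglyMeasurable_hypKernel d) ?_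
  filter_upwards [ae_restrict_mem measurableSet_Ioi] with t ht
  have ht' : (1 : ℝ) < t := ht
  have h := norm_one_sub_cpow_le hw hC' (inv_mem_Icc ht)
  rw [hypKernel, norm_mul, Complex.norm_real, Real.norm_eq_abs, abs_of_nonneg (by positivity),
    ← rpow_sub_one_mul_inv ht']
  rw [Complex.ofReal_inv, ← div_eq_mul_inv] at h
  calc _ ≤ ‖m‖ * ‖w‖ * C * t⁻¹ * (d * t ^ (d - 1)) := by gcongr
    _ = _ := by ring

theorem differentiableOn_hypIntegral {m : ℂ} {d : ℝ} (hd0 : 0 < d) (hd : d < 1) :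
    DifferentiableOn ℂ (fun w => 1 + ∫ t in Ioi (1 : ℝ), hypKernel m d w t) cutPlane := by
  intro w₀ hw₀
  apply DifferentiableAt.differentiableWithinAt
  obtain ⟨ε, hε, hb, C, hC0, hC⟩ := exists_bound_cpow (-m - 1) w₀ hw₀
  refine ((hasDerivAt_integral_of_dominated_loc_of_deriv_le (μ := volume.restrict (Ioi (1 : ℝ)))
    (F := fun w t => hypKernel m d w t)
    (F' := fun w t => -(m * (t⁻¹ : ℝ) * (1 - w * (t⁻¹ : ℝ)) ^ (-m - 1)) *
      ((d * t ^ (d - 1) : ℝ) : ℂ))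
    (bound := fun t => ‖m‖ * C * d * t ^ (d - 2))
    (Metric.ball_mem_nhds w₀ hε) (Eventually.of_forall fun w => aestronglyMeasurable_hypKernel d)
    (integrableOn_hypKernel hd0 hd hw₀) (Measurable.aestronglyMeasurable (by fun_prop)) ?_
    ((integrableOn_Ioi_rpow_of_lt (by linarith) one_pos).const_mul _) ?_).2.differentiableAt).const_add 1
  · filter_upwards [ae_restrict_mem measurableSet_Ioi] with t ht w hw
    have ht' : (1 : ℝ) < t := ht
    have h := hC w (Metric.ball_subset_closedBall hw) _ (inv_mem_Icc ht)
    rw [norm_mul, norm_neg, norm_mul, norm_mul, Complex.norm_real, Complex.norm_real,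
      Real.norm_eq_abs, Real.norm_eq_abs, abs_of_nonneg (by positivity),
      abs_of_nonneg (by positivity), ← rpow_sub_one_mul_inv ht']
    calc _ ≤ ‖m‖ * t⁻¹ * C * (d * t ^ (d - 1)) := by gcongr
      _ = _ := by ring
  · filter_upwards [ae_restrict_mem measurableSet_Ioi] with t ht w hw
    have h := hasDerivAt_one_sub_mul_cpow m (hb (Metric.ball_subset_closedBall hw))
      (inv_mem_Icc ht).1 (inv_mem_Icc ht).2
    have h2 := (h.const_sub 1).mul_const ((d * t ^ (d - 1) : ℝ) : ℂ)
    refine h2.congr_of_eventuallyEq (Eventually.of_forall fun v => ?_)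
    simp [hypKernel, div_eq_mul_inv]

/-- The coefficients of the series of `(1 - x) ^ (-m)`. -/
noncomputable def negBinomCoeff (m : ℂ) (n : ℕ) : ℂ := (n.factorial : ℂ)⁻¹ * (ascPochhammer ℂ n).eval m

theorem choose_eq_negBinomCoeff (m : ℂ) (n : ℕ) : Ring.choose (m + n - 1) n = negBinomCoeff m n := by
  have h := Ring.factorial_nsmul_multichoose_eq_ascPochhammer m n
  rw [Ring.multichoose_eq, Polynomial.ascPochhammer_smeval_eq_eval, nsmul_eq_mul] at h
  rw [negBinomCoeff, ← h, ← mul_assoc, inv_mul_cancel₀ (by simp [Nat.factorial_ne_zero]), one_mul]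

theorem hasSum_negBinom (m : ℂ) {z : ℂ} (hz : ‖z‖ < 1) :
    HasSum (fun n => negBinomCoeff m n * z ^ n) ((1 - z) ^ (-m)) := by
  have h := (Complex.one_div_one_sub_cpow_hasFPowerSeriesOnBall_zero m).hasSum (y := z)
    (by simpa [enorm_eq_nnnorm, ← NNReal.coe_lt_coe] using hz)
  simpa [FormalMultilinearSeries.ofScalars_apply_eq, choose_eq_negBinomCoeff, Complex.cpow_neg,
    mul_comm] using h

theorem summable_norm_negBinom (m : ℂ) {z : ℂ} (hz : ‖z‖ < 1) :
    Summable fun n => ‖negBinomCoeff m n * z ^ n‖ := by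
  have h := (Complex.one_div_one_sub_cpow_hasFPowerSeriesOnBall_zero m)
  have h2 := FormalMultilinearSeries.summable_norm_apply _ (x := z)
    (Metric.eball_subset_eball h.r_le
      (by simpa [enorm_eq_nnnorm, ← NNReal.coe_lt_coe] using hz))
  simpa [FormalMultilinearSeries.ofScalars_apply_eq, choose_eq_negBinomCoeff, mul_comm] using h2

/-- Both sides are the rising factorial of `-d` of order `n + 1`, split off at its last and at its
first factor. Hence the quotient of the rising factorials of `-d` and `1 - d` of order `n` is `-d /
(n - d)`. -/
theorem ascPochhammer_neg_mul (d : ℂ) (n : ℕ) :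
    (ascPochhammer ℂ n).eval (-d) * (n - d) = -d * (ascPochhammer ℂ n).eval (1 - d) := by
  have h1 : (ascPochhammer ℂ (n + 1)).eval (-d) = (ascPochhammer ℂ n).eval (-d) * (n - d) := by
    rw [ascPochhammer_succ_right, Polynomial.eval_mul, Polynomial.eval_add, Polynomial.eval_X,
      Polynomial.eval_natCast]
    ring
  have h2 : (ascPochhammer ℂ (n + 1)).eval (-d) = -d * (ascPochhammer ℂ n).eval (1 - d) := by
    rw [ascPochhammer_succ_left]
    rw [Polynomial.eval_mul, Polynomial.eval_X, Polynomial.eval_comp, Polynomial.eval_add,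
      Polynomial.eval_X, Polynomial.eval_one, neg_add_eq_sub]
  rw [← h1, h2]

/-- Expand `(1 - z / t) ^ (-m)` in the binomial series and integrate termwise over `t > 1`. The
power `t ^ (d - 1 - n)` contributes `1 / (n - d)`, and `-d / (n - d)` is the quotient of Pochhammer
symbols in the hypergeometric coefficient. -/
theorem ordinaryHypergeometric_eq_hypIntegral {m : ℂ} {d : ℝ} (hd0 : 0 < d) (hd : d < 1) {z : ℂ}
    (hz : ‖z‖ < 1) :
    1 + ∫ t in Ioi (1 : ℝ), hypKernel m d z t = ordinaryHypergeometric m (-d : ℂ) (1 - d : ℂ) z := by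
  set G : ℕ → ℝ → ℂ := fun n t =>
    -(negBinomCoeff m (n + 1) * z ^ (n + 1) * d) * ((t ^ (d - 2 - n) : ℝ) : ℂ) with hG
  have hexp : ∀ n : ℕ, d - 2 - (n : ℝ) < -1 := fun n => by
    have : (0 : ℝ) ≤ n := n.cast_nonneg
    linarith
  have hpos : ∀ n : ℕ, 0 < (n : ℝ) + 1 - d := fun n => by
    have : (0 : ℝ) ≤ n := n.cast_nonneg
    linarith
  have hval : ∀ n : ℕ, ∫ t in Ioi (1 : ℝ), t ^ (d - 2 - n) = 1 / (n + 1 - d) := fun n => by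
    rw [integral_Ioi_rpow_of_lt (hexp n) one_pos, Real.one_rpow, neg_div, ← div_neg]
    congr 1
    ring
  have hint : ∀ n, Integrable (G n) (volume.restrict (Ioi (1 : ℝ))) := fun n =>
    ((integrableOn_Ioi_rpow_of_lt (hexp n) one_pos).ofReal (𝕜 := ℂ)).const_mul _
  have hnorm : ∀ n, ∫ t in Ioi (1 : ℝ), ‖G n t‖ =
      ‖negBinomCoeff m (n + 1) * z ^ (n + 1)‖ * (d / (n + 1 - d)) := fun n => by
    have : ∀ t ∈ Ioi (1 : ℝ), ‖G n t‖ =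
        ‖negBinomCoeff m (n + 1) * z ^ (n + 1)‖ * d * t ^ (d - 2 - n) := fun t ht => by
      have ht' : (0 : ℝ) < t := one_pos.trans ht
      rw [hG]
      simp only [norm_mul, norm_neg, Complex.norm_real, Real.norm_eq_abs]
      rw [abs_of_pos hd0, abs_of_nonneg (by positivity)]
    rw [setIntegral_congr_fun measurableSet_Ioi this, integral_const_mul, hval]
    ring
  have hsumm : Summable fun n => ∫ t in Ioi (1 : ℝ), ‖G n t‖ := by
    simp_rw [hnorm]
    refine Summable.of_nonneg_of_le (fun n => ?_) (fun n => ?_)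
      (((summable_nat_add_iff 1).2 (summable_norm_negBinom m hz)).mul_right (d / (1 - d)))
    · have := hpos n
      positivity
    · have h1 : 0 < 1 - d := by linarith
      have h2 : 1 - d ≤ n + 1 - d := by
        have : (0 : ℝ) ≤ n := n.cast_nonneg
        linarith
      gcongr
  have hs := hasSum_integral_of_summable_integral_norm hint hsumm
  have hI : ∀ n, ∫ t in Ioi (1 : ℝ), G n t =
      negBinomCoeff m (n + 1) * z ^ (n + 1) * (-d / (n + 1 - d)) := fun n => by
    rw [hG, integral_const_mul, integral_complex_ofReal, hval]
    push_cast
    ring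
  -- The constant term of the binomial series cancels the `1` in the kernel, so `G n` carries the
  -- term of order `n + 1`.
  have hlim : ∫ t in Ioi (1 : ℝ), ∑' n, G n t = ∫ t in Ioi (1 : ℝ), hypKernel m d z t := by
    refine setIntegral_congr_fun measurableSet_Ioi fun t ht => ?_
    have ht' : (1 : ℝ) < t := ht
    have ht0 : (0 : ℝ) < t := one_pos.trans ht
    have hzt : ‖z / t‖ < 1 := by
      rw [norm_div, Complex.norm_real, Real.norm_eq_abs, abs_of_pos ht0, div_lt_one ht0]
      linarith
    have h := (hasSum_nat_add_iff' 1).2 (hasSum_negBinom m hzt)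
    have h2 := (h.mul_left (-((d * t ^ (d - 1) : ℝ) : ℂ))).tsum_eq
    simp only [Finset.range_one, Finset.sum_singleton, pow_zero, mul_one] at h2
    have h0 : negBinomCoeff m 0 = 1 := by simp [negBinomCoeff]
    rw [h0] at h2
    rw [hypKernel]
    transitivity -((d * t ^ (d - 1) : ℝ) : ℂ) * ((1 - z / t) ^ (-m) - 1)
    · rw [← h2]
      refine tsum_congr fun n => ?_
      have : t ^ (d - 2 - n) = t ^ (d - 1) * (t ^ (n + 1))⁻¹ := by
        rw [← Real.rpow_natCast, ← Real.rpow_neg ht0.le, ← Real.rpow_add ht0]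
        congr 1
        push_cast
        ring
      rw [hG]
      simp only
      rw [this, div_pow]
      push_cast
      ring
    · ring
  rw [hlim] at hs
  simp_rw [hI] at hs
  rw [ordinaryHypergeometric_eq_tsum]
  simp only
  -- For `n = 0` the factor `-d / (n - d)` is `1`, which accounts for the summand outside the
  -- integral.
  have hfull : HasSum (fun n : ℕ => negBinomCoeff m n * z ^ n * (-d / (n - d)))
      (1 + ∫ t in Ioi (1 : ℝ), hypKernel m d z t) := by
    rw [← hasSum_nat_add_iff' 1]
    have hd' : (d : ℂ) ≠ 0 := by exact_mod_cast hd0.ne'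
    simp only [Finset.range_one, Finset.sum_singleton, pow_zero, mul_one, Nat.cast_zero, zero_sub,
      Nat.cast_add, Nat.cast_one]
    have h0 : negBinomCoeff m 0 = 1 := by simp [negBinomCoeff]
    rw [h0, one_mul, neg_div_neg_eq, div_self hd', add_sub_cancel_left]
    exact hs
  rw [← hfull.tsum_eq]
  refine tsum_congr fun n => ?_
  have h1 : ((n : ℂ) - d) ≠ 0 := by
    intro h
    have h' : (n : ℝ) = d := by exact_mod_cast sub_eq_zero.1 h
    rcases Nat.eq_zero_or_pos n with rfl | hn
    · simp at h'
      linarith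
    · have : (1 : ℝ) ≤ n := by exact_mod_cast hn
      linarith
  have h2 : (ascPochhammer ℂ n).eval (1 - d : ℂ) ≠ 0 := by
    have h3 : (1 - d : ℂ) = ((1 - d : ℝ) : ℂ) := by push_cast; ring
    have h4 : 0 < (ascPochhammer ℝ n).eval (1 - d) := ascPochhammer_pos n _ (by linarith)
    rw [h3, show (ascPochhammer ℂ n) = (ascPochhammer ℝ n).map Complex.ofRealHom by
      rw [ascPochhammer_map], ← Complex.ofRealHom_eq_coe, Polynomial.eval_map,
      Polynomial.eval₂_at_apply]
    simpa using h4.ne'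
  have h3 := ascPochhammer_neg_mul d n
  rw [smul_eq_mul, negBinomCoeff]
  field_simp
  linear_combination (-(n.factorial : ℂ)⁻¹ * (ascPochhammer ℂ n).eval m * z ^ n) * h3

theorem gaussHyp_eq_integral {m : ℂ} {d : ℝ} (hd0 : 0 < d) (hd : d < 1) {w : ℂ}
    (hw : w ∈ cutPlane) :
    gaussHyp m (-d : ℂ) (1 - d : ℂ) w = 1 + ∫ t in Ioi (1 : ℝ), hypKernel m d w t :=
  gaussHyp_eqOn (differentiableOn_hypIntegral hd0 hd)
    (fun _ hz => ordinaryHypergeometric_eq_hypIntegral hd0 hd (by simpa using hz)) hw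

theorem continuousOn_gaussHyp {m : ℂ} {d : ℝ} (hd0 : 0 < d) (hd : d < 1) :
    ContinuousOn (gaussHyp m (-d : ℂ) (1 - d : ℂ)) cutPlane :=
  (differentiableOn_hypIntegral hd0 hd).continuousOn.congr
    fun _ hw => gaussHyp_eq_integral hd0 hd hw

end Hypergeometric

/-! ### The inversion formula of Gil-Pelaez -/

section GilPelaez

open Filter Topology

theorem integral_exp_neg_mul_cos {ε : ℝ} (hε : 0 < ε) (w : ℝ) :
    ∫ z in Ioi (0 : ℝ), Real.exp (-ε * z) * Real.cos (z * w) = ε / (ε ^ 2 + w ^ 2) := by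
  have ha : (-(ε : ℂ) + w * Complex.I).re < 0 := by simp [hε]
  have h := integral_exp_mul_complex_Ioi ha 0
  have hint := integrableOn_exp_mul_complex_Ioi ha 0
  have h1 : ∀ z : ℝ, (Complex.exp ((-(ε : ℂ) + w * Complex.I) * z)).re =
      Real.exp (-ε * z) * Real.cos (z * w) := fun z => by
    rw [Complex.exp_re]
    simp [mul_comm]
  have h2 := integral_re (𝕜 := ℂ) hint
  simp only [RCLike.re_eq_complex_re, h1] at h2
  rw [h2, h]
  simp [Complex.inv_re, Complex.normSq_apply, neg_div]
  ring

theorem abs_sin_mul_div_le (w : ℝ) {z : ℝ} (hz : 0 < z) : |Real.sin (z * w) / z| ≤ |w| := by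
  rw [abs_div, abs_of_pos hz, div_le_iff₀ hz]
  calc _ ≤ |z * w| := Real.abs_sin_le_abs
    _ = |w| * z := by rw [abs_mul, abs_of_pos hz, mul_comm]

theorem integrableOn_exp_neg_mul {ε : ℝ} (hε : 0 < ε) :
    IntegrableOn (fun z => Real.exp (-ε * z)) (Ioi 0) := by
  simpa using integrableOn_exp_mul_Ioi (neg_lt_zero.2 hε) 0

/-- Both sides vanish at `w = 0` and have the same derivative in `w`, the Laplace transform of a
cosine. The damping `exp (-ε z)` replaces the conditionally convergent Dirichlet integral by an
absolutely convergent one. -/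
theorem integral_exp_neg_mul_sin_div {ε : ℝ} (hε : 0 < ε) (w : ℝ) :
    ∫ z in Ioi (0 : ℝ), Real.exp (-ε * z) * (Real.sin (z * w) / z) = Real.arctan (w / ε) := by
  have hd : ∀ w : ℝ, HasDerivAt
      (fun w : ℝ => ∫ z in Ioi (0 : ℝ), Real.exp (-ε * z) * (Real.sin (z * w) / z))
      (ε / (ε ^ 2 + w ^ 2)) w := by
    intro w
    rw [← integral_exp_neg_mul_cos hε w]
    refine (hasDerivAt_integral_of_dominated_loc_of_deriv_le (μ := volume.restrict (Ioi (0 : ℝ)))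
      (F := fun w z => Real.exp (-ε * z) * (Real.sin (z * w) / z))
      (F' := fun w z => Real.exp (-ε * z) * Real.cos (z * w))
      (bound := fun z => Real.exp (-ε * z)) univ_mem
      (Eventually.of_forall fun w => Measurable.aestronglyMeasurable (by fun_prop)) ?_
      (Measurable.aestronglyMeasurable (by fun_prop)) ?_ (integrableOn_exp_neg_mul hε) ?_).2
    · refine ((integrableOn_exp_neg_mul hε).mul_const |w|).mono'
        (Measurable.aestronglyMeasurable (by fun_prop)) ?_
      filter_upwards [ae_restrict_mem measurableSet_Ioi] with z hz
      rw [norm_mul, Real.norm_eq_abs, Real.abs_exp, Real.norm_eq_abs]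
      exact mul_le_mul_of_nonneg_left (abs_sin_mul_div_le w hz) (Real.exp_pos _).le
    · refine Eventually.of_forall fun z w _ => ?_
      rw [norm_mul, Real.norm_eq_abs, Real.abs_exp, Real.norm_eq_abs]
      exact mul_le_of_le_one_right (Real.exp_pos _).le (Real.abs_cos_le_one _)
    · filter_upwards [ae_restrict_mem measurableSet_Ioi] with z hz w _
      have hz' : z ≠ 0 := (ne_of_gt hz)
      have h := ((((hasDerivAt_id' w).const_mul z).sin).div_const z).const_mul (Real.exp (-ε * z))
      rwa [mul_one, mul_div_cancel_right₀ _ hz'] at h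
  have hd2 : ∀ w : ℝ, HasDerivAt (fun w : ℝ => Real.arctan (w / ε)) (ε / (ε ^ 2 + w ^ 2)) w := by
    intro w
    convert ((hasDerivAt_id' w).div_const ε).arctan using 1
    field_simp
  have hconst := is_const_of_deriv_eq_zero
    (f := fun w => (∫ z in Ioi (0 : ℝ), Real.exp (-ε * z) * (Real.sin (z * w) / z)) -
      Real.arctan (w / ε))
    (fun w => ((hd w).sub (hd2 w)).differentiableAt)
    (fun w => by
      have h := ((hd w).sub (hd2 w)).deriv
      rw [sub_self] at h
      exact h) w 0
  simpa [sub_eq_zero] using hconst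

theorem im_charFun (ν : Measure ℝ) [IsProbabilityMeasure ν] (z : ℝ) :
    (charFun ν z).im = ∫ x, Real.sin (z * x) ∂ν := by
  have hint : Integrable (fun x : ℝ => Complex.exp (z * x * Complex.I)) ν := by
    refine Integrable.of_bound (C := 1) (Measurable.aestronglyMeasurable (by fun_prop)) ?_
    refine Eventually.of_forall fun x => ?_
    rw [← Complex.ofReal_mul, Complex.norm_exp_ofReal_mul_I]
  rw [charFun_apply_real, ← RCLike.im_eq_complex_im, ← integral_im hint]
  refine integral_congr_ae (Eventually.of_forall fun x => ?_)
  simp only [RCLike.im_eq_complex_im]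
  rw [← Complex.ofReal_mul, Complex.exp_ofReal_mul_I_im]

theorem tendsto_arctan_div (w : ℝ) :
    Tendsto (fun n : ℕ => Real.arctan (w / (1 / ((n : ℝ) + 1)))) atTop
      (𝓝 (Real.pi / 2 * ((Ioi (0 : ℝ)).indicator 1 w - (Iio (0 : ℝ)).indicator 1 w))) := by
  have hn : Tendsto (fun n : ℕ => (n : ℝ) + 1) atTop atTop :=
    tendsto_atTop_add_const_right _ _ tendsto_natCast_atTop_atTop
  simp only [one_div, div_inv_eq_mul]
  rcases lt_trichotomy w 0 with hw | rfl | hw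
  · have h := (tendsto_nhds_of_tendsto_nhdsWithin Real.tendsto_arctan_atBot).comp
      (hn.const_mul_atTop_of_neg hw)
    simpa [hw, hw.le, neg_div, Function.comp_def] using h
  · simp
  · have h := (tendsto_nhds_of_tendsto_nhdsWithin Real.tendsto_arctan_atTop).comp
      (hn.const_mul_atTop hw)
    simpa [hw, hw.le, Function.comp_def] using h

/-- Fubini's theorem, with `|sin (z w) / z| ≤ |w|`: the first moment of `ν` and the damping dominate
the double integral. -/
theorem integral_exp_neg_mul_im_charFun_div {ν : Measure ℝ} [IsProbabilityMeasure ν]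
    (hν : Integrable id ν) {ε : ℝ} (hε : 0 < ε) :
    ∫ z in Ioi (0 : ℝ), Real.exp (-ε * z) * ((charFun ν z).im / z) =
      ∫ w, Real.arctan (w / ε) ∂ν := by
  have hint : Integrable (fun p : ℝ × ℝ => Real.exp (-ε * p.1) * (Real.sin (p.1 * p.2) / p.1))
      ((volume.restrict (Ioi 0)).prod ν) := by
    refine ((integrableOn_exp_neg_mul hε).mul_prod hν.abs).mono'
      (Measurable.aestronglyMeasurable (by fun_prop)) ?_
    have : ∀ᵐ p : ℝ × ℝ ∂((volume.restrict (Ioi 0)).prod ν), p.1 ∈ Ioi (0 : ℝ) :=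
      Measure.quasiMeasurePreserving_fst.ae (ae_restrict_mem measurableSet_Ioi)
    filter_upwards [this] with p hp
    rw [norm_mul, Real.norm_eq_abs, Real.abs_exp, Real.norm_eq_abs]
    exact mul_le_mul_of_nonneg_left (abs_sin_mul_div_le p.2 hp) (Real.exp_pos _).le
  calc _ = ∫ z in Ioi (0 : ℝ), ∫ w, Real.exp (-ε * z) * (Real.sin (z * w) / z) ∂ν := by
        congr with z
        rw [integral_const_mul, integral_div, im_charFun]
    _ = ∫ w, (∫ z in Ioi (0 : ℝ), Real.exp (-ε * z) * (Real.sin (z * w) / z)) ∂ν :=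
        integral_integral_swap
          (f := fun z w => Real.exp (-ε * z) * (Real.sin (z * w) / z)) hint
    _ = _ := by simp_rw [integral_exp_neg_mul_sin_div hε]

/-- The inversion formula of Gil-Pelaez, at a point that is not an atom. -/
theorem gilPelaez {ν : Measure ℝ} [IsProbabilityMeasure ν] (hν : Integrable id ν)
    (hint : IntegrableOn (fun z => (charFun ν z).im / z) (Ioi 0)) (h0 : ν {0} = 0) :
    ν.real (Iic 0) = 1 / 2 - (∫ z in Ioi (0 : ℝ), (charFun ν z).im / z) / Real.pi := by
  have hε : ∀ n : ℕ, (0 : ℝ) < 1 / ((n : ℝ) + 1) := fun n => by positivity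
  -- The damping is removed along `ε = 1 / (n + 1)`. On the frequency side the assumed integrability
  -- dominates; on the other side `arctan (w / ε)` is bounded by `π / 2` and tends to `π / 2` times
  -- the sign of `w`.
  have hl : Tendsto (fun n : ℕ => ∫ z in Ioi (0 : ℝ),
      Real.exp (-(1 / ((n : ℝ) + 1)) * z) * ((charFun ν z).im / z)) atTop
      (𝓝 (∫ z in Ioi (0 : ℝ), (charFun ν z).im / z)) := by
    refine tendsto_integral_of_dominated_convergence (fun z => ‖(charFun ν z).im / z‖)
      (fun n => ?_) hint.norm (fun n => ?_) ?_
    · exact (Measurable.aestronglyMeasurable (by fun_prop)).mul hint.aestronglyMeasurable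
    · filter_upwards [ae_restrict_mem measurableSet_Ioi] with z hz
      have hz' : (0 : ℝ) < z := hz
      rw [norm_mul, Real.norm_eq_abs, Real.abs_exp]
      refine mul_le_of_le_one_left (norm_nonneg _) (Real.exp_le_one_iff.2 ?_)
      have := mul_pos (hε n) hz'
      linarith
    · refine Eventually.of_forall fun z => ?_
      have h1 : Tendsto (fun n : ℕ => Real.exp (-(1 / ((n : ℝ) + 1)) * z)) atTop
          (𝓝 (Real.exp (-0 * z))) :=
        (Real.continuous_exp.tendsto _).comp
          ((tendsto_one_div_add_atTop_nhds_zero_nat.neg).mul_const z)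
      simpa using h1.mul_const ((charFun ν z).im / z)
  have hr : Tendsto (fun n : ℕ => ∫ w, Real.arctan (w / (1 / ((n : ℝ) + 1))) ∂ν) atTop
      (𝓝 (∫ w, Real.pi / 2 * ((Ioi (0 : ℝ)).indicator 1 w - (Iio (0 : ℝ)).indicator 1 w) ∂ν)) := by
    refine tendsto_integral_of_dominated_convergence (fun _ => Real.pi / 2)
      (fun n => Measurable.aestronglyMeasurable (by fun_prop)) (integrable_const _)
      (fun n => Eventually.of_forall fun w => ?_) (Eventually.of_forall tendsto_arctan_div)
    rw [Real.norm_eq_abs, abs_le]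
    exact ⟨(Real.neg_pi_div_two_lt_arctan _).le, (Real.arctan_lt_pi_div_two _).le⟩
  have heq := tendsto_nhds_unique hl
    (hr.congr fun n => (integral_exp_neg_mul_im_charFun_div hν (hε n)).symm)
  have hi : ∀ s : Set ℝ, MeasurableSet s → Integrable (s.indicator (1 : ℝ → ℝ)) ν := fun s hs =>
    (integrable_const (1 : ℝ)).indicator hs
  rw [integral_const_mul, integral_sub (hi _ measurableSet_Ioi) (hi _ measurableSet_Iio),
    integral_indicator_one measurableSet_Ioi, integral_indicator_one measurableSet_Iio] at heq
  -- The limit is the difference of the masses of the two open half-lines; in the absence of an atom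
  -- at `0` it equals `1 - 2 ν(Iic 0)`.
  have h1 : ν.real (Iio 0) = ν.real (Iic 0) := by
    rw [← Iio_union_right, measureReal_union (by simp) (measurableSet_singleton _)]
    simp [measureReal_def, h0]
  have h2 : ν.real (Ioi 0) = 1 - ν.real (Iic 0) := by
    rw [← compl_Iic, probReal_compl_eq_one_sub measurableSet_Iic]
  rw [heq, h1, h2]
  field_simp
  ring

end GilPelaez

/-! ### Poisson point processes as random measures -/

section PointMeasure

variable {Ω E : Type*} [MeasurableSpace Ω] [MeasurableSpace E]

/-- The counting measure of a set of points. -/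
noncomputable def pointMeasure (A : Set E) : Measure E :=
  Measure.sum fun p : A => Measure.dirac (p : E)

theorem lintegral_pointMeasure (A : Set E) {f : E → ℝ≥0∞} (hf : Measurable f) :
    ∫⁻ x, f x ∂pointMeasure A = ∑' p : A, f p := by
  rw [pointMeasure, lintegral_sum_measure]
  exact tsum_congr fun p => lintegral_dirac' _ hf

theorem pointMeasure_apply (A : Set E) {B : Set E} (hB : MeasurableSet B) :
    pointMeasure A B = ((A ∩ B).encard : ℝ≥0∞) := by
  rw [pointMeasure, Measure.sum_apply _ hB, ← ENNReal.tsum_set_one]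
  simp only [Measure.dirac_apply' _ hB]
  rw [tsum_subtype A (fun x => B.indicator (1 : E → ℝ≥0∞) x),
    tsum_subtype (A ∩ B) (fun _ => (1 : ℝ≥0∞))]
  refine tsum_congr fun x => ?_
  rw [indicator_indicator]
  rfl

end PointMeasure

/-! ### The mean of the Poisson law, and regrouping of independent families -/

section PoissonLaw

theorem lintegral_natCast_poissonMeasure (r : ℝ≥0) :
    ∫⁻ n : ℕ, (n : ℝ≥0∞) ∂poissonMeasure r = r := by
  have h1 : ∑' n : ℕ, poissonMeasure r {n} = 1 := by
    have := measure_univ (μ := poissonMeasure r)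
    rw [← lintegral_one, lintegral_countable'] at this
    simpa using this
  rw [lintegral_countable', tsum_eq_zero_add' ENNReal.summable]
  simp only [Nat.cast_zero, zero_mul, zero_add]
  rw [← mul_one (r : ℝ≥0∞), ← h1, ← ENNReal.tsum_mul_left]
  refine tsum_congr fun n => ?_
  rw [poissonMeasure_singleton, poissonMeasure_singleton, ← ENNReal.ofReal_natCast,
    ← ENNReal.ofReal_coe_nnreal, ← ENNReal.ofReal_mul (by positivity),
    ← ENNReal.ofReal_mul (by positivity)]
  congr 1
  rw [Nat.factorial_succ, pow_succ]
  push_cast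
  have : ((n : ℝ) + 1) ≠ 0 := by positivity
  have h2 : (n.factorial : ℝ) ≠ 0 := by positivity
  field_simp

/-- Independence says that the joint law is a product measure, and currying a product over pairs
gives a product of products. It serves to regroup counts indexed by region and state. -/
theorem iIndepFun_curry {Ω ι κ 𝓧 : Type*} [MeasurableSpace Ω] [MeasurableSpace 𝓧] {P : Measure Ω}
    {X : ι → κ → Ω → 𝓧} (mX : ∀ i j, Measurable (X i j))
    (h : iIndepFun (fun p : ι × κ => X p.1 p.2) P) :
    iIndepFun (fun i ω j => X i j ω) P := by
  have := h.isProbabilityMeasure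
  have : ∀ i j, IsProbabilityMeasure (P.map (X i j)) :=
    fun i j => Measure.isProbabilityMeasure_map (mX i j).aemeasurable
  have hm : ∀ i, Measurable fun ω j => X i j ω := fun i => by fun_prop
  rw [iIndepFun_iff_map_fun_eq_infinitePi_map hm]
  have h1 := (iIndepFun_iff_map_fun_eq_infinitePi_map (fun p : ι × κ => mX p.1 p.2)).1 h
  have h2 : ∀ i, P.map (fun ω j => X i j ω) = Measure.infinitePi fun j => P.map (X i j) := fun i =>
    (iIndepFun_iff_map_fun_eq_infinitePi_map (mX i)).1
      (h.precomp (g := fun j => (i, j)) (Prod.mk_right_injective i))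
  simp_rw [h2]
  rw [← Measure.infinitePi_map_curry (fun i j => P.map (X i j)), ← h1,
    Measure.map_map (by fun_prop) (by fun_prop)]
  rfl

end PoissonLaw

namespace IsPoissonProcess

variable {Ω E : Type*} [MeasurableSpace Ω] [MeasurableSpace E] {Φ : Ω → Set E} {μ : Measure E}
  {P : Measure Ω}

theorem measurable_pointMeasure (h : IsPoissonProcess Φ μ P) :
    Measurable fun ω => pointMeasure (Φ ω) := by
  refine Measure.measurable_of_measurable_coe _ fun s hs => ?_
  simp_rw [pointMeasure_apply _ hs]
  exact (measurable_of_countable _).comp (h.measurable_count s hs)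

theorem measurable_lintegral (h : IsPoissonProcess Φ μ P) {f : E → ℝ≥0∞} (hf : Measurable f) :
    Measurable fun ω => ∫⁻ x, f x ∂pointMeasure (Φ ω) :=
  (Measure.measurable_lintegral hf).comp h.measurable_pointMeasure

theorem iIndepFun_count (h : IsPoissonProcess Φ μ P) {ι : Type*} [Fintype ι] {A : ι → Set E}
    (hA : ∀ i, MeasurableSet (A i)) (hd : Pairwise fun i j => Disjoint (A i) (A j)) :
    iIndepFun (fun i => count Φ (A i)) P := by
  have e := Fintype.equivFin ι
  have := h.indep _ (fun k => A (e.symm k)) (fun k => hA _)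
    (fun i j hij => hd (e.symm.injective.ne hij))
  exact this.of_precomp e.symm.surjective

variable [IsProbabilityMeasure P]

/-- The definition prescribes the atoms at finite values only. Two probability measures on `ℕ∞` that
agree there also agree at `⊤`, the complement of a countable union of atoms. -/
theorem map_count (h : IsPoissonProcess Φ μ P) {A : Set E} (hA : MeasurableSet A) (hμ : μ A ≠ ∞) :
    P.map (count Φ A) = (poissonMeasure (μ A).toNNReal).map (Nat.cast : ℕ → ℕ∞) := by
  have hm := h.measurable_count A hA
  have hp : IsProbabilityMeasure (P.map (count Φ A)) := Measure.isProbabilityMeasure_map hm.aemeasurable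
  have hk : ∀ k : ℕ, P.map (count Φ A) {(k : ℕ∞)} = poissonMeasure (μ A).toNNReal {k} := fun k => by
    rw [Measure.map_apply hm (measurableSet_singleton _)]
    exact h.poisson A hA hμ k
  have hk2 : ∀ k : ℕ, (poissonMeasure (μ A).toNNReal).map (Nat.cast : ℕ → ℕ∞) {(k : ℕ∞)} =
      poissonMeasure (μ A).toNNReal {k} := fun k => by
    rw [Measure.map_apply (measurable_of_countable _) (measurableSet_singleton _)]
    congr 1
    ext n
    simp
  have hp2 : IsProbabilityMeasure ((poissonMeasure (μ A).toNNReal).map (Nat.cast : ℕ → ℕ∞)) :=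
    Measure.isProbabilityMeasure_map (measurable_of_countable _).aemeasurable
  have htop : ∀ ν : Measure ℕ∞, IsProbabilityMeasure ν → ν {⊤} = 1 - ∑' k : ℕ, ν {(k : ℕ∞)} := by
    intro ν hν
    have hc : ({⊤} : Set ℕ∞) = (⋃ k : ℕ, {(k : ℕ∞)})ᶜ := by
      ext n
      cases n <;> simp
    rw [hc, prob_compl_eq_one_sub (MeasurableSet.iUnion fun _ => measurableSet_singleton _),
      measure_iUnion (fun i j hij => by simpa using hij)
        (fun _ => measurableSet_singleton _)]
  refine Measure.ext_of_singleton fun n => ?_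
  cases n with
  | top => simp only [htop _ hp, htop _ hp2, hk, hk2]
  | coe k => rw [hk, hk2]

theorem ae_count_ne_top (h : IsPoissonProcess Φ μ P) {A : Set E} (hA : MeasurableSet A)
    (hμ : μ A ≠ ∞) : ∀ᵐ ω ∂P, count Φ A ω ≠ ⊤ := by
  have h1 : ∀ᵐ n ∂P.map (count Φ A), n ≠ ⊤ := by
    rw [h.map_count hA hμ, ae_map_iff (measurable_of_countable _).aemeasurable .of_discrete]
    simp
  exact ae_of_ae_map (h.measurable_count A hA).aemeasurable h1

theorem lintegral_pointMeasure_apply (h : IsPoissonProcess Φ μ P) {A : Set E}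
    (hA : MeasurableSet A) : ∫⁻ ω, pointMeasure (Φ ω) A ∂P = μ A := by
  have h1 : ∀ ω, pointMeasure (Φ ω) A = (count Φ A ω : ℝ≥0∞) := fun ω => pointMeasure_apply _ hA
  simp_rw [h1]
  by_cases hμ : μ A = ∞
  · rw [lintegral_congr_ae (g := fun _ => ∞)
      ((h.infinite A hA hμ).mono fun ω hω => by simp [hω])]
    simp [hμ]
  · rw [← lintegral_map (f := fun n : ℕ∞ => (n : ℝ≥0∞)) (measurable_of_countable _)
      (h.measurable_count A hA), h.map_count hA hμ,
      lintegral_map (measurable_of_countable _) (measurable_of_countable _)]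
    simp only [ENat.toENNReal_coe]
    rw [lintegral_natCast_poissonMeasure, ENNReal.coe_toNNReal hμ]

/-- Campbell's formula. -/
theorem lintegral_lintegral (h : IsPoissonProcess Φ μ P) {f : E → ℝ≥0∞} (hf : Measurable f) :
    ∫⁻ ω, ∫⁻ x, f x ∂pointMeasure (Φ ω) ∂P = ∫⁻ x, f x ∂μ := by
  -- Averaging the random counting measure over `P` gives the measure of mean counts, which is the
  -- intensity.
  have : P.bind (fun ω => pointMeasure (Φ ω)) = μ := by
    ext s hs
    rw [Measure.bind_apply hs h.measurable_pointMeasure.aemeasurable,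
      h.lintegral_pointMeasure_apply hs]
  rw [← Measure.lintegral_bind h.measurable_pointMeasure.aemeasurable hf.aemeasurable, this]

/-- The expected number of exceptional points is the intensity of the exceptional set, which is
zero. -/
theorem ae_forall_mem (h : IsPoissonProcess Φ μ P) {p : E → Prop} (hp : MeasurableSet {x | p x})
    (hμ : ∀ᵐ x ∂μ, p x) : ∀ᵐ ω ∂P, ∀ x ∈ Φ ω, p x := by
  have h1 := h.lintegral_pointMeasure_apply hp.compl
  rw [show μ {x | p x}ᶜ = 0 from hμ, lintegral_eq_zero_iff
    (Measure.measurable_measure.1 h.measurable_pointMeasure _ hp.compl)] at h1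
  filter_upwards [h1] with ω hω x hx
  rw [pointMeasure_apply _ hp.compl] at hω
  simp only [Pi.zero_apply, ENat.toENNReal_eq_zero, encard_eq_zero] at hω
  by_contra hpx
  exact (hω ▸ (⟨hx, hpx⟩ : x ∈ Φ ω ∩ {x | p x}ᶜ) : x ∈ (∅ : Set E))

/-! #### Characteristic functional -/

theorem integral_cexp_count (h : IsPoissonProcess Φ μ P) {A : Set E} (hA : MeasurableSet A)
    (hμ : μ A ≠ ∞) (t : ℝ) :
    ∫ ω, Complex.exp (t * ((count Φ A ω).toNat : ℝ) * Complex.I) ∂P =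
      Complex.exp (μ.real A * (Complex.exp (t * Complex.I) - 1)) := by
  have h1 := charFun_map_cast_poissonMeasure (μ A).toNNReal t
  rw [charFun_apply_real, integral_map (measurable_of_countable _).aemeasurable
    (Measurable.aestronglyMeasurable (by fun_prop))] at h1
  have h2 : ((μ A).toNNReal : ℂ) = (μ.real A : ℂ) := rfl
  rw [h2] at h1
  rw [← h1, ← integral_map (f := fun n : ℕ∞ => Complex.exp (t * (n.toNat : ℝ) * Complex.I))
    (h.measurable_count A hA).aemeasurable (Measurable.aestronglyMeasurable
      (measurable_of_countable _)), h.map_count hA hμ,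
    integral_map (measurable_of_countable _).aemeasurable (Measurable.aestronglyMeasurable
      (measurable_of_countable _))]
  simp

end IsPoissonProcess

/-! #### Simple functions as sums of indicators -/

section Simple

variable {E : Type*} [MeasurableSpace E]

/-- The nonzero values of a simple function. -/
noncomputable def nzRange (f : SimpleFunc E ℝ≥0∞) : Finset ℝ≥0∞ := {c ∈ f.range | c ≠ 0}

/-- The value `0` is left out because its level set may have infinite intensity; `g 0 = 0` makes
this harmless. -/
theorem sum_nzRange {M : Type*} [AddCommMonoid M] (f : SimpleFunc E ℝ≥0∞) (g : ℝ≥0∞ → M)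
    (hg : g 0 = 0) (x : E) :
    ∑ c : nzRange f, (f ⁻¹' {(c : ℝ≥0∞)}).indicator (fun _ => g c) x = g (f x) := by
  classical
  rw [Finset.sum_coe_sort (nzRange f) (fun c => (f ⁻¹' {c}).indicator (fun _ => g c) x)]
  by_cases h : f x = 0
  · rw [h, hg]
    refine Finset.sum_eq_zero fun c hc => indicator_of_notMem ?_ _
    simp only [nzRange, Finset.mem_filter] at hc
    simpa [h] using hc.2.symm
  · rw [Finset.sum_eq_single (f x)]
    · simp
    · intro c _ hc
      exact indicator_of_notMem (by simpa using hc.symm) _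
    · intro hc
      simp [nzRange, h] at hc

theorem pairwise_disjoint_preimage (f : SimpleFunc E ℝ≥0∞) :
    Pairwise fun c d : nzRange f => Disjoint (f ⁻¹' {(c : ℝ≥0∞)}) (f ⁻¹' {(d : ℝ≥0∞)}) := by
  intro c d hcd
  refine disjoint_left.2 fun x hx hy => hcd (Subtype.ext ?_)
  simp only [mem_preimage, mem_singleton_iff] at hx hy
  rw [← hx, ← hy]

theorem lintegral_simple (f : SimpleFunc E ℝ≥0∞) (ν : Measure E) :
    ∫⁻ x, f x ∂ν = ∑ c : nzRange f, (c : ℝ≥0∞) * ν (f ⁻¹' {(c : ℝ≥0∞)}) := by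
  have h : ∀ x, f x = ∑ c : nzRange f, (f ⁻¹' {(c : ℝ≥0∞)}).indicator (fun _ => (c : ℝ≥0∞)) x :=
    fun x => (sum_nzRange f id rfl x).symm
  rw [lintegral_congr h, lintegral_finsetSum _ fun c _ =>
    measurable_const.indicator (f.measurableSet_fiber _)]
  refine Finset.sum_congr rfl fun c _ => ?_
  rw [lintegral_indicator_const (f.measurableSet_fiber _)]

theorem measure_preimage_ne_top {f : SimpleFunc E ℝ≥0∞} {ν : Measure E}
    (h : ∫⁻ x, f x ∂ν ≠ ∞) (c : nzRange f) : ν (f ⁻¹' {(c : ℝ≥0∞)}) ≠ ∞ := by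
  intro hc
  apply h
  rw [lintegral_simple, ENNReal.sum_eq_top]
  refine ⟨c, Finset.mem_univ _, ?_⟩
  rw [hc, ENNReal.mul_top]
  have := c.2
  simp only [nzRange, Finset.mem_filter] at this
  exact this.2

end Simple

namespace IsPoissonProcess

variable {Ω E : Type*} [MeasurableSpace Ω] [MeasurableSpace E] {Φ : Ω → Set E} {μ : Measure E}
  {P : Measure Ω} [IsProbabilityMeasure P]

theorem ae_lintegral_ne_top (h : IsPoissonProcess Φ μ P) {f : E → ℝ≥0∞} (hf : Measurable f)
    (hμ : ∫⁻ x, f x ∂μ ≠ ∞) : ∀ᵐ ω ∂P, ∫⁻ x, f x ∂pointMeasure (Φ ω) ≠ ∞ := by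
  rw [← h.lintegral_lintegral hf] at hμ
  exact (ae_lt_top (h.measurable_lintegral hf) hμ).mono fun ω hω => hω.ne

/-- The sum of `f` over the points is a linear combination of the counts of the nonzero level sets.
These are disjoint and of finite intensity, so the counts are independent Poisson variables and the
expectation factorizes. -/
theorem integral_cexp_simple (h : IsPoissonProcess Φ μ P) {f : SimpleFunc E ℝ≥0∞}
    (hf : ∀ x, f x ≠ ∞) (hμ : ∫⁻ x, f x ∂μ ≠ ∞) (t : ℝ) :
    ∫ ω, Complex.exp (t * (∫⁻ x, f x ∂pointMeasure (Φ ω)).toReal * Complex.I) ∂P =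
      Complex.exp (∫ x, (Complex.exp (t * (f x).toReal * Complex.I) - 1) ∂μ) := by
  have hfin := measure_preimage_ne_top hμ
  have hmeas : ∀ c : nzRange f, MeasurableSet (f ⁻¹' {(c : ℝ≥0∞)}) := fun c =>
    f.measurableSet_fiber _
  have hctop : ∀ c : nzRange f, (c : ℝ≥0∞) ≠ ∞ := fun c => by
    have := c.2
    simp only [nzRange, Finset.mem_filter, SimpleFunc.mem_range] at this
    obtain ⟨⟨x, hx⟩, -⟩ := this
    rw [← hx]
    exact hf x
  have hind : iIndepFun (fun (c : nzRange f) ω => Complex.exp ((t * (c : ℝ≥0∞).toReal : ℝ) *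
      ((count Φ (f ⁻¹' {(c : ℝ≥0∞)}) ω).toNat : ℝ) * Complex.I)) P :=
    (h.iIndepFun_count hmeas (pairwise_disjoint_preimage f)).comp
      (fun c n => Complex.exp ((t * (c : ℝ≥0∞).toReal : ℝ) * (n.toNat : ℝ) * Complex.I))
      (fun c => measurable_of_countable _)
  have hL : ∀ᵐ ω ∂P, Complex.exp (t * (∫⁻ x, f x ∂pointMeasure (Φ ω)).toReal * Complex.I) =
      ∏ c : nzRange f, Complex.exp ((t * (c : ℝ≥0∞).toReal : ℝ) *
        ((count Φ (f ⁻¹' {(c : ℝ≥0∞)}) ω).toNat : ℝ) * Complex.I) := by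
    -- Off a null set all these counts are finite, so `toNat` does not replace an infinite count by
    -- its default value.
    have : ∀ᵐ ω ∂P, ∀ c : nzRange f, count Φ (f ⁻¹' {(c : ℝ≥0∞)}) ω ≠ ⊤ :=
      ae_all_iff.2 fun c => h.ae_count_ne_top (hmeas c) (hfin c)
    filter_upwards [this] with ω hω
    have hc : ∀ c : nzRange f, pointMeasure (Φ ω) (f ⁻¹' {(c : ℝ≥0∞)}) =
        ((count Φ (f ⁻¹' {(c : ℝ≥0∞)}) ω).toNat : ℝ≥0∞) := fun c => by
      rw [pointMeasure_apply _ (hmeas c)]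
      change (count Φ (f ⁻¹' {(c : ℝ≥0∞)}) ω : ℝ≥0∞) = _
      obtain ⟨n, hn⟩ := ENat.ne_top_iff_exists.1 (hω c)
      rw [← hn]
      simp
    rw [← Complex.exp_sum, lintegral_simple]
    simp_rw [hc]
    rw [ENNReal.toReal_sum fun c _ => ENNReal.mul_ne_top (hctop c) (ENNReal.natCast_ne_top _)]
    congr 1
    rw [← Finset.sum_mul]
    congr 1
    push_cast
    rw [Finset.mul_sum]
    refine Finset.sum_congr rfl fun c _ => ?_
    simp
    ring
  have hR : ∫ x, (Complex.exp (t * (f x).toReal * Complex.I) - 1) ∂μ =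
      ∑ c : nzRange f, (μ.real (f ⁻¹' {(c : ℝ≥0∞)}) : ℂ) *
        (Complex.exp ((t * (c : ℝ≥0∞).toReal : ℝ) * Complex.I) - 1) := by
    have hpt := fun x => (sum_nzRange f
      (fun c => Complex.exp ((t * c.toReal : ℝ) * Complex.I) - 1) (by simp) x).symm
    have hpt' : ∀ x, Complex.exp (t * (f x).toReal * Complex.I) - 1 =
        ∑ c : nzRange f, (f ⁻¹' {(c : ℝ≥0∞)}).indicator
          (fun _ => Complex.exp ((t * (c : ℝ≥0∞).toReal : ℝ) * Complex.I) - 1) x := fun x => by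
      rw [← hpt x]
      push_cast
      rfl
    simp_rw [hpt']
    rw [integral_finsetSum _ fun c _ =>
      (integrable_indicator_iff (hmeas c)).2 (integrableOn_const (hfin c))]
    refine Finset.sum_congr rfl fun c _ => ?_
    rw [integral_indicator_const _ (hmeas c)]
    simp
  rw [integral_congr_ae hL, hind.integral_fun_prod_eq_prod_integral, hR, Complex.exp_sum]
  · exact Finset.prod_congr rfl fun c _ => h.integral_cexp_count (hmeas c) (hfin c) _
  · intro c
    exact Measurable.aestronglyMeasurable (Measurable.comp (g := fun n : ℕ∞ =>
      Complex.exp ((t * (c : ℝ≥0∞).toReal : ℝ) * (n.toNat : ℝ) * Complex.I))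
      (measurable_of_countable _) (h.measurable_count _ (hmeas c)))

theorem norm_cexp_sub_one_le (t : ℝ) : ‖Complex.exp (t * Complex.I) - 1‖ ≤ |t| := by
  rw [mul_comm]
  simpa using Real.norm_exp_I_mul_ofReal_sub_one_le (x := t)

/-- The characteristic functional of a Poisson process. -/
theorem integral_cexp_lintegral (h : IsPoissonProcess Φ μ P) {f : E → ℝ≥0∞} (hf : Measurable f)
    (hμ : ∫⁻ x, f x ∂μ ≠ ∞) (t : ℝ) :
    ∫ ω, Complex.exp (t * (∫⁻ x, f x ∂pointMeasure (Φ ω)).toReal * Complex.I) ∂P =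
      Complex.exp (∫ x, (Complex.exp (t * (f x).toReal * Complex.I) - 1) ∂μ) := by
  open Filter Topology in
  have hle : ∀ n x, SimpleFunc.eapprox f n x ≤ f x := fun n x => by
    rw [← SimpleFunc.iSup_eapprox_apply hf x]
    exact le_iSup (fun n => SimpleFunc.eapprox f n x) n
  have hn : ∀ n, ∫⁻ x, SimpleFunc.eapprox f n x ∂μ ≠ ∞ := fun n =>
    ne_top_of_le_ne_top hμ (lintegral_mono (hle n))
  have hs := fun n => h.integral_cexp_simple (f := SimpleFunc.eapprox f n)
    (fun x => (SimpleFunc.eapprox_lt_top f n x).ne) (hn n) t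
  have hftop : ∀ᵐ x ∂μ, f x ≠ ∞ := (ae_lt_top hf hμ).mono fun x hx => hx.ne
  have htend : ∀ x, Tendsto (fun n => SimpleFunc.eapprox f n x) atTop (𝓝 (f x)) := fun x => by
    rw [← SimpleFunc.iSup_eapprox_apply hf x]
    exact tendsto_atTop_iSup fun _ _ hnm => SimpleFunc.monotone_eapprox f hnm x
  -- Monotone simple approximation of `f`, with dominated convergence on both sides: the
  -- exponentials have modulus one, and the integrand of the exponent is bounded by `|t| f`.
  have hL : Tendsto (fun n => ∫ ω, Complex.exp (t *
      (∫⁻ x, SimpleFunc.eapprox f n x ∂pointMeasure (Φ ω)).toReal * Complex.I) ∂P) atTop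
      (𝓝 (∫ ω, Complex.exp (t * (∫⁻ x, f x ∂pointMeasure (Φ ω)).toReal * Complex.I) ∂P)) := by
    refine tendsto_integral_of_dominated_convergence (fun _ => 1) (fun n => ?_)
      (integrable_const _) (fun n => Eventually.of_forall fun ω => ?_) ?_
    · have := h.measurable_lintegral (SimpleFunc.eapprox f n).measurable
      exact Measurable.aestronglyMeasurable (by fun_prop)
    · rw [← Complex.ofReal_mul, Complex.norm_exp_ofReal_mul_I]
    · filter_upwards [h.ae_lintegral_ne_top hf hμ] with ω hω
      have h1 : Tendsto (fun n => ∫⁻ x, SimpleFunc.eapprox f n x ∂pointMeasure (Φ ω)) atTop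
          (𝓝 (∫⁻ x, f x ∂pointMeasure (Φ ω))) :=
        lintegral_tendsto_of_tendsto_of_monotone
          (fun n => (SimpleFunc.eapprox f n).measurable.aemeasurable)
          (Eventually.of_forall fun x _ _ hnm => SimpleFunc.monotone_eapprox f hnm x)
          (Eventually.of_forall htend)
      have h2 := (ENNReal.tendsto_toReal hω).comp h1
      have hc : Continuous fun y : ℝ => Complex.exp (t * y * Complex.I) := by fun_prop
      exact (hc.tendsto _).comp h2
  have hR : Tendsto (fun n => ∫ x, (Complex.exp (t * (SimpleFunc.eapprox f n x).toReal *
      Complex.I) - 1) ∂μ) atTop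
      (𝓝 (∫ x, (Complex.exp (t * (f x).toReal * Complex.I) - 1) ∂μ)) := by
    refine tendsto_integral_of_dominated_convergence (fun x => |t| * (f x).toReal) (fun n => ?_)
      ((integrable_toReal_of_lintegral_ne_top hf.aemeasurable hμ).const_mul _) (fun n => ?_) ?_
    · have := (SimpleFunc.eapprox f n).measurable
      exact Measurable.aestronglyMeasurable (by fun_prop)
    · filter_upwards [hftop] with x hx
      rw [← Complex.ofReal_mul]
      refine (norm_cexp_sub_one_le _).trans ?_
      rw [abs_mul, abs_of_nonneg ENNReal.toReal_nonneg]
      exact mul_le_mul_of_nonneg_left (ENNReal.toReal_mono hx (hle n x)) (abs_nonneg t)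
    · filter_upwards [hftop] with x hx
      have h2 := (ENNReal.tendsto_toReal hx).comp (htend x)
      have hc : Continuous fun y : ℝ => Complex.exp (t * y * Complex.I) - 1 := by fun_prop
      exact (hc.tendsto _).comp h2
  refine tendsto_nhds_unique hL ?_
  simp_rw [hs]
  exact (Complex.continuous_exp.tendsto _).comp hR

/-! #### Independence of disjoint regions -/

/-- For a simple function vanishing on the regions `A i`, its nonzero level sets and the `A i` form
one disjoint family, whose counts are independent. A general `f` is reached by monotone
approximation of the events that the sum of `f` is at most a given value. -/
theorem indepFun_count_lintegral (h : IsPoissonProcess Φ μ P) {ι : Type*} [Fintype ι]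
    {A : ι → Set E} (hA : ∀ i, MeasurableSet (A i))
    (hd : Pairwise fun i j => Disjoint (A i) (A j)) {f : E → ℝ≥0∞} (hf : Measurable f)
    (hfA : ∀ i, ∀ x ∈ A i, f x = 0) :
    IndepFun (fun ω i => count Φ (A i) ω) (fun ω => ∫⁻ x, f x ∂pointMeasure (Φ ω)) P := by
  open Filter Topology in
  classical
  have hmc : Measurable fun ω i => count Φ (A i) ω :=
    measurable_pi_lambda _ fun i => h.measurable_count _ (hA i)
  have hle : ∀ n x, SimpleFunc.eapprox f n x ≤ f x := fun n x => by
    rw [← SimpleFunc.iSup_eapprox_apply hf x]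
    exact le_iSup (fun n => SimpleFunc.eapprox f n x) n
  have hsimple : ∀ n, IndepFun (fun ω i => count Φ (A i) ω)
      (fun ω => ∫⁻ x, SimpleFunc.eapprox f n x ∂pointMeasure (Φ ω)) P := by
    intro n
    set g := SimpleFunc.eapprox f n with hg
    let V : ι ⊕ nzRange g → Set E := Sum.elim A fun c => g ⁻¹' {(c : ℝ≥0∞)}
    have hV : ∀ i, MeasurableSet (V i) := by
      rintro (i | c)
      · exact hA i
      · exact g.measurableSet_fiber _
    have hAc : ∀ i (c : nzRange g), Disjoint (A i) (g ⁻¹' {(c : ℝ≥0∞)}) := by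
      intro i c
      refine disjoint_left.2 fun x hx hy => ?_
      have h0 : g x = 0 := le_antisymm ((hle n x).trans (hfA i x hx).le) (zero_le)
      have hc := c.2
      simp only [nzRange, Finset.mem_filter] at hc
      exact hc.2 (Eq.trans (Eq.symm hy) h0)
    have hVd : Pairwise fun i j => Disjoint (V i) (V j) := by
      rintro (i | c) (j | d) hij
      · exact hd (by simpa using hij)
      · exact hAc i d
      · exact (hAc j c).symm
      · exact pairwise_disjoint_preimage g (by simpa using hij)
    have hi := h.iIndepFun_count hV hVd
    have hST : Disjoint (Finset.univ.map ⟨(Sum.inl : ι → ι ⊕ nzRange g), Sum.inl_injective⟩)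
        (Finset.univ.map ⟨(Sum.inr : nzRange g → ι ⊕ nzRange g), Sum.inr_injective⟩) := by
      simp [Finset.disjoint_left]
    have hfin := hi.indepFun_finset _ _ hST (fun i => h.measurable_count _ (hV i))
    have hcomp := hfin.comp
      (φ := fun (v : (Finset.univ.map ⟨(Sum.inl : ι → ι ⊕ nzRange g), Sum.inl_injective⟩) → ℕ∞)
        (i : ι) => v ⟨Sum.inl i, by simp⟩)
      (ψ := fun (v : (Finset.univ.map ⟨(Sum.inr : nzRange g → ι ⊕ nzRange g),
        Sum.inr_injective⟩) → ℕ∞) =>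
        ∑ c : nzRange g, (c : ℝ≥0∞) * ((v ⟨Sum.inr c, by simp⟩ : ℕ∞) : ℝ≥0∞))
      (measurable_pi_lambda _ fun i => measurable_pi_apply _)
      (Finset.measurable_fun_sum _ fun c _ => Measurable.const_mul
        (Measurable.comp (g := fun n : ℕ∞ => (n : ℝ≥0∞)) (measurable_of_countable _)
          (measurable_pi_apply _)) _)
    convert hcomp using 1
    · rfl
    ext ω
    rw [lintegral_simple]
    refine Finset.sum_congr rfl fun c _ => ?_
    rw [pointMeasure_apply _ (g.measurableSet_fiber _)]
    rfl
  have hmZ := h.measurable_lintegral hf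
  rw [indepFun_iff_measure_inter_preimage_eq_mul]
  intro s t hs ht
  have hD : MeasurableSet ((fun ω i => count Φ (A i) ω) ⁻¹' s) := hmc hs
  set D := (fun ω i => count Φ (A i) ω) ⁻¹' s with hDdef
  -- Finite measures on `[0, ∞]` are determined by the intervals `Iic a`. There the event for `f` is
  -- the decreasing intersection of the events for its approximations, so the product rule survives
  -- the limit.
  have key : (P.restrict D).map (fun ω => ∫⁻ x, f x ∂pointMeasure (Φ ω)) =
      P D • P.map (fun ω => ∫⁻ x, f x ∂pointMeasure (Φ ω)) := by
    have : IsFiniteMeasure ((P.restrict D).map (fun ω => ∫⁻ x, f x ∂pointMeasure (Φ ω))) :=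
      Measure.isFiniteMeasure_map _ _
    refine Measure.ext_of_Iic _ _ fun a => ?_
    rw [Measure.map_apply hmZ measurableSet_Iic, Measure.smul_apply,
      Measure.map_apply hmZ measurableSet_Iic, Measure.restrict_apply (hmZ measurableSet_Iic),
      smul_eq_mul]
    have hset : (fun ω => ∫⁻ x, f x ∂pointMeasure (Φ ω)) ⁻¹' Iic a =
        ⋂ n, (fun ω => ∫⁻ x, SimpleFunc.eapprox f n x ∂pointMeasure (Φ ω)) ⁻¹' Iic a := by
      ext ω
      simp only [mem_preimage, mem_Iic, mem_iInter]
      rw [lintegral_eq_iSup_eapprox_lintegral hf, iSup_le_iff]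
      simp_rw [SimpleFunc.lintegral_eq_lintegral]
    have hanti : Antitone fun n =>
        (fun ω => ∫⁻ x, SimpleFunc.eapprox f n x ∂pointMeasure (Φ ω)) ⁻¹' Iic a := by
      intro n m hnm ω hω
      exact (lintegral_mono fun x => SimpleFunc.monotone_eapprox f hnm x).trans hω
    have hmn : ∀ n, MeasurableSet
        ((fun ω => ∫⁻ x, SimpleFunc.eapprox f n x ∂pointMeasure (Φ ω)) ⁻¹' Iic a) := fun n =>
      h.measurable_lintegral (SimpleFunc.eapprox f n).measurable measurableSet_Iic
    have h1 : Tendsto (fun n => P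
        ((fun ω => ∫⁻ x, SimpleFunc.eapprox f n x ∂pointMeasure (Φ ω)) ⁻¹' Iic a)) atTop
        (𝓝 (P ((fun ω => ∫⁻ x, f x ∂pointMeasure (Φ ω)) ⁻¹' Iic a))) := by
      rw [hset]
      exact tendsto_measure_iInter_atTop (fun n => (hmn n).nullMeasurableSet) hanti
        ⟨0, measure_ne_top _ _⟩
    have h2 : Tendsto (fun n => P
        ((fun ω => ∫⁻ x, SimpleFunc.eapprox f n x ∂pointMeasure (Φ ω)) ⁻¹' Iic a ∩ D)) atTop
        (𝓝 (P ((fun ω => ∫⁻ x, f x ∂pointMeasure (Φ ω)) ⁻¹' Iic a ∩ D))) := by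
      rw [hset, iInter_inter]
      exact tendsto_measure_iInter_atTop (fun n => ((hmn n).inter hD).nullMeasurableSet)
        (fun n m hnm => inter_subset_inter_left _ (hanti hnm)) ⟨0, measure_ne_top _ _⟩
    refine tendsto_nhds_unique h2 ?_
    have h3 : ∀ n, P ((fun ω => ∫⁻ x, SimpleFunc.eapprox f n x ∂pointMeasure (Φ ω)) ⁻¹' Iic a ∩ D)
        = P D * P ((fun ω => ∫⁻ x, SimpleFunc.eapprox f n x ∂pointMeasure (Φ ω)) ⁻¹' Iic a) :=
      fun n => by
        rw [inter_comm]
        exact (indepFun_iff_measure_inter_preimage_eq_mul.1 (hsimple n)) s _ hs measurableSet_Iic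
    simp_rw [h3]
    exact ENNReal.Tendsto.const_mul h1 (Or.inr (measure_ne_top _ _))
  have := congrArg (fun ν => ν t) key
  simp only [Measure.smul_apply, smul_eq_mul] at this
  rw [Measure.map_apply hmZ ht, Measure.map_apply hmZ ht, Measure.restrict_apply (hmZ ht)] at this
  rw [inter_comm, this]

end IsPoissonProcess

/-! ### Superposition of independent Poisson processes -/

section Merge

variable {S Ω E : Type*}

/-- The disjoint union of a family of random sets. -/
def mergedSet (Φ : S → Ω → Set E) (ω : Ω) : Set (S × E) := {p | p.2 ∈ Φ p.1 ω}

theorem count_mergedSet [Fintype S] (Φ : S → Ω → Set E) (A : Set (S × E)) (ω : Ω) :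
    count (mergedSet Φ) A ω = ∑ s, count (Φ s) (Prod.mk s ⁻¹' A) ω := by
  have h : mergedSet Φ ω ∩ A = ⋃ s, Prod.mk s '' (Φ s ω ∩ Prod.mk s ⁻¹' A) := by
    ext ⟨s, x⟩
    simp [mergedSet]
  rw [count, h, encard_iUnion_of_finite, finsum_eq_sum_of_fintype]
  · exact Finset.sum_congr rfl fun s _ => (Prod.mk_right_injective s).encard_image _
  · intro s t hst
    refine disjoint_left.2 ?_
    rintro _ ⟨x, _, rfl⟩ ⟨y, _, hy⟩
    exact hst (congrArg Prod.fst hy).symm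

theorem tsum_mergedSet [Fintype S] (Φ : S → Ω → Set E) (ω : Ω) (f : S × E → ℝ≥0∞) :
    ∑' p : mergedSet Φ ω, f p = ∑ s, ∑' x : Φ s ω, f (s, x) := by
  rw [tsum_subtype (mergedSet Φ ω) f, ENNReal.tsum_prod', tsum_fintype]
  refine Finset.sum_congr rfl fun s _ => ?_
  rw [tsum_subtype (Φ s ω) (fun x => f (s, x))]
  rfl

variable [MeasurableSpace Ω] [MeasurableSpace E] {Φ : S → Ω → Set E} {μ : S → Measure E}
  {P : Measure Ω}

/-- Independence across states comes from the generated σ-algebras, independence across regions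
within a state from disjointness. Together all pairs are independent, and they are then grouped by
region. -/
theorem iIndepFun_count_of_iIndep [IsProbabilityMeasure P] (h : ∀ s, IsPoissonProcess (Φ s) (μ s) P)
    (hi : iIndep (fun s => generatedBy (Φ s)) P) {n : ℕ} {A : Fin n → S → Set E}
    (hA : ∀ i s, MeasurableSet (A i s))
    (hd : ∀ s, Pairwise fun i j => Disjoint (A i s) (A j s)) :
    iIndepFun (fun i ω s => count (Φ s) (A i s) ω) P := by
  have hm : ∀ s i, Measurable (count (Φ s) (A i s)) := fun s i => (h s).measurable_count _ (hA i s)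
  have h1 : iIndepFun (fun s ω i => count (Φ s) (A i s) ω) P := by
    refine iIndep_of_iIndep_of_le hi fun s => ?_
    have hmeas : Measurable[generatedBy (Φ s)] fun ω i => count (Φ s) (A i s) ω := by
      refine @measurable_pi_lambda _ _ _ (generatedBy (Φ s)) _ _ fun i => ?_
      rw [measurable_iff_comap_le]
      exact le_iSup₂ (f := fun (A : Set E) (_ : MeasurableSet A) =>
        MeasurableSpace.comap (count (Φ s) A) inferInstance) (A i s) (hA i s)
    exact hmeas.comap_le
  have h2 := iIndepFun_uncurry' (X := fun s i => count (Φ s) (A i s)) hm h1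
    (fun s => (h s).indep n (fun i => A i s) (fun i => hA i s) (hd s))
  have h3 := h2.precomp (g := fun p : Fin n × S => (p.2, p.1)) Prod.swap_injective
  exact iIndepFun_curry (X := fun i s => count (Φ s) (A i s)) (fun i s => hm s i) h3

theorem hasLaw_sum_poisson {X : S → Ω → ℕ} {r : S → ℝ≥0} (hX : iIndepFun X P)
    (hm : ∀ s, Measurable (X s)) (hl : ∀ s, P.map (X s) = poissonMeasure (r s))
    (t : Finset S) : HasLaw (∑ s ∈ t, X s) (poissonMeasure (∑ s ∈ t, r s)) P := by
  classical
  have := hX.isProbabilityMeasure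
  induction t using Finset.induction_on with
  | empty =>
    simp only [Finset.sum_empty]
    refine ⟨aemeasurable_const, ?_⟩
    have hz : poissonMeasure 0 = Measure.dirac 0 := by
      refine Measure.ext_of_singleton fun n => ?_
      rw [poissonMeasure_singleton]
      cases n <;> simp
    rw [hz]
    exact (Measure.map_const P 0).trans (by simp)
  | insert a t ha ih =>
    rw [Finset.sum_insert ha, Finset.sum_insert ha]
    exact (hX.indepFun_finsetSum_of_notMem hm ha).symm.hasLaw_add_poissonMeasure
      ⟨(hm a).aemeasurable, hl a⟩ ih

variable [Fintype S] [MeasurableSpace S]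

/-- The disjoint union of a family of measures. -/
noncomputable def mergedMeasure (μ : S → Measure E) : Measure (S × E) :=
  Measure.sum fun s => (μ s).map (Prod.mk s)

theorem mergedMeasure_apply (μ : S → Measure E) {A : Set (S × E)} (hA : MeasurableSet A) :
    mergedMeasure μ A = ∑ s, μ s (Prod.mk s ⁻¹' A) := by
  rw [mergedMeasure, Measure.sum_apply _ hA, tsum_fintype]
  exact Finset.sum_congr rfl fun s _ => Measure.map_apply measurable_prodMk_left hA

theorem lintegral_mergedMeasure (μ : S → Measure E) {f : S × E → ℝ≥0∞} (hf : Measurable f) :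
    ∫⁻ p, f p ∂mergedMeasure μ = ∑ s, ∫⁻ x, f (s, x) ∂μ s := by
  rw [mergedMeasure, lintegral_sum_measure, tsum_fintype]
  exact Finset.sum_congr rfl fun s _ => lintegral_map hf measurable_prodMk_left

/-- A finite sum of independent Poisson counts is Poisson. Keeping the state as a coordinate puts
all links into a single process, whose first point is the serving link. -/
theorem isPoissonProcess_mergedSet [IsProbabilityMeasure P] [MeasurableSingletonClass S]
    (h : ∀ s, IsPoissonProcess (Φ s) (μ s) P) (hi : iIndep (fun s => generatedBy (Φ s)) P) :
    IsPoissonProcess (mergedSet Φ) (mergedMeasure μ) P where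
  countable ω := by
    have : mergedSet Φ ω = ⋃ s, Prod.mk s '' Φ s ω := by
      ext ⟨s, x⟩
      simp [mergedSet]
    rw [this]
    exact countable_iUnion fun s => ((h s).countable ω).image _
  measurable_count A hA := by
    have : count (mergedSet Φ) A = fun ω => ∑ s, count (Φ s) (Prod.mk s ⁻¹' A) ω :=
      funext fun ω => count_mergedSet Φ A ω
    rw [this]
    exact (measurable_of_countable (fun v : S → ℕ∞ => ∑ s, v s)).comp
      (measurable_pi_lambda _ fun s => (h s).measurable_count _ (measurable_prodMk_left hA))
  poisson A hA hμ k := by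
    have hAs : ∀ s, MeasurableSet (Prod.mk s ⁻¹' A) := fun s => measurable_prodMk_left hA
    rw [mergedMeasure_apply _ hA] at hμ ⊢
    have hμs : ∀ s, μ s (Prod.mk s ⁻¹' A) ≠ ∞ := fun s =>
      (ENNReal.sum_ne_top.1 hμ) s (Finset.mem_univ _)
    have hm : ∀ s, Measurable fun ω => (count (Φ s) (Prod.mk s ⁻¹' A) ω).toNat := fun s =>
      (measurable_of_countable _).comp ((h s).measurable_count _ (hAs s))
    have h1 : iIndepFun (fun s ω => (count (Φ s) (Prod.mk s ⁻¹' A) ω).toNat) P := by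
      have : iIndepFun (fun s => count (Φ s) (Prod.mk s ⁻¹' A)) P :=
        iIndep_of_iIndep_of_le hi fun s =>
          le_iSup₂ (f := fun (A : Set E) (_ : MeasurableSet A) =>
            MeasurableSpace.comap (count (Φ s) A) inferInstance) (Prod.mk s ⁻¹' A) (hAs s)
      exact this.comp (fun _ n => n.toNat) fun _ => measurable_of_countable _
    have hl : ∀ s, P.map (fun ω => (count (Φ s) (Prod.mk s ⁻¹' A) ω).toNat) =
        poissonMeasure (μ s (Prod.mk s ⁻¹' A)).toNNReal := fun s => by
      have h2 := (h s).map_count (hAs s) (hμs s)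
      rw [← Function.comp_def (ENat.toNat) (count (Φ s) (Prod.mk s ⁻¹' A)),
        ← Measure.map_map (measurable_of_countable _) ((h s).measurable_count _ (hAs s)), h2,
        Measure.map_map (measurable_of_countable _) (measurable_of_countable _)]
      have : ENat.toNat ∘ (Nat.cast : ℕ → ℕ∞) = id := by
        ext n
        simp
      rw [this, Measure.map_id]
    have h3 := hasLaw_sum_poisson h1 hm hl Finset.univ
    have h4 : ∑ s, (μ s (Prod.mk s ⁻¹' A)).toNNReal =
        (∑ s, μ s (Prod.mk s ⁻¹' A)).toNNReal := (ENNReal.toNNReal_sum fun s _ => hμs s).symm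
    rw [h4] at h3
    rw [← h3.map_eq, Measure.map_apply_of_aemeasurable h3.aemeasurable (measurableSet_singleton _)]
    refine measure_congr ?_
    have hfin : ∀ᵐ ω ∂P, ∀ s, count (Φ s) (Prod.mk s ⁻¹' A) ω ≠ ⊤ :=
      ae_all_iff.2 fun s => (h s).ae_count_ne_top (hAs s) (hμs s)
    filter_upwards [hfin] with ω hω
    refine propext ?_
    change count (mergedSet Φ) A ω = k ↔ (∑ s, fun ω => (count (Φ s) (Prod.mk s ⁻¹' A) ω).toNat) ω = k
    rw [count_mergedSet, Finset.sum_apply, ← Nat.cast_inj (R := ℕ∞), Nat.cast_sum]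
    simp only [fun s => ENat.natCast_toNat (hω s)]
  infinite A hA hμ := by
    rw [mergedMeasure_apply _ hA, ENNReal.sum_eq_top] at hμ
    obtain ⟨s, -, hs⟩ := hμ
    filter_upwards [(h s).infinite _ (measurable_prodMk_left hA) hs] with ω hω
    rw [count_mergedSet, eq_top_iff, ← hω]
    exact Finset.single_le_sum (f := fun s => count (Φ s) (Prod.mk s ⁻¹' A) ω)
      (fun _ _ => zero_le) (Finset.mem_univ s)
  indep n A hA hd := by
    have h1 := iIndepFun_count_of_iIndep (A := fun i s => Prod.mk s ⁻¹' A i) h hi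
      (fun i s => measurable_prodMk_left (hA i)) (fun s i j hij => (hd hij).preimage _)
    have h2 := h1.comp (fun _ v => ∑ s, v s) (fun _ => measurable_of_countable _)
    convert h2 using 1
    ext i ω
    exact count_mergedSet Φ (A i) ω

end Merge

/-! ### The first point of a Poisson process -/

/-! ### Total mass of the law of the first point -/

section LayerCake

open Filter Topology

theorem lintegral_ofReal_mul_exp_neg :
    ∫⁻ t in Ioi (0 : ℝ), ENNReal.ofReal (Real.exp (-t)) * ENNReal.ofReal t = 1 := by
  have h := Real.integral_rpow_mul_exp_neg_mul_Ioi (a := 2) (r := 1) (by norm_num) one_pos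
  have hi : IntegrableOn (fun t : ℝ => t * Real.exp (-t)) (Ioi 0) := by
    have := Real.GammaIntegral_convergent (s := 2) (by norm_num)
    refine this.congr_fun (fun t _ => ?_) measurableSet_Ioi
    norm_num
    ring
  have h2 : ∫ t in Ioi (0 : ℝ), t * Real.exp (-t) = 1 := by
    norm_num [Real.Gamma_two] at h
    exact h
  rw [← ENNReal.ofReal_one, ← h2, ofReal_integral_eq_lintegral_ofReal hi]
  · refine setLIntegral_congr_fun measurableSet_Ioi fun t ht => ?_
    rw [← ENNReal.ofReal_mul (Real.exp_pos _).le, mul_comm]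
  · filter_upwards [ae_restrict_mem measurableSet_Ioi] with t ht
    exact mul_nonneg (le_of_lt ht) (Real.exp_pos _).le

theorem ofReal_exp_neg_eq_lintegral (y : ℝ) :
    ENNReal.ofReal (Real.exp (-y)) = ∫⁻ t in Ioi y, ENNReal.ofReal (Real.exp (-t)) := by
  have hi : IntegrableOn (fun t : ℝ => Real.exp (-t)) (Ioi y) := by
    simpa using integrableOn_exp_mul_Ioi (a := -1) (by norm_num) y
  rw [← integral_exp_neg_Ioi, ofReal_integral_eq_lintegral_ofReal hi
    (Eventually.of_forall fun t => (Real.exp_pos _).le)]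

variable {ν : Measure ℝ}

/-- An atomless measure is carried to Lebesgue measure on the half-line by its own distribution
function. The set is an initial interval with supremum `b`; approaching `b` from below bounds its
mass above by `t`, approaching from outside bounds it below. Infinite total mass keeps `b` finite.
-/
theorem measure_setOf_real_Iic_lt (hfin : ∀ x, ν (Iic x) ≠ ∞) (hat : ∀ x, ν {x} = 0)
    (h0 : ν (Iio 0) = 0) (htop : ν univ = ∞) {t : ℝ} (ht : 0 < t) :
    ν {x | ν.real (Iic x) < t} = ENNReal.ofReal t := by
  set s := {x | ν.real (Iic x) < t} with hs
  have hmono : Monotone fun x => ν.real (Iic x) := fun x y hxy =>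
    measureReal_mono (Iic_subset_Iic.2 hxy) (hfin y)
  have hne : s.Nonempty := by
    refine ⟨-1, ?_⟩
    have : ν (Iic (-1)) = 0 := measure_mono_null (Iic_subset_Iio.2 (by norm_num)) h0
    simp [hs, measureReal_def, this, ht]
  have hbdd : BddAbove s := by
    have h1 : Tendsto (fun n : ℕ => ν (Iic (n : ℝ))) atTop (𝓝 ∞) := by
      rw [← htop]
      have hu : (⋃ n : ℕ, Iic (n : ℝ)) = univ := by
        ext x
        simpa using exists_nat_ge x
      rw [← hu]
      exact tendsto_measure_iUnion_atTop fun n m hnm => Iic_subset_Iic.2 (by exact_mod_cast hnm)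
    obtain ⟨n, hn⟩ := (h1.eventually (lt_mem_nhds (ENNReal.ofReal_lt_top (r := t)))).exists
    refine ⟨n, fun x hx => ?_⟩
    by_contra! hlt
    have h2 : t < ν.real (Iic (n : ℝ)) := (ENNReal.ofReal_lt_iff_lt_toReal ht.le (hfin _)).1 hn
    exact absurd (h2.trans_le (hmono hlt.le)) (not_lt.2 (le_of_lt hx))
  set b := sSup s with hb
  have hlow : ∀ y < b, y ∈ s := fun y hy => by
    obtain ⟨x, hx, hyx⟩ := exists_lt_of_lt_csSup hne hy
    exact (hmono hyx.le).trans_lt hx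
  have hsub : s ⊆ Iic b := fun x hx => le_csSup hbdd hx
  have hIio : ν (Iio b) = ν (Iic b) := by
    rw [← Iio_union_right]
    exact le_antisymm (measure_mono subset_union_left)
      ((measure_union_le _ _).trans (by rw [hat, add_zero]))
  have heq : ν s = ν (Iic b) :=
    le_antisymm (measure_mono hsub) (hIio ▸ measure_mono fun y hy => hlow y hy)
  rw [heq]
  refine le_antisymm ?_ ?_
  · have hu : (⋃ n : ℕ, Iic (b - 1 / ((n : ℝ) + 1))) = Iio b := by
      ext x
      simp only [mem_iUnion, mem_Iic, mem_Iio]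
      constructor
      · rintro ⟨n, hn⟩
        have : (0 : ℝ) < 1 / ((n : ℝ) + 1) := by positivity
        linarith
      · intro hx
        obtain ⟨n, hn⟩ := exists_nat_one_div_lt (sub_pos.2 hx)
        exact ⟨n, by linarith⟩
    have hm : Monotone fun n : ℕ => Iic (b - 1 / ((n : ℝ) + 1)) := fun n m hnm =>
      Iic_subset_Iic.2 (sub_le_sub_left (one_div_le_one_div_of_le (by positivity)
        (by simpa using hnm)) _)
    rw [← hIio, ← hu]
    refine le_of_tendsto' (tendsto_measure_iUnion_atTop hm) fun n => ?_
    have h2 : (0 : ℝ) < 1 / ((n : ℝ) + 1) := by positivity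
    have h1 : ν.real (Iic (b - 1 / ((n : ℝ) + 1))) < t := hlow _ (by linarith)
    exact ((ENNReal.lt_ofReal_iff_toReal_lt (hfin _)).2 h1).le
  · have hi : (⋂ n : ℕ, Iic (b + 1 / ((n : ℝ) + 1))) = Iic b := by
      ext x
      simp only [mem_iInter, mem_Iic]
      constructor
      · intro h
        by_contra! hx
        obtain ⟨n, hn⟩ := exists_nat_one_div_lt (sub_pos.2 hx)
        linarith [h n]
      · intro hx n
        have : (0 : ℝ) < 1 / ((n : ℝ) + 1) := by positivity
        linarith
    have hm : Antitone fun n : ℕ => Iic (b + 1 / ((n : ℝ) + 1)) := fun n m hnm =>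
      Iic_subset_Iic.2 (by
        have := one_div_le_one_div_of_le (a := (n : ℝ) + 1) (b := m + 1) (by positivity)
          (by simpa using hnm)
        linarith)
    rw [← hi]
    refine ge_of_tendsto' (tendsto_measure_iInter_atTop
      (fun n => measurableSet_Iic.nullMeasurableSet) hm ⟨0, hfin _⟩) fun n => ?_
    have h2 : (0 : ℝ) < 1 / ((n : ℝ) + 1) := by positivity
    have h1 : b + 1 / ((n : ℝ) + 1) ∉ s := fun h => by
      have := hsub h
      simp only [mem_Iic] at this
      linarith
    exact (ENNReal.ofReal_le_iff_le_toReal (hfin _)).2 (not_lt.1 h1)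

/-- Write `exp (-y)` as the integral of `exp (-t)` over `t > y` and swap the integrals. The inner
measure is `t` by the previous change of scale, and the integral of `t exp (-t)` over the half-line
is `Γ(2) = 1`. -/
theorem lintegral_exp_neg_real_Iic (hfin : ∀ x, ν (Iic x) ≠ ∞) (hat : ∀ x, ν {x} = 0)
    (h0 : ν (Iio 0) = 0) (htop : ν univ = ∞) :
    ∫⁻ x, ENNReal.ofReal (Real.exp (-ν.real (Iic x))) ∂ν = 1 := by
  have : IsLocallyFiniteMeasure ν :=
    ⟨fun x => ⟨Iic (x + 1), Iic_mem_nhds (by linarith), (hfin _).lt_top⟩⟩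
  have hmono : Monotone fun x => ν.real (Iic x) := fun x y hxy =>
    measureReal_mono (Iic_subset_Iic.2 hxy) (hfin y)
  have hmeas : Measurable fun x => ν.real (Iic x) := hmono.measurable
  have h1 : ∀ x, ENNReal.ofReal (Real.exp (-ν.real (Iic x))) =
      ∫⁻ t in Ioi (0 : ℝ), {p : ℝ × ℝ | ν.real (Iic p.1) < p.2}.indicator
        (fun p => ENNReal.ofReal (Real.exp (-p.2))) (x, t) := fun x => by
    rw [ofReal_exp_neg_eq_lintegral, ← lintegral_indicator measurableSet_Ioi,
      ← lintegral_indicator measurableSet_Ioi]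
    refine lintegral_congr fun t => ?_
    by_cases ht : ν.real (Iic x) < t
    · have : 0 < t := measureReal_nonneg.trans_lt ht
      simp [indicator, ht, this]
    · simp [indicator, ht]
  have hset : MeasurableSet {p : ℝ × ℝ | ν.real (Iic p.1) < p.2} :=
    measurableSet_lt (hmeas.comp measurable_fst) measurable_snd
  simp_rw [h1]
  rw [lintegral_lintegral_swap]
  · rw [← lintegral_ofReal_mul_exp_neg]
    refine setLIntegral_congr_fun measurableSet_Ioi fun t ht => ?_
    rw [← measure_setOf_real_Iic_lt hfin hat h0 htop ht, ← lintegral_indicator_const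
      (measurableSet_lt hmeas measurable_const)]
    rfl
  · exact ((by fun_prop : Measurable fun p : ℝ × ℝ =>
      ENNReal.ofReal (Real.exp (-p.2))).indicator hset).aemeasurable

end LayerCake

/-! ### The first nonempty level of a discretized Poisson process -/

section Levels

variable {Ω E : Type*} {Φ : Ω → Set E}

theorem count_eq_zero_iff {A : Set E} {ω : Ω} : count Φ A ω = 0 ↔ ∀ p ∈ Φ ω, p ∉ A := by
  rw [count, encard_eq_zero, eq_empty_iff_forall_notMem]
  simp

variable [MeasurableSpace E]

theorem lintegral_pointMeasure_indicator {A C : Set E} (hC : MeasurableSet C) {a : E → ℝ≥0∞}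
    (ha : Measurable a) {p : E} (h : A ∩ C = {p}) :
    ∫⁻ x, C.indicator a x ∂pointMeasure A = a p := by
  rw [lintegral_pointMeasure _ (ha.indicator hC), tsum_subtype A (C.indicator a),
    indicator_indicator, h, ← tsum_subtype, tsum_singleton]

/-- For a discretization `K` of the positions, the event that the first nonempty level contains a
single point `p`, and that `c` plus the sum of `f` over the later levels is at most `a p`. -/
def firstLevel (Φ : Ω → Set E) (K : E → ℕ) (f a : E → ℝ≥0∞) (c : ℝ≥0∞) (k : ℕ) : Set Ω :=
  {ω | count Φ {p | K p < k} ω = 0 ∧ count Φ {p | K p = k} ω = 1 ∧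
    c + ∫⁻ x, {p | k < K p}.indicator f x ∂pointMeasure (Φ ω) ≤
      ∫⁻ x, {p | K p = k}.indicator a x ∂pointMeasure (Φ ω)}

theorem pairwise_disjoint_firstLevel {K : E → ℕ} {f a : E → ℝ≥0∞} {c : ℝ≥0∞} :
    Pairwise (Function.onFun Disjoint (firstLevel Φ K f a c)) := by
  have key : ∀ j k, j < k → Disjoint (firstLevel Φ K f a c j) (firstLevel Φ K f a c k) := by
    intro j k hjk
    refine disjoint_left.2 fun ω h1 h2 => ?_
    obtain ⟨p, hp⟩ := encard_eq_one.1 h1.2.1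
    have hp' : p ∈ Φ ω ∩ {p | K p = j} := hp ▸ mem_singleton p
    exact count_eq_zero_iff.1 h2.1 p hp'.1 (hp'.2.trans_lt hjk)
  intro j k hjk
  rcases lt_or_gt_of_ne hjk with h | h
  · exact key j k h
  · exact (key k j h).symm

variable [MeasurableSpace Ω] {μ : Measure E} {P : Measure Ω}

theorem measurableSet_firstLevel (h : IsPoissonProcess Φ μ P) {K : E → ℕ} (hK : Measurable K)
    {f a : E → ℝ≥0∞} (hf : Measurable f) (ha : Measurable a) (c : ℝ≥0∞) (k : ℕ) :
    MeasurableSet (firstLevel Φ K f a c k) := by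
  have h1 : MeasurableSet {p | K p < k} := hK measurableSet_Iio
  have h2 : MeasurableSet {p | K p = k} := hK (measurableSet_singleton k)
  have h3 : MeasurableSet {p | k < K p} := hK measurableSet_Ioi
  have h4 : MeasurableSet {ω | c + ∫⁻ x, {p | k < K p}.indicator f x ∂pointMeasure (Φ ω) ≤
      ∫⁻ x, {p | K p = k}.indicator a x ∂pointMeasure (Φ ω)} :=
    measurableSet_le ((h.measurable_lintegral (hf.indicator h3)).const_add c)
      (h.measurable_lintegral (ha.indicator h2))
  exact ((h.measurable_count _ h1) (measurableSet_singleton 0)).inter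
    (((h.measurable_count _ h2) (measurableSet_singleton 1)).inter h4)

theorem measure_count_triple (h : IsPoissonProcess Φ μ P) {A : Fin 3 → Set E}
    (hA : ∀ i, MeasurableSet (A i)) (hd : Pairwise fun i j => Disjoint (A i) (A j))
    (hμ : ∀ i, μ (A i) ≠ ∞) :
    P {ω | count Φ (A 0) ω = 0 ∧ count Φ (A 1) ω = 1 ∧ count Φ (A 2) ω = 0} =
      ENNReal.ofReal (Real.exp (-(μ.real (A 0) + μ.real (A 1) + μ.real (A 2)))) * μ (A 1) := by
  have hi := (h.iIndepFun_count hA hd).meas_iInter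
    (s := ![{ω | count Φ (A 0) ω = 0}, {ω | count Φ (A 1) ω = 1}, {ω | count Φ (A 2) ω = 0}]) (by
      intro i
      fin_cases i
      · exact ⟨{0}, trivial, rfl⟩
      · exact ⟨{1}, trivial, rfl⟩
      · exact ⟨{0}, trivial, rfl⟩)
  have hset : {ω | count Φ (A 0) ω = 0 ∧ count Φ (A 1) ω = 1 ∧ count Φ (A 2) ω = 0} =
      ⋂ i, ![{ω | count Φ (A 0) ω = 0}, {ω | count Φ (A 1) ω = 1},
        {ω | count Φ (A 2) ω = 0}] i := by
    ext ω
    simp [Fin.forall_fin_succ]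
  have h0 := h.poisson (A 0) (hA 0) (hμ 0) 0
  have h1 := h.poisson (A 1) (hA 1) (hμ 1) 1
  have h2 := h.poisson (A 2) (hA 2) (hμ 2) 0
  rw [poissonMeasure_singleton] at h0 h1 h2
  simp only [Nat.cast_zero, Nat.cast_one, pow_zero, pow_one, Nat.factorial_zero, Nat.factorial_one,
    mul_one, div_one] at h0 h1 h2
  rw [hset, hi]
  simp only [Fin.prod_univ_three, Matrix.cons_val_zero, Matrix.cons_val_one, Matrix.cons_val]
  rw [h0, h1, h2, ← ENNReal.ofReal_toReal (hμ 1), ← ENNReal.ofReal_mul (Real.exp_pos _).le,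
    ← ENNReal.ofReal_mul (by positivity), ← ENNReal.ofReal_mul (Real.exp_pos _).le]
  congr 1
  rw [neg_add, neg_add, Real.exp_add, Real.exp_add, ENNReal.ofReal_toReal (hμ 1)]
  simp only [measureReal_def, ENNReal.coe_toNNReal_eq_toReal]
  ring

variable [IsProbabilityMeasure P]

/-- Restricted to the event that the lower levels are empty and level `k` holds one point, that
point has law `μ` on the level, weighted by `exp (-μ {K ≤ k})`, and it is independent of the sum
over the later levels. -/
theorem measure_firstLevel (h : IsPoissonProcess Φ μ P) {K : E → ℕ} (hK : Measurable K)
    (hfin : ∀ k, μ {p | K p ≤ k} ≠ ∞) {f a : E → ℝ≥0∞} (hf : Measurable f) (ha : Measurable a)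
    (c : ℝ≥0∞) (k : ℕ) :
    P (firstLevel Φ K f a c k) = ∫⁻ p in {p | K p = k},
      ENNReal.ofReal (Real.exp (-μ.real {p' | K p' ≤ K p})) *
        P {ω | c + ∫⁻ x, {p' | K p < K p'}.indicator f x ∂pointMeasure (Φ ω) ≤ a p} ∂μ := by
  set C := {p | K p = k} with hCdef
  set w := ENNReal.ofReal (Real.exp (-μ.real {p' | K p' ≤ k})) with hw
  set Y := fun ω => ∫⁻ x, C.indicator a x ∂pointMeasure (Φ ω) with hY
  set Z := fun ω => ∫⁻ x, {p | k < K p}.indicator f x ∂pointMeasure (Φ ω) with hZ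
  have hC : MeasurableSet C := hK (measurableSet_singleton k)
  have hlt : MeasurableSet {p | K p < k} := hK measurableSet_Iio
  have hgt : MeasurableSet {p | k < K p} := hK measurableSet_Ioi
  have hYm : Measurable Y := h.measurable_lintegral (ha.indicator hC)
  have hZm : Measurable Z := h.measurable_lintegral (hf.indicator hgt)
  have hCfin : μ C ≠ ∞ := ne_top_of_le_ne_top (hfin k) (measure_mono fun p hp => le_of_eq hp)
  have hltfin : μ {p | K p < k} ≠ ∞ :=
    ne_top_of_le_ne_top (hfin k) (measure_mono fun p (hp : K p < k) => hp.le)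
  set D := {ω | count Φ {p | K p < k} ω = 0 ∧ count Φ C ω = 1} with hD
  have hDm : MeasurableSet D := ((h.measurable_count _ hlt) (measurableSet_singleton 0)).inter
    ((h.measurable_count _ hC) (measurableSet_singleton 1))
  have hYZ : Measurable fun ω => (Y ω, Z ω) := hYm.prodMk hZm
  -- For a value set `s`, the event `D ∩ {Y ∈ s}` says that three disjoint regions contain `0`, `1`
  -- and `0` points: the lower levels, the part of level `k` where `a ∈ s`, and the rest of level
  -- `k`. The tail `Z` vanishes on all three, hence is independent of their counts.
  have hrect : ∀ s t, MeasurableSet s → MeasurableSet t →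
      ((P.restrict D).map fun ω => (Y ω, Z ω)) (s ×ˢ t) =
        (w • (μ.restrict C).map a) s * (P.map Z) t := by
    intro s t hs ht
    let A : Fin 3 → Set E := ![{p | K p < k}, C ∩ a ⁻¹' s, C \ a ⁻¹' s]
    have hA : ∀ i, MeasurableSet (A i) := by
      intro i
      fin_cases i
      · exact hlt
      · exact hC.inter (ha hs)
      · exact hC.diff (ha hs)
    have hAd : Pairwise fun i j => Disjoint (A i) (A j) := by
      have h01 : Disjoint {p | K p < k} C := disjoint_left.2 fun p (hp : K p < k) (hp' : K p = k) =>
        hp.ne hp'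
      have d01 : Disjoint (A 0) (A 1) := h01.mono_right inter_subset_left
      have d02 : Disjoint (A 0) (A 2) := h01.mono_right sdiff_subset
      have d12 : Disjoint (A 1) (A 2) := disjoint_left.2 fun p hp hp' => hp'.2 hp.2
      intro i j hij
      fin_cases i <;> fin_cases j
      all_goals first
        | exact absurd rfl hij
        | exact d01
        | exact d02
        | exact d12
        | exact d01.symm
        | exact d02.symm
        | exact d12.symm
    have hAfin : ∀ i, μ (A i) ≠ ∞ := by
      intro i
      fin_cases i
      · exact hltfin
      · exact ne_top_of_le_ne_top hCfin (measure_mono inter_subset_left)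
      · exact ne_top_of_le_ne_top hCfin (measure_mono sdiff_subset)
    have hfA : ∀ i, ∀ x ∈ A i, {p | k < K p}.indicator f x = 0 := by
      have hle : ∀ i, ∀ x ∈ A i, K x ≤ k := by
        intro i x hx
        fin_cases i
        · exact le_of_lt hx
        · exact le_of_eq hx.1
        · exact le_of_eq hx.1
      exact fun i x hx => indicator_of_notMem (s := {p | k < K p}) (not_lt.2 (hle i x hx)) _
    have hind := indepFun_iff_measure_inter_preimage_eq_mul.1
      (h.indepFun_count_lintegral hA hAd (hf.indicator hgt) hfA) {![0, 1, 0]} t .of_discrete ht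
    have hpre : (fun ω i => count Φ (A i) ω) ⁻¹' {![0, 1, 0]} =
        {ω | count Φ (A 0) ω = 0 ∧ count Φ (A 1) ω = 1 ∧ count Φ (A 2) ω = 0} := by
      ext ω
      simp [funext_iff, Fin.forall_fin_succ]
    have hDY : D ∩ Y ⁻¹' s = (fun ω i => count Φ (A i) ω) ⁻¹' {![0, 1, 0]} := by
      rw [hpre]
      ext ω
      constructor
      · rintro ⟨⟨h1, h2⟩, h3⟩
        obtain ⟨p, hp⟩ := encard_eq_one.1 h2
        have hYp : Y ω = a p := lintegral_pointMeasure_indicator hC ha hp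
        have hps : a p ∈ s := hYp ▸ h3
        refine ⟨h1, ?_, ?_⟩
        · change (Φ ω ∩ (C ∩ a ⁻¹' s)).encard = 1
          rw [← inter_assoc, hp, encard_eq_one]
          exact ⟨p, inter_eq_left.2 (singleton_subset_iff.2 hps)⟩
        · refine count_eq_zero_iff.2 fun x hx hxA => hxA.2 ?_
          have : x ∈ ({p} : Set E) := hp ▸ ⟨hx, hxA.1⟩
          rw [mem_singleton_iff.1 this]
          exact hps
      · rintro ⟨h1, h2, h3⟩
        obtain ⟨p, hp⟩ := encard_eq_one.1 h2
        have hpm : p ∈ Φ ω ∩ (C ∩ a ⁻¹' s) := hp ▸ mem_singleton p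
        have hp2 : Φ ω ∩ C = {p} := by
          refine Subset.antisymm (fun x hx => ?_)
            (singleton_subset_iff.2 ⟨hpm.1, hpm.2.1⟩)
          rw [← hp]
          refine ⟨hx.1, hx.2, ?_⟩
          by_contra hxs
          exact count_eq_zero_iff.1 h3 x hx.1 ⟨hx.2, hxs⟩
        refine ⟨⟨h1, encard_eq_one.2 ⟨p, hp2⟩⟩, ?_⟩
        change Y ω ∈ s
        rw [show Y ω = a p from lintegral_pointMeasure_indicator hC ha hp2]
        exact hpm.2.2
    have hwA : w = ENNReal.ofReal (Real.exp (-(μ.real (A 0) + μ.real (A 1) + μ.real (A 2)))) := by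
      rw [hw]
      congr 3
      have hu : {p' | K p' ≤ k} = A 0 ∪ (A 1 ∪ A 2) := by
        change _ = {p | K p < k} ∪ ((C ∩ a ⁻¹' s) ∪ (C \ a ⁻¹' s))
        rw [inter_union_sdiff]
        ext p
        exact (le_iff_lt_or_eq : K p ≤ k ↔ K p < k ∨ K p = k)
      rw [hu, measureReal_union (Disjoint.union_right (hAd (by decide)) (hAd (by decide)))
        ((hA 1).union (hA 2)) (hAfin 0) (measure_union_ne_top (hAfin 1) (hAfin 2)),
        measureReal_union (hAd (by decide)) (hA 2) (hAfin 1) (hAfin 2), add_assoc]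
    rw [Measure.map_apply hYZ (hs.prod ht), Measure.restrict_apply (hYZ (hs.prod ht)),
      Measure.smul_apply, smul_eq_mul, Measure.map_apply ha hs,
      Measure.restrict_apply (ha hs), Measure.map_apply hZm ht]
    have hset : (fun ω => (Y ω, Z ω)) ⁻¹' s ×ˢ t ∩ D = (D ∩ Y ⁻¹' s) ∩ Z ⁻¹' t := by
      ext ω
      simp only [mem_inter_iff, mem_preimage, mem_prod]
      tauto
    rw [hset, hDY, hind, hpre, measure_count_triple h hA hAd hAfin, ← hwA, inter_comm (a ⁻¹' s) C]
    rfl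
  have hfinC : IsFiniteMeasure (w • (μ.restrict C).map a) := by
    constructor
    rw [Measure.smul_apply, Measure.map_apply ha .univ, preimage_univ, Measure.restrict_apply_univ]
    exact ENNReal.mul_lt_top ENNReal.ofReal_lt_top hCfin.lt_top
  have hPZ : IsProbabilityMeasure (P.map Z) := Measure.isProbabilityMeasure_map hZm.aemeasurable
  -- Agreement on rectangles identifies the joint law of `Y` and `Z` on `D` as a product, so the
  -- inequality between them can be integrated out.
  have hprod := Measure.prod_eq hrect
  have hset : MeasurableSet {p : ℝ≥0∞ × ℝ≥0∞ | c + p.2 ≤ p.1} :=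
    measurableSet_le (measurable_snd.const_add c) measurable_fst
  have hev : firstLevel Φ K f a c k = (fun ω => (Y ω, Z ω)) ⁻¹' {p | c + p.2 ≤ p.1} ∩ D := by
    ext ω
    simp only [firstLevel, mem_ofPred_eq, mem_inter_iff, mem_preimage, hD]
    tauto
  have hq : Measurable fun y => P.map Z (Prod.mk y ⁻¹' {p : ℝ≥0∞ × ℝ≥0∞ | c + p.2 ≤ p.1}) :=
    measurable_measure_prodMk_left hset
  rw [hev, ← Measure.restrict_apply (hYZ hset), ← Measure.map_apply hYZ hset, ← hprod,
    Measure.prod_apply hset, lintegral_smul_measure, lintegral_map hq ha, smul_eq_mul,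
    ← lintegral_const_mul w (f := fun p => P.map Z
      (Prod.mk (a p) ⁻¹' {p : ℝ≥0∞ × ℝ≥0∞ | c + p.2 ≤ p.1})) (hq.comp ha)]
  refine setLIntegral_congr_fun hC fun p hp => ?_
  have hp' : K p = k := hp
  rw [hp', Measure.map_apply hZm (measurable_prodMk_left hset)]
  rfl

theorem measure_iUnion_firstLevel (h : IsPoissonProcess Φ μ P) {K : E → ℕ} (hK : Measurable K)
    (hfin : ∀ k, μ {p | K p ≤ k} ≠ ∞) {f a : E → ℝ≥0∞} (hf : Measurable f) (ha : Measurable a)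
    (c : ℝ≥0∞) :
    P (⋃ k, firstLevel Φ K f a c k) = ∫⁻ p,
      ENNReal.ofReal (Real.exp (-μ.real {p' | K p' ≤ K p})) *
        P {ω | c + ∫⁻ x, {p' | K p < K p'}.indicator f x ∂pointMeasure (Φ ω) ≤ a p} ∂μ := by
  rw [measure_iUnion pairwise_disjoint_firstLevel fun k => measurableSet_firstLevel h hK hf ha c k]
  simp_rw [measure_firstLevel h hK hfin hf ha c]
  rw [← lintegral_iUnion (s := fun k => {p | K p = k}) (fun k => hK (measurableSet_singleton k))]
  · have : (⋃ k, {p | K p = k}) = univ := by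
      ext p
      simp
    rw [this, setLIntegral_univ]
  · intro j k hjk
    exact disjoint_left.2 fun p hp hp' => hjk (hp.symm.trans hp')

end Levels

/-! ### The law of the first point, by refinement of dyadic levels -/

section FirstPoint

open Filter Topology

/-- The index of the dyadic interval of length `2 ^ (-n)` that contains `x`. -/
noncomputable def dyadic (n : ℕ) (x : ℝ) : ℕ := ⌊x * 2 ^ n⌋₊

theorem dyadic_mono (n : ℕ) {x y : ℝ} (h : x ≤ y) : dyadic n x ≤ dyadic n y :=
  Nat.floor_mono (by gcongr)

theorem measurable_dyadic (n : ℕ) : Measurable (dyadic n) :=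
  Nat.measurable_floor.comp (measurable_id.mul_const _)

theorem dyadic_eq_div (n : ℕ) (x : ℝ) : dyadic n x = dyadic (n + 1) x / 2 := by
  rw [dyadic, dyadic, ← Nat.floor_div_ofNat]
  congr 1
  rw [pow_succ]
  ring

/-- The dyadic partitions are nested: halving an index gives the coarser index, so points once
separated stay separated. -/
theorem dyadic_lt_of_le {n m : ℕ} (hnm : n ≤ m) {x y : ℝ} (h : dyadic n x < dyadic n y) :
    dyadic m x < dyadic m y := by
  induction m, hnm using Nat.le_induction with
  | base => exact h
  | succ m _ ih =>
    rw [dyadic_eq_div m x, dyadic_eq_div m y] at ih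
    by_contra! hle
    exact absurd ih (not_lt.2 (Nat.div_le_div_right hle))

/-- Once `2 ^ n (y - x) > 1`, the rescaled points differ by more than one. Nonnegativity matters
because the natural floor sends all negative numbers to `0`. -/
theorem exists_dyadic_lt {x y : ℝ} (hx : 0 ≤ x) (h : x < y) : ∃ n, dyadic n x < dyadic n y := by
  obtain ⟨n, hn⟩ := pow_unbounded_of_one_lt (1 / (y - x)) (one_lt_two)
  refine ⟨n, ?_⟩
  have h1 : 1 < (y - x) * 2 ^ n := by
    rwa [div_lt_iff₀ (sub_pos.2 h), mul_comm] at hn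
  have h2 : x * 2 ^ n + 1 ≤ y * 2 ^ n := by linarith
  calc dyadic n x < dyadic n x + 1 := Nat.lt_succ_self _
    _ = ⌊x * 2 ^ n + 1⌋₊ := (Nat.floor_add_one (by positivity)).symm
    _ ≤ dyadic n y := Nat.floor_mono h2

theorem lt_of_dyadic_lt {n : ℕ} {x y : ℝ} (h : dyadic n x < dyadic n y) : x < y := by
  by_contra! hle
  exact absurd h (not_lt.2 (dyadic_mono n hle))

variable {Ω E : Type*} {Φ : Ω → Set E} {L : E → ℝ}

theorem monotone_setOf_dyadic_lt (L : E → ℝ) (x : ℝ) :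
    Monotone fun n => {p | dyadic n x < dyadic n (L p)} :=
  fun _ _ hnm _ hp => dyadic_lt_of_le hnm hp

theorem iUnion_setOf_dyadic_lt (L : E → ℝ) {x : ℝ} (hx : 0 ≤ x) :
    ⋃ n, {p | dyadic n x < dyadic n (L p)} = {p | x < L p} := by
  ext p
  simp only [mem_iUnion, mem_ofPred_eq]
  exact ⟨fun ⟨n, hn⟩ => lt_of_dyadic_lt hn, fun h => exists_dyadic_lt hx h⟩

variable [MeasurableSpace E]

theorem exists_first_of_mem_firstLevel {n k : ℕ} {f a : E → ℝ≥0∞} {c : ℝ≥0∞} {ω : Ω}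
    (hω : ω ∈ firstLevel Φ (fun p => dyadic n (L p)) f a c k) :
    ∃ p ∈ Φ ω, ∀ p' ∈ Φ ω, p' ≠ p → dyadic n (L p) < dyadic n (L p') := by
  obtain ⟨h0, h1, -⟩ := hω
  obtain ⟨p, hp⟩ := encard_eq_one.1 h1
  have hpm : p ∈ Φ ω ∩ {p | dyadic n (L p) = k} := hp ▸ mem_singleton p
  refine ⟨p, hpm.1, fun p' hp' hne => ?_⟩
  have hk : dyadic n (L p) = k := hpm.2
  rw [hk]
  have h2 : ¬ dyadic n (L p') < k := fun hlt => count_eq_zero_iff.1 h0 p' hp' hlt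
  refine lt_of_le_of_ne (not_lt.1 h2) fun heq => hne ?_
  have : p' ∈ Φ ω ∩ {p | dyadic n (L p) = k} := ⟨hp', heq.symm⟩
  rw [hp] at this
  exact this

variable [MeasurableSpace Ω] {μ : Measure E} {P : Measure Ω}

theorem measure_dyadic_le_ne_top (hfin : ∀ x, μ {p | L p ≤ x} ≠ ∞) (n k : ℕ) :
    μ {p | dyadic n (L p) ≤ k} ≠ ∞ := by
  refine ne_top_of_le_ne_top (hfin ((k + 1) / 2 ^ n)) (measure_mono fun p hp => ?_)
  have hp' : ⌊L p * 2 ^ n⌋₊ ≤ k := hp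
  have h1 := Nat.lt_floor_add_one (L p * 2 ^ n)
  have h2 : (⌊L p * 2 ^ n⌋₊ : ℝ) ≤ k := by exact_mod_cast hp'
  change L p ≤ (k + 1) / 2 ^ n
  rw [le_div_iff₀ (by positivity)]
  linarith

theorem tendsto_exp_neg_dyadic (hL : Measurable L) (hfin : ∀ x, μ {p | L p ≤ x} ≠ ∞) {x : ℝ}
    (hx : 0 ≤ x) :
    Tendsto (fun n => ENNReal.ofReal (Real.exp (-μ.real {p | dyadic n (L p) ≤ dyadic n x}))) atTop
      (𝓝 (ENNReal.ofReal (Real.exp (-μ.real {p | L p ≤ x})))) := by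
  have hc : ∀ n, {p | dyadic n (L p) ≤ dyadic n x} = {p | dyadic n x < dyadic n (L p)}ᶜ := fun n => by
    ext p
    simp
  have hi : ⋂ n, {p | dyadic n (L p) ≤ dyadic n x} = {p | L p ≤ x} := by
    simp_rw [hc]
    rw [← compl_iUnion, iUnion_setOf_dyadic_lt L hx]
    ext p
    simp
  have h1 : Tendsto (fun n => μ {p | dyadic n (L p) ≤ dyadic n x}) atTop (𝓝 (μ {p | L p ≤ x})) := by
    rw [← hi]
    refine tendsto_measure_iInter_atTop (fun n => MeasurableSet.nullMeasurableSet
      (((measurable_dyadic n).comp hL) measurableSet_Iic)) (fun n m hnm => ?_)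
      ⟨0, measure_dyadic_le_ne_top hfin 0 _⟩
    simp only [hc]
    exact compl_subset_compl.2 (monotone_setOf_dyadic_lt L x hnm)
  have h2 := (ENNReal.tendsto_toReal (hfin x)).comp h1
  exact (ENNReal.continuous_ofReal.tendsto _).comp
    ((Real.continuous_exp.tendsto _).comp h2.neg)

/-- A dyadic level set contains everything up to `x`, so discretization only lowers the weight. The
limiting weight thus dominates all its approximations. -/
theorem exp_neg_dyadic_le (hfin : ∀ x, μ {p | L p ≤ x} ≠ ∞) (n : ℕ) (x : ℝ) :
    ENNReal.ofReal (Real.exp (-μ.real {p | dyadic n (L p) ≤ dyadic n x})) ≤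
      ENNReal.ofReal (Real.exp (-μ.real {p | L p ≤ x})) := by
  refine ENNReal.ofReal_le_ofReal (Real.exp_le_exp.2 (neg_le_neg ?_))
  exact measureReal_mono (fun p hp => dyadic_mono n hp) (measure_dyadic_le_ne_top hfin n _)

theorem measurable_exp_neg (hfin : ∀ x, μ {p | L p ≤ x} ≠ ∞) :
    Measurable fun x => ENNReal.ofReal (Real.exp (-μ.real {p | L p ≤ x})) := by
  have hmono : Monotone fun x => μ.real {p | L p ≤ x} := fun x y hxy =>
    measureReal_mono (fun p hp => le_trans hp hxy) (hfin y)
  exact (Real.measurable_exp.comp hmono.measurable.neg).ennreal_ofReal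

/-- The one-dimensional identity for the image of `μ` under `L`. It provides the integrable majorant
for the dyadic limit, the almost sure existence of a first point, and the normalization of the law
of the serving path-loss. -/
theorem lintegral_exp_neg_eq_one (hL : Measurable L) (hL0 : ∀ p, 0 ≤ L p)
    (hfin : ∀ x, μ {p | L p ≤ x} ≠ ∞) (hat : ∀ x, μ {p | L p = x} = 0) (htop : μ univ = ∞) :
    ∫⁻ p, ENNReal.ofReal (Real.exp (-μ.real {p' | L p' ≤ L p})) ∂μ = 1 := by
  have hIic : ∀ x, μ.map L (Iic x) = μ {p | L p ≤ x} := fun x => Measure.map_apply hL measurableSet_Iic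
  have h := lintegral_exp_neg_real_Iic (ν := μ.map L) (fun x => by rw [hIic]; exact hfin x)
    (fun x => by rw [Measure.map_apply hL (measurableSet_singleton x)]; exact hat x)
    (by
      rw [Measure.map_apply hL measurableSet_Iio]
      have : L ⁻¹' Iio 0 = ∅ := by
        ext p
        simpa using hL0 p
      rw [this, measure_empty])
    (by rw [Measure.map_apply hL .univ, preimage_univ, htop])
  have hr : ∀ x, (μ.map L).real (Iic x) = μ.real {p | L p ≤ x} := fun x =>
    congrArg ENNReal.toReal (hIic x)
  simp only [hr] at h
  rwa [lintegral_map (measurable_exp_neg hfin) hL] at h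

/-- The probability that `c` plus the sum of `f` over the points beyond `x` is at most `v`. -/
noncomputable def tailProb {β : Type*} [LT β] (Φ : Ω → Set E) (P : Measure Ω) (L : E → β)
    (f : E → ℝ≥0∞) (c : ℝ≥0∞) (x : β) (v : ℝ≥0∞) : ℝ≥0∞ :=
  P {ω | c + ∫⁻ y, {p | x < L p}.indicator f y ∂pointMeasure (Φ ω) ≤ v}

theorem tailProb_mono {β : Type*} [LT β] (K : E → β) (f : E → ℝ≥0∞) (c : ℝ≥0∞) (k : β) :
    Monotone (tailProb Φ P K f c k) := by
  intro v w hvw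
  unfold tailProb
  refine measure_mono ?_
  intro ω hω
  exact le_trans (show _ ≤ v from hω) hvw

/-- Joint measurability comes cheaply: the level takes countably many values, and for each of them
the function is monotone in the threshold. -/
theorem measurable_tailProb_nat (K : E → ℕ) (f : E → ℝ≥0∞) (c : ℝ≥0∞) :
    Measurable fun q : ℕ × ℝ≥0∞ => tailProb Φ P K f c q.1 q.2 :=
  measurable_from_prod_countable_right fun k => (tailProb_mono K f c k).measurable

theorem measurable_tailProb_dyadic (n : ℕ) (L : E → ℝ) (f : E → ℝ≥0∞) (c : ℝ≥0∞) :
    Measurable fun q : ℝ × ℝ≥0∞ => tailProb Φ P (fun p => dyadic n (L p)) f c (dyadic n q.1) q.2 :=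
  Measurable.comp (g := fun q : ℕ × ℝ≥0∞ => tailProb Φ P (fun p => dyadic n (L p)) f c q.1 q.2)
    (f := fun q : ℝ × ℝ≥0∞ => (dyadic n q.1, q.2))
    (measurable_tailProb_nat (fun p => dyadic n (L p)) f c)
    (((measurable_dyadic n).comp measurable_fst).prodMk measurable_snd)

variable [IsProbabilityMeasure P]

theorem tendsto_tailProb (h : IsPoissonProcess Φ μ P) (hL : Measurable L) {f : E → ℝ≥0∞}
    (hf : Measurable f) (c : ℝ≥0∞) {x : ℝ} (hx : 0 ≤ x) (v : ℝ≥0∞) :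
    Tendsto (fun n => tailProb Φ P (fun p => dyadic n (L p)) f c (dyadic n x) v) atTop
      (𝓝 (tailProb Φ P L f c x v)) := by
  have hm : ∀ n, MeasurableSet {p | dyadic n x < dyadic n (L p)} := fun n =>
    ((measurable_dyadic n).comp hL) measurableSet_Ioi
  have hmono : Monotone fun n => {p | dyadic n x < dyadic n (L p)}.indicator f := fun n m hnm p =>
    indicator_le_indicator_of_subset (monotone_setOf_dyadic_lt L x hnm) (fun _ => zero_le) p
  have hset : {ω | c + ∫⁻ y, {p | x < L p}.indicator f y ∂pointMeasure (Φ ω) ≤ v} =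
      ⋂ n, {ω | c + ∫⁻ y, {p | dyadic n x < dyadic n (L p)}.indicator f y ∂pointMeasure (Φ ω) ≤ v} := by
    ext ω
    simp only [mem_ofPred_eq, mem_iInter]
    have h1 : ∫⁻ y, {p | x < L p}.indicator f y ∂pointMeasure (Φ ω) =
        ⨆ n, ∫⁻ y, {p | dyadic n x < dyadic n (L p)}.indicator f y ∂pointMeasure (Φ ω) := by
      rw [← lintegral_iSup (fun n => hf.indicator (hm n)) hmono]
      refine lintegral_congr fun y => ?_
      rw [← iUnion_setOf_dyadic_lt L hx, indicator_iUnion_apply rfl]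
    rw [h1, ENNReal.add_iSup, iSup_le_iff]
  rw [tailProb, hset]
  refine tendsto_measure_iInter_atTop (fun n => ?_) (fun n m hnm ω hω => ?_) ⟨0, measure_ne_top _ _⟩
  · exact (measurableSet_le ((h.measurable_lintegral (hf.indicator (hm n))).const_add c)
      measurable_const).nullMeasurableSet
  · exact le_trans (add_le_add_right (lintegral_mono (hmono hnm)) c) hω

/-- A pointwise limit of the dyadic versions. The truncation at `0` is there because the dyadic
approximation converges only at nonnegative arguments. -/
theorem measurable_tailProb (h : IsPoissonProcess Φ μ P) (hL : Measurable L) {f : E → ℝ≥0∞}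
    (hf : Measurable f) (c : ℝ≥0∞) :
    Measurable fun q : ℝ × ℝ≥0∞ => tailProb Φ P L f c (max q.1 0) q.2 := by
  refine measurable_of_tendsto_metrizable (f := fun n (q : ℝ × ℝ≥0∞) =>
    tailProb Φ P (fun p => dyadic n (L p)) f c (dyadic n (max q.1 0)) q.2) (fun n => ?_) ?_
  · exact Measurable.comp (g := fun q : ℝ × ℝ≥0∞ =>
      tailProb Φ P (fun p => dyadic n (L p)) f c (dyadic n q.1) q.2)
      (f := fun q : ℝ × ℝ≥0∞ => (max q.1 0, q.2)) (measurable_tailProb_dyadic n L f c) (by fun_prop)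
  · exact tendsto_pi_nhds.2 fun q => tendsto_tailProb h hL hf c (le_max_right _ _) q.2

theorem tendsto_measure_iUnion_firstLevel (h : IsPoissonProcess Φ μ P) (hL : Measurable L)
    (hL0 : ∀ p, 0 ≤ L p) (hfin : ∀ x, μ {p | L p ≤ x} ≠ ∞) (hat : ∀ x, μ {p | L p = x} = 0)
    (htop : μ univ = ∞) {f a : E → ℝ≥0∞} (hf : Measurable f) (ha : Measurable a) (c : ℝ≥0∞) :
    Tendsto (fun n => P (⋃ k, firstLevel Φ (fun p => dyadic n (L p)) f a c k)) atTop
      (𝓝 (∫⁻ p, ENNReal.ofReal (Real.exp (-μ.real {p' | L p' ≤ L p})) *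
        tailProb Φ P L f c (L p) (a p) ∂μ)) := by
  have h1 : ∀ n, P (⋃ k, firstLevel Φ (fun p => dyadic n (L p)) f a c k) = ∫⁻ p,
      ENNReal.ofReal (Real.exp (-μ.real {p' | dyadic n (L p') ≤ dyadic n (L p)})) *
        tailProb Φ P (fun p => dyadic n (L p)) f c (dyadic n (L p)) (a p) ∂μ := fun n =>
    measure_iUnion_firstLevel h ((measurable_dyadic n).comp hL)
      (measure_dyadic_le_ne_top hfin n) hf ha c
  simp_rw [h1]
  refine tendsto_lintegral_of_dominated_convergence
    (fun p => ENNReal.ofReal (Real.exp (-μ.real {p' | L p' ≤ L p}))) (fun n => ?_) (fun n => ?_)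
    (by rw [lintegral_exp_neg_eq_one hL hL0 hfin hat htop]; exact ENNReal.one_ne_top) ?_
  · have hK : Measurable fun p => dyadic n (L p) := (measurable_dyadic n).comp hL
    have hm : Measurable fun k : ℕ => ENNReal.ofReal
        (Real.exp (-μ.real {p' | dyadic n (L p') ≤ k})) := measurable_of_countable _
    have hm2 : Measurable fun p =>
        tailProb Φ P (fun p => dyadic n (L p)) f c (dyadic n (L p)) (a p) :=
      Measurable.comp (g := fun q : ℝ × ℝ≥0∞ =>
        tailProb Φ P (fun p => dyadic n (L p)) f c (dyadic n q.1) q.2)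
        (f := fun p => (L p, a p)) (measurable_tailProb_dyadic n L f c) (hL.prodMk ha)
    exact (hm.comp hK).mul hm2
  · refine Eventually.of_forall fun p => ?_
    refine (mul_le_of_le_one_right zero_le prob_le_one).trans (exp_neg_dyadic_le hfin n (L p))
  · refine Eventually.of_forall fun p => ?_
    exact ENNReal.Tendsto.mul (tendsto_exp_neg_dyadic hL hfin (hL0 p))
      (Or.inr (measure_ne_top _ _)) (tendsto_tailProb h hL hf c (hL0 p) (a p))
      (Or.inr ENNReal.ofReal_ne_top)

/-- Almost surely, a unique point is closest, and it is alone in its dyadic interval of some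
order. -/
theorem ae_exists_first_dyadic (h : IsPoissonProcess Φ μ P) (hL : Measurable L)
    (hL0 : ∀ p, 0 ≤ L p) (hfin : ∀ x, μ {p | L p ≤ x} ≠ ∞) (hat : ∀ x, μ {p | L p = x} = 0)
    (htop : μ univ = ∞) :
    ∀ᵐ ω ∂P, ∃ n, ∃ p ∈ Φ ω, ∀ p' ∈ Φ ω, p' ≠ p → dyadic n (L p) < dyadic n (L p') := by
  -- With `f = 0` and `a = ∞` the inequality is vacuous, so the event only says that the first
  -- nonempty level has one point; its probability tends to the total mass `1`.
  have h1 := tendsto_measure_iUnion_firstLevel h hL hL0 hfin hat htop (f := fun _ => 0)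
    (a := fun _ => ∞) measurable_const measurable_const 0
  have h2 : ∀ x, tailProb Φ P L (fun _ => 0) 0 x ∞ = 1 := fun x => by
    simp [tailProb]
  simp only [h2, mul_one] at h1
  rw [lintegral_exp_neg_eq_one hL hL0 hfin hat htop] at h1
  have hm : MeasurableSet (⋃ n, ⋃ k, firstLevel Φ (fun p => dyadic n (L p)) (fun _ => 0)
      (fun _ => ∞) 0 k) := MeasurableSet.iUnion fun n => MeasurableSet.iUnion fun k =>
    measurableSet_firstLevel h ((measurable_dyadic n).comp hL) measurable_const measurable_const 0 k
  have h3 : P (⋃ n, ⋃ k, firstLevel Φ (fun p => dyadic n (L p)) (fun _ => 0)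
      (fun _ => ∞) 0 k) = 1 :=
    le_antisymm prob_le_one (le_of_tendsto' h1 fun n => measure_mono (subset_iUnion_of_subset n
      subset_rfl))
  rw [← prob_compl_eq_zero_iff hm] at h3
  have h4 : ∀ᵐ ω ∂P, ω ∈ ⋃ n, ⋃ k, firstLevel Φ (fun p => dyadic n (L p)) (fun _ => 0)
      (fun _ => ∞) 0 k := h3
  filter_upwards [h4] with ω hω
  simp only [mem_iUnion] at hω
  obtain ⟨n, k, hk⟩ := hω
  exact ⟨n, exists_first_of_mem_firstLevel hk⟩

theorem ae_exists_first (h : IsPoissonProcess Φ μ P) (hL : Measurable L)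
    (hL0 : ∀ p, 0 ≤ L p) (hfin : ∀ x, μ {p | L p ≤ x} ≠ ∞) (hat : ∀ x, μ {p | L p = x} = 0)
    (htop : μ univ = ∞) :
    ∀ᵐ ω ∂P, ∃ p ∈ Φ ω, ∀ p' ∈ Φ ω, p' ≠ p → L p < L p' := by
  filter_upwards [ae_exists_first_dyadic h hL hL0 hfin hat htop] with ω ⟨n, p, hp, hpp⟩
  exact ⟨p, hp, fun p' hp' hne => lt_of_dyadic_lt (hpp p' hp' hne)⟩

theorem lintegral_pointMeasure_congr {A : Set E} {f g : E → ℝ≥0∞} (hf : Measurable f)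
    (hg : Measurable g) (h : ∀ p ∈ A, f p = g p) :
    ∫⁻ x, f x ∂pointMeasure A = ∫⁻ x, g x ∂pointMeasure A := by
  rw [lintegral_pointMeasure _ hf, lintegral_pointMeasure _ hg]
  exact tsum_congr fun p => h p p.2

/-- The law of the closest point and of the sum of `f` over the other points. -/
theorem measure_first (h : IsPoissonProcess Φ μ P) (hL : Measurable L)
    (hL0 : ∀ p, 0 ≤ L p) (hfin : ∀ x, μ {p | L p ≤ x} ≠ ∞) (hat : ∀ x, μ {p | L p = x} = 0)
    (htop : μ univ = ∞) {f a : E → ℝ≥0∞} (hf : Measurable f) (ha : Measurable a) (c : ℝ≥0∞) :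
    P {ω | ∃ p ∈ Φ ω, (∀ p' ∈ Φ ω, L p ≤ L p') ∧
        c + ∫⁻ y, {p' | L p < L p'}.indicator f y ∂pointMeasure (Φ ω) ≤ a p} =
      ∫⁻ p, ENNReal.ofReal (Real.exp (-μ.real {p' | L p' ≤ L p})) *
        tailProb Φ P L f c (L p) (a p) ∂μ := by
  set G := fun n => ⋃ k, firstLevel Φ (fun p => dyadic n (L p)) f a c k with hG
  set A := {ω | ∃ p ∈ Φ ω, (∀ p' ∈ Φ ω, L p ≤ L p') ∧
        c + ∫⁻ y, {p' | L p < L p'}.indicator f y ∂pointMeasure (Φ ω) ≤ a p} with hA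
  have hGm : ∀ n, MeasurableSet (G n) := fun n => MeasurableSet.iUnion fun k =>
    measurableSet_firstLevel h ((measurable_dyadic n).comp hL) hf ha c k
  -- Once the dyadic order separates the first point from all others, the first nonempty level holds
  -- it alone and the later levels are exactly the points of larger `L`.
  have key : ∀ᵐ ω ∂P, ∀ᶠ n in atTop, ω ∈ G n ↔ ω ∈ A := by
    filter_upwards [ae_exists_first_dyadic h hL hL0 hfin hat htop] with ω ⟨n, p, hp, hpp⟩
    filter_upwards [eventually_ge_atTop n] with m hm
    have hK : Measurable fun p => dyadic m (L p) := (measurable_dyadic m).comp hL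
    have hpm : ∀ p' ∈ Φ ω, p' ≠ p → dyadic m (L p) < dyadic m (L p') := fun p' hp' hne =>
      dyadic_lt_of_le hm (hpp p' hp' hne)
    have hone : ∀ k, Φ ω ∩ {p | dyadic m (L p) = k} = {p} ∨
        ¬ (count Φ {p | dyadic m (L p) < k} ω = 0 ∧ count Φ {p | dyadic m (L p) = k} ω = 1) := by
      intro k
      by_cases hk : dyadic m (L p) = k
      · left
        refine Subset.antisymm (fun p' hp' => ?_) (singleton_subset_iff.2 ⟨hp, hk⟩)
        by_contra hne
        exact absurd (hp'.2.trans hk.symm) (ne_of_gt (hpm p' hp'.1 hne))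
      · right
        rintro ⟨h0, h1⟩
        obtain ⟨p', hp'⟩ := encard_eq_one.1 h1
        have hp'm : p' ∈ Φ ω ∩ {p | dyadic m (L p) = k} := hp' ▸ mem_singleton p'
        have hne : p' ≠ p := fun he => hk (he ▸ hp'm.2)
        refine count_eq_zero_iff.1 h0 p hp ?_
        have := hpm p' hp'm.1 hne
        rwa [show dyadic m (L p') = k from hp'm.2] at this
    have hsum : ∫⁻ y, {p' | dyadic m (L p) < dyadic m (L p')}.indicator f y ∂pointMeasure (Φ ω) =
        ∫⁻ y, {p' | L p < L p'}.indicator f y ∂pointMeasure (Φ ω) := by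
      refine lintegral_pointMeasure_congr (hf.indicator (hK measurableSet_Ioi))
        (hf.indicator (hL measurableSet_Ioi)) fun p' hp' => ?_
      by_cases hne : p' = p
      · subst hne
        simp [indicator]
      · have h1 := hpm p' hp' hne
        have h2 := lt_of_dyadic_lt h1
        simp [indicator, h1, h2]
    have hA' : ω ∈ A ↔
        c + ∫⁻ y, {p' | L p < L p'}.indicator f y ∂pointMeasure (Φ ω) ≤ a p := by
      constructor
      · rintro ⟨p', hp', hmin, hle⟩
        have : p' = p := by
          by_contra hne
          exact absurd (lt_of_dyadic_lt (hpp p' hp' hne)) (not_lt.2 (hmin p hp))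
        rwa [this] at hle
      · intro hle
        refine ⟨p, hp, fun p' hp' => ?_, hle⟩
        by_cases hne : p' = p
        · rw [hne]
        · exact (lt_of_dyadic_lt (hpp p' hp' hne)).le
    rw [hA', ← hsum]
    simp only [hG, mem_iUnion]
    constructor
    · rintro ⟨k, h0, h1, hle⟩
      rcases hone k with hk | hk
      · have hpk : p ∈ Φ ω ∩ {p | dyadic m (L p) = k} := hk ▸ mem_singleton p
        rw [lintegral_pointMeasure_indicator (C := {p | dyadic m (L p) = k})
          (hK (measurableSet_singleton k)) ha hk] at hle
        rwa [show dyadic m (L p) = k from hpk.2]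
      · exact absurd ⟨h0, h1⟩ hk
    · intro hle
      have hk : Φ ω ∩ {p' | dyadic m (L p') = dyadic m (L p)} = {p} := by
        refine Subset.antisymm (fun p' hp' => ?_) (singleton_subset_iff.2 ⟨hp, rfl⟩)
        by_contra hne
        exact absurd hp'.2 (ne_of_gt (hpm p' hp'.1 hne))
      refine ⟨dyadic m (L p), count_eq_zero_iff.2 fun p' hp' hlt => ?_,
        encard_eq_one.2 ⟨p, hk⟩, ?_⟩
      · by_cases hne : p' = p
        · subst hne
          exact lt_irrefl (dyadic m (L p')) hlt
        · exact lt_asymm (hpm p' hp' hne) hlt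
      · rwa [lintegral_pointMeasure_indicator (C := {p' | dyadic m (L p') = dyadic m (L p)})
          (hK (measurableSet_singleton _)) ha hk]
  -- Measurability of `A` is not evident from its definition; this lower limit of measurable events
  -- agrees with `A` almost surely and replaces it.
  set A' := {ω | ∀ᶠ n in atTop, ω ∈ G n} with hA'
  have hA'm : MeasurableSet A' := by
    have : A' = ⋃ N, ⋂ n, ⋂ (_ : N ≤ n), G n := by
      ext ω
      simp [hA', eventually_atTop]
    rw [this]
    exact MeasurableSet.iUnion fun N => MeasurableSet.iInter fun n => MeasurableSet.iInter fun _ =>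
      hGm n
  have hAA' : A =ᵐ[P] A' := by
    filter_upwards [key] with ω hω
    refine propext ⟨fun hm => hω.mono fun n hn => hn.2 hm, fun hm => ?_⟩
    obtain ⟨n, hn1, hn2⟩ := (hω.and hm).exists
    exact hn1.1 hn2
  have hAA'' : ∀ᵐ ω ∂P, ω ∈ A ↔ ω ∈ A' := hAA'.mono fun ω hω => iff_of_eq hω
  rw [measure_congr hAA']
  refine tendsto_nhds_unique (tendsto_measure_of_ae_tendsto_indicator_of_isFiniteMeasure atTop
    hA'm hGm ?_) (tendsto_measure_iUnion_firstLevel h hL hL0 hfin hat htop hf ha c)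
  filter_upwards [key, hAA''] with ω h1 h2
  exact h1.mono fun n hn => hn.trans h2

end FirstPoint

/-! ### The gamma law and its characteristic function -/

section Gamma

open Filter Topology

variable {a r : ℝ}

theorem measurable_gammaPDF : Measurable (gammaPDF a r) :=
  (measurable_gammaPDFReal a r).ennreal_ofReal

theorem ae_pos_gammaMeasure : ∀ᵐ x ∂gammaMeasure a r, 0 < x := by
  rw [gammaMeasure, ae_withDensity_iff measurable_gammaPDF]
  filter_upwards [compl_mem_ae_iff.2 (measure_singleton (0 : ℝ))] with x hx0 hx
  by_contra! h
  exact hx (gammaPDF_of_neg (lt_of_le_of_ne h hx0))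

theorem gammaMeasure_singleton (x : ℝ) : gammaMeasure a r {x} = 0 :=
  withDensity_absolutelyContinuous _ _ (measure_singleton x)

/-- Exponential tilting: multiplying the density of rate `r` by `exp (t x)` gives a multiple of the
density of rate `r - t`. -/
theorem lintegral_exp_mul_gammaMeasure (ha : 0 < a) (hr : 0 < r) {t : ℝ} (ht : t < r) :
    ∫⁻ x, ENNReal.ofReal (Real.exp (t * x)) ∂gammaMeasure a r =
      ENNReal.ofReal ((r / (r - t)) ^ a) := by
  have hrt : 0 < r - t := sub_pos.2 ht
  rw [gammaMeasure, lintegral_withDensity_eq_lintegral_mul _ measurable_gammaPDF (by fun_prop)]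
  have h1 : ∀ x, (gammaPDF a r * fun x => ENNReal.ofReal (Real.exp (t * x))) x =
      ENNReal.ofReal ((r / (r - t)) ^ a) * gammaPDF a (r - t) x := fun x => by
    rw [Pi.mul_apply, gammaPDF, gammaPDF, ← ENNReal.ofReal_mul (gammaPDFReal_nonneg ha hr x),
      ← ENNReal.ofReal_mul (by positivity)]
    congr 1
    unfold gammaPDFReal
    split_ifs with hx
    · have h2 : Real.exp (-((r - t) * x)) = Real.exp (-(r * x)) * Real.exp (t * x) := by
        rw [← Real.exp_add]
        ring_nf
      have := (Real.rpow_pos_of_pos hrt a).ne'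
      rw [Real.div_rpow hr.le hrt.le, h2]
      field_simp
    · simp
  simp_rw [h1]
  rw [lintegral_const_mul _ measurable_gammaPDF, lintegral_gammaPDF_eq_one ha hrt, mul_one]

theorem integrable_exp_mul_gammaMeasure (ha : 0 < a) (hr : 0 < r) {t : ℝ} (ht : t < r) :
    Integrable (fun x => Real.exp (t * x)) (gammaMeasure a r) := by
  refine ⟨by fun_prop, ?_⟩
  rw [hasFiniteIntegral_iff_ofReal (Eventually.of_forall fun x => (Real.exp_pos _).le),
    lintegral_exp_mul_gammaMeasure ha hr ht]
  exact ENNReal.ofReal_lt_top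

theorem mgf_gammaMeasure (ha : 0 < a) (hr : 0 < r) {t : ℝ} (ht : t < r) :
    mgf id (gammaMeasure a r) t = (r / (r - t)) ^ a := by
  have hrt : 0 < r - t := sub_pos.2 ht
  simp only [mgf, id]
  rw [integral_eq_lintegral_of_nonneg_ae (Eventually.of_forall fun x => (Real.exp_pos _).le)
    (by fun_prop), lintegral_exp_mul_gammaMeasure ha hr ht, ENNReal.toReal_ofReal (by positivity)]

theorem Iio_subset_interior_integrableExpSet (ha : 0 < a) (hr : 0 < r) :
    Iio r ⊆ interior (integrableExpSet id (gammaMeasure a r)) :=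
  interior_maximal (fun _ ht => integrable_exp_mul_gammaMeasure ha hr ht) isOpen_Iio

theorem integrable_id_gammaMeasure (ha : 0 < a) (hr : 0 < r) :
    Integrable id (gammaMeasure a r) :=
  integrable_of_mem_interior_integrableExpSet (Iio_subset_interior_integrableExpSet ha hr hr)

/-- Both sides are analytic on the half-plane `Re z < r` and agree at real points, which accumulate
at `0`. On this half-plane `1 - z / r` has positive real part, so the principal power is analytic.
-/
theorem complexMGF_gammaMeasure (ha : 0 < a) (hr : 0 < r) {z : ℂ} (hz : z.re < r) :
    complexMGF id (gammaMeasure a r) z = (1 - z / r) ^ (-a : ℂ) := by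
  have hslit : ∀ w : ℂ, w.re < r → 1 - w / r ∈ Complex.slitPlane := fun w hw => by
    refine Or.inl ?_
    rw [Complex.sub_re, Complex.one_re, Complex.div_ofReal_re, sub_pos, div_lt_one hr]
    exact hw
  have hU : IsPreconnected {w : ℂ | w.re < r} := (convex_halfSpace_re_lt r).isPreconnected
  have hopen : IsOpen {w : ℂ | w.re < r} := isOpen_lt Complex.continuous_re continuous_const
  refine AnalyticOnNhd.eqOn_of_preconnected_of_frequently_eq (𝕜 := ℂ) (z₀ := 0)
    (f := complexMGF id (gammaMeasure a r)) (g := fun z : ℂ => (1 - z / r) ^ (-a : ℂ))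
    (fun w hw => analyticOnNhd_complexMGF w (Iio_subset_interior_integrableExpSet ha hr hw))
    (DifferentiableOn.analyticOnNhd (fun w hw => ?_) hopen) hU (show (0 : ℂ).re < r by simpa using hr) ?_ hz
  · have hd : DifferentiableAt ℂ (fun z : ℂ => 1 - z / r) w := by fun_prop
    exact (hd.cpow_const (hslit w hw)).differentiableWithinAt
  · have h1 : Tendsto (fun t : ℝ => (t : ℂ)) (𝓝[≠] 0) (𝓝[≠] 0) := by
      refine tendsto_nhdsWithin_iff.2 ⟨?_, ?_⟩
      · exact (Complex.continuous_ofReal.tendsto' 0 0 Complex.ofReal_zero).mono_left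
          nhdsWithin_le_nhds
      · filter_upwards [self_mem_nhdsWithin] with t ht
        exact Complex.ofReal_ne_zero.2 ht
    refine h1.frequently (Eventually.frequently ?_)
    filter_upwards [mem_nhdsWithin_of_mem_nhds (Iio_mem_nhds hr)] with t ht
    have hrt : 0 < r - t := sub_pos.2 ht
    rw [complexMGF_ofReal, mgf_gammaMeasure ha hr ht, ← Complex.ofReal_neg,
      ← Complex.ofReal_div, ← Complex.ofReal_one, ← Complex.ofReal_sub,
      ← Complex.ofReal_cpow, Complex.ofReal_inj]
    · rw [Real.rpow_neg, ← Real.inv_rpow]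
      · congr 1
        field_simp
      all_goals rw [one_sub_div hr.ne']; positivity
    · rw [one_sub_div hr.ne']; positivity

theorem integral_cexp_gammaMeasure (ha : 0 < a) (hr : 0 < r) (s : ℝ) :
    ∫ x, Complex.exp (s * x * Complex.I) ∂gammaMeasure a r =
      (1 - s * Complex.I / r) ^ (-a : ℂ) := by
  rw [← complexMGF_gammaMeasure ha hr (z := s * Complex.I) (by simpa using hr), complexMGF]
  refine integral_congr_ae (Eventually.of_forall fun x => ?_)
  simp only [id]
  ring_nf

end Gamma

/-! ### Load, activity and fading -/

namespace Network

variable {S : Type*} [Fintype S] {B : ℕ} (net : Network S B)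

theorem isProbabilityMeasure_areaLaw : IsProbabilityMeasure net.areaLaw :=
  isProbabilityMeasure_gammaMeasure (by norm_num) (mul_pos (by norm_num) net.lamBS_pos)

theorem mtProb_nonneg (n : ℕ) {a : ℝ} (ha : 0 ≤ a) : 0 ≤ net.mtProb n a := by
  have := net.lamMT_pos
  unfold mtProb
  positivity

theorem sum_mtProb_le_one (n : ℕ) {a : ℝ} (ha : 0 ≤ a) :
    ∑ k ∈ Finset.range n, net.mtProb k a ≤ 1 := by
  have h0 : 0 ≤ net.lamMT * a := mul_nonneg net.lamMT_pos.le ha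
  simp only [mtProb, mul_div_assoc]
  rw [← Finset.mul_sum, Real.exp_neg, inv_mul_le_iff₀ (Real.exp_pos _), mul_one]
  exact Real.sum_le_exp_of_nonneg h0 n

theorem mtProb_le_one (n : ℕ) {a : ℝ} (ha : 0 ≤ a) : net.mtProb n a ≤ 1 :=
  (Finset.single_le_sum (f := fun k => net.mtProb k a) (fun k _ => net.mtProb_nonneg k ha)
    (Finset.self_mem_range_succ n)).trans (net.sum_mtProb_le_one (n + 1) ha)

theorem integrable_mtProb (n : ℕ) : Integrable (net.mtProb n) net.areaLaw := by
  have := net.isProbabilityMeasure_areaLaw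
  refine Integrable.of_bound (Measurable.aestronglyMeasurable ?_) 1 ?_
  · unfold mtProb
    fun_prop
  · filter_upwards [ae_pos_gammaMeasure (a := 7 / 2) (r := 7 / 2 * net.lamBS)] with a ha
    rw [Real.norm_of_nonneg (net.mtProb_nonneg n ha.le)]
    exact net.mtProb_le_one n ha.le

theorem loadProb_nonneg (n : ℕ) : 0 ≤ net.loadProb n := by
  refine integral_nonneg_of_ae ?_
  filter_upwards [ae_pos_gammaMeasure (a := 7 / 2) (r := 7 / 2 * net.lamBS)] with a ha
  exact net.mtProb_nonneg n ha.le

theorem sum_loadProb_le_one (n : ℕ) : ∑ k ∈ Finset.range n, net.loadProb k ≤ 1 := by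
  have := net.isProbabilityMeasure_areaLaw
  simp only [loadProb]
  rw [← integral_finsetSum _ fun k _ => net.integrable_mtProb k]
  calc ∫ a, ∑ k ∈ Finset.range n, net.mtProb k a ∂net.areaLaw
      ≤ ∫ _, 1 ∂net.areaLaw := by
        refine integral_mono_ae (integrable_finsetSum _ fun k _ => net.integrable_mtProb k)
          (integrable_const 1) ?_
        filter_upwards [ae_pos_gammaMeasure (a := 7 / 2) (r := 7 / 2 * net.lamBS)] with a ha
        exact net.sum_mtProb_le_one n ha.le
    _ = 1 := by simp

/-- With the upper bound by one, this makes `activityLaw` a probability measure. -/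
theorem pOff_nonneg : 0 ≤ net.pOff := by
  refine Finset.sum_nonneg fun n hn => mul_nonneg (sub_nonneg.2 ?_) (net.loadProb_nonneg n)
  have : n ≤ net.NRB := Nat.lt_succ_iff.1 (Finset.mem_range.1 hn)
  exact div_le_one_of_le₀ (by exact_mod_cast this) (by positivity)

theorem pOff_le_one : net.pOff ≤ 1 := by
  refine (Finset.sum_le_sum fun n _ => ?_).trans (net.sum_loadProb_le_one (net.NRB + 1))
  refine mul_le_of_le_one_left (net.loadProb_nonneg n) ?_
  have : 0 ≤ (n : ℝ) / net.NRB := by positivity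
  linarith

instance isProbabilityMeasure_activityLaw : IsProbabilityMeasure net.activityLaw := by
  constructor
  have h1 := net.pOff_nonneg
  have h2 := net.pOff_le_one
  simp only [activityLaw, Measure.add_apply, Measure.smul_apply, measure_univ, smul_eq_mul,
    mul_one]
  rw [← ENNReal.ofReal_add (by linarith) h1]
  simp

instance isProbabilityMeasure_angleLaw : IsProbabilityMeasure angleLaw := by
  constructor
  have hpi := Real.pi_pos
  rw [angleLaw, Measure.smul_apply, Measure.restrict_apply_univ, Real.volume_Ico, smul_eq_mul,
    sub_neg_eq_add, ← two_mul]
  exact ENNReal.inv_mul_cancel (by simpa using hpi) ENNReal.ofReal_ne_top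

theorem isProbabilityMeasure_fadingLaw (s : S) :
    IsProbabilityMeasure (gammaMeasure (net.m s) (net.m s / net.Om s)) :=
  isProbabilityMeasure_gammaMeasure (net.m_pos s) (div_pos (net.m_pos s) (net.Om_pos s))

instance isProbabilityMeasure_markLaw (s : S) : IsProbabilityMeasure (net.markLaw s) := by
  have := net.isProbabilityMeasure_fadingLaw s
  unfold markLaw
  infer_instance

theorem integral_activityLaw (f : Bool → ℂ) :
    ∫ b, f b ∂net.activityLaw = ((1 - net.pOff : ℝ) : ℂ) * f true + (net.pOff : ℂ) * f false := by
  have h1 := net.pOff_nonneg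
  have h2 := net.pOff_le_one
  rw [activityLaw, integral_add_measure, integral_smul_measure, integral_smul_measure,
    integral_dirac, integral_dirac, ENNReal.toReal_ofReal (by linarith), ENNReal.toReal_ofReal h1]
  · simp
  all_goals exact (integrable_dirac (by simp)).smul_measure ENNReal.ofReal_ne_top

theorem fadingMGF_eq (s : S) (z : ℝ) :
    net.fadingMGF s (Complex.I * z) = ∫ g, Complex.exp (-z * g * Complex.I)
      ∂gammaMeasure (net.m s) (net.m s / net.Om s) := by
  have h1 := net.m_pos s
  have h2 := net.Om_pos s
  have := integral_cexp_gammaMeasure h1 (div_pos h1 h2) (-z)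
  push_cast at this
  rw [this, fadingMGF]
  congr 1
  have : (net.m s : ℂ) ≠ 0 := Complex.ofReal_ne_zero.2 h1.ne'
  have : (net.Om s : ℂ) ≠ 0 := Complex.ofReal_ne_zero.2 h2.ne'
  field_simp
  ring

end Network

/-! ### Antenna gains in uniform directions -/

namespace Antenna

variable (A : Antenna)

theorem gain_eq {θ : ℝ} {l : Fin A.K} (h : |θ| ∈ Ico (A.φ l.castSucc) (A.φ l.succ)) :
    A.gain θ = A.γ l := by
  unfold gain
  rw [Finset.sum_eq_single l]
  · rw [indicator_of_mem h, mul_one]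
  · intro k _ hk
    rw [indicator_of_notMem, mul_zero]
    intro hk'
    rcases lt_or_gt_of_ne hk with hlt | hlt
    · have : A.φ k.succ ≤ A.φ l.castSucc := A.φ_strictMono.monotone (by
        rw [Fin.le_def]; simpa using hlt)
      exact absurd (hk'.2.trans_le (this.trans h.1)) (lt_irrefl _)
    · have : A.φ l.succ ≤ A.φ k.castSucc := A.φ_strictMono.monotone (by
        rw [Fin.le_def]; simpa using hlt)
      exact absurd (h.2.trans_le (this.trans hk'.1)) (lt_irrefl _)
  · simp

theorem measurable_gain : Measurable A.gain := by
  unfold gain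
  refine Finset.measurable_sum _ fun l _ => Measurable.const_mul ?_ _
  exact (measurable_const.indicator measurableSet_Ico).comp measurable_norm

theorem gain_nonneg (θ : ℝ) : 0 ≤ A.gain θ :=
  Finset.sum_nonneg fun l _ => mul_nonneg (A.γ_nonneg l)
    (indicator_nonneg (fun _ _ => zero_le_one) _)

theorem gain_le (θ : ℝ) : A.gain θ ≤ ∑ l, A.γ l :=
  Finset.sum_le_sum fun l _ => mul_le_of_le_one_right (A.γ_nonneg l)
    (indicator_apply_le' (fun _ => le_rfl) fun _ => zero_le_one)

theorem φ_nonneg (k : Fin (A.K + 1)) : 0 ≤ A.φ k :=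
  A.φ_zero ▸ A.φ_strictMono.monotone (Fin.zero_le k)

theorem φ_le_pi (k : Fin (A.K + 1)) : A.φ k ≤ Real.pi :=
  A.φ_last ▸ A.φ_strictMono.monotone (Fin.le_last k)

end Antenna

/-- Points between the extreme values of a finite sequence lie in one of the intervals spanned by
consecutive values. -/
theorem exists_mem_Ico_castSucc_succ {n : ℕ} {φ : Fin (n + 1) → ℝ} {t : ℝ} (h0 : φ 0 ≤ t)
    (h1 : t < φ (Fin.last n)) : ∃ l : Fin n, t ∈ Ico (φ l.castSucc) (φ l.succ) := by
  by_contra! h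
  have : ∀ k : Fin (n + 1), φ k ≤ t := fun k => by
    induction k using Fin.induction with
    | zero => exact h0
    | succ l ih =>
      by_contra! hlt
      exact h l ⟨ih, hlt⟩
  exact absurd (this (Fin.last n)) (not_le.2 h1)

namespace Antenna

variable (A : Antenna)

theorem sum_width : ∑ l, A.width l = 2 * Real.pi := by
  simp only [width]
  rw [← Finset.mul_sum, Finset.sum_sub_distrib]
  have h1 := Fin.sum_univ_succ A.φ
  have h2 := Fin.sum_univ_castSucc A.φ
  rw [A.φ_zero] at h1
  rw [A.φ_last] at h2
  linarith

/-- The set of directions in a lobe. -/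
def lobe (l : Fin A.K) : Set ℝ := {θ | |θ| ∈ Ico (A.φ l.castSucc) (A.φ l.succ)}

theorem measurableSet_lobe (l : Fin A.K) : MeasurableSet (A.lobe l) :=
  measurable_norm measurableSet_Ico

theorem angleLaw_lobe (l : Fin A.K) :
    Network.angleLaw.real (A.lobe l) = A.width l / (2 * Real.pi) := by
  have hpi := Real.pi_pos
  have hl := A.φ_strictMono.monotone (Fin.castSucc_lt_succ (i := l)).le
  have h0 := A.φ_nonneg l.castSucc
  have h1 := A.φ_le_pi l.succ
  -- A lobe is the difference of two symmetric intervals, whence the factor `2` in its width.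
  have hset : A.lobe l ∩ Ico (-Real.pi) Real.pi =
      Ioo (-A.φ l.succ) (A.φ l.succ) \ Ioo (-A.φ l.castSucc) (A.φ l.castSucc) := by
    ext θ
    simp only [lobe, mem_inter_iff, mem_ofPred_eq, mem_Ico, mem_sdiff, mem_Ioo, ← abs_lt, not_lt]
    constructor
    · rintro ⟨⟨h, h'⟩, -⟩
      exact ⟨h', h⟩
    · rintro ⟨h', h⟩
      exact ⟨⟨h, h'⟩, ⟨by linarith [neg_abs_le θ], by linarith [le_abs_self θ]⟩⟩
  rw [Network.angleLaw, measureReal_def, Measure.smul_apply,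
    Measure.restrict_apply (A.measurableSet_lobe l), hset, measure_sdiff
      (Ioo_subset_Ioo (by linarith) (by linarith)) measurableSet_Ioo.nullMeasurableSet (by simp),
    Real.volume_Ioo, Real.volume_Ioo, ← ENNReal.ofReal_sub _ (by linarith), smul_eq_mul,
    ENNReal.toReal_mul, ENNReal.toReal_inv, ENNReal.toReal_ofReal (by positivity),
    ENNReal.toReal_ofReal (by linarith), width]
  field_simp
  ring

theorem ae_exists_lobe : ∀ᵐ θ ∂Network.angleLaw, ∃ l, θ ∈ A.lobe l := by
  have hpi := Real.pi_pos
  have h1 : ∀ᵐ θ ∂volume.restrict (Ico (-Real.pi) Real.pi), ∃ l, θ ∈ A.lobe l := by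
    -- The direction `-π` lies in no lobe, since `|-π| = π` is the excluded right end of the last
    -- interval; it is a null set.
    filter_upwards [ae_restrict_mem measurableSet_Ico, ae_restrict_of_ae
      (compl_mem_ae_iff.2 (measure_singleton (-Real.pi)))] with θ hθ hne
    refine exists_mem_Ico_castSucc_succ (φ := A.φ) (by rw [A.φ_zero]; exact abs_nonneg θ) ?_
    rw [A.φ_last, abs_lt]
    exact ⟨lt_of_le_of_ne hθ.1 (Ne.symm hne), hθ.2⟩
  exact Measure.ae_smul_measure h1 _

theorem eq_of_mem_lobe {θ : ℝ} {k l : Fin A.K} (hk : θ ∈ A.lobe k) (hl : θ ∈ A.lobe l) :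
    k = l := by
  by_contra hne
  rcases lt_or_gt_of_ne hne with hlt | hlt
  · have : A.φ k.succ ≤ A.φ l.castSucc := A.φ_strictMono.monotone (by
      rw [Fin.le_def]; simpa using hlt)
    exact absurd (hk.2.trans_le (this.trans hl.1)) (lt_irrefl _)
  · have : A.φ l.succ ≤ A.φ k.castSucc := A.φ_strictMono.monotone (by
      rw [Fin.le_def]; simpa using hlt)
    exact absurd (hl.2.trans_le (this.trans hk.1)) (lt_irrefl _)

/-- The integral of a function of the gains of two antennas in uniform directions. -/
theorem integral_gain (A' : Antenna) (F : ℝ → ℝ → ℂ) :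
    ∫ θ, F (A.gain θ.1) (A'.gain θ.2) ∂(Network.angleLaw.prod Network.angleLaw) =
      ∑ k, ∑ l, ((A.width k / (2 * Real.pi) : ℝ) : ℂ) * ((A'.width l / (2 * Real.pi) : ℝ) : ℂ) *
        F (A.γ k) (A'.γ l) := by
  have h1 : ∀ᵐ θ ∂(Network.angleLaw.prod Network.angleLaw), F (A.gain θ.1) (A'.gain θ.2) =
      ∑ k, ∑ l, (A.lobe k ×ˢ A'.lobe l).indicator (fun _ => F (A.γ k) (A'.γ l)) θ := by
    have e1 : ∀ᵐ θ ∂(Network.angleLaw.prod Network.angleLaw), ∃ k, θ.1 ∈ A.lobe k :=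
      Measure.quasiMeasurePreserving_fst.ae A.ae_exists_lobe
    have e2 : ∀ᵐ θ ∂(Network.angleLaw.prod Network.angleLaw), ∃ l, θ.2 ∈ A'.lobe l :=
      Measure.quasiMeasurePreserving_snd.ae A'.ae_exists_lobe
    filter_upwards [e1, e2] with θ ⟨k, hk⟩ ⟨l, hl⟩
    rw [A.gain_eq hk, A'.gain_eq hl, Finset.sum_eq_single k, Finset.sum_eq_single l]
    · rw [indicator_of_mem (mk_mem_prod hk hl)]
    · intro l' _ hne
      exact indicator_of_notMem (fun h => hne (A'.eq_of_mem_lobe h.2 hl)) _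
    · simp
    · intro k' _ hne
      exact Finset.sum_eq_zero fun l' _ =>
        indicator_of_notMem (fun h => hne (A.eq_of_mem_lobe h.1 hk)) _
    · simp
  have hm : ∀ k l, MeasurableSet (A.lobe k ×ˢ A'.lobe l) := fun k l =>
    (A.measurableSet_lobe k).prod (A'.measurableSet_lobe l)
  have hi : ∀ k l, Integrable ((A.lobe k ×ˢ A'.lobe l).indicator fun _ => F (A.γ k) (A'.γ l))
      (Network.angleLaw.prod Network.angleLaw) := fun k l =>
    (integrable_const _).indicator (hm k l)
  rw [integral_congr_ae h1, integral_finsetSum _ fun k _ => integrable_finsetSum _ fun l _ => hi k l]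
  refine Finset.sum_congr rfl fun k _ => ?_
  rw [integral_finsetSum _ fun l _ => hi k l]
  refine Finset.sum_congr rfl fun l _ => ?_
  rw [integral_indicator_const _ (hm k l), measureReal_prod_prod, A.angleLaw_lobe, A'.angleLaw_lobe,
    Complex.real_smul, Complex.ofReal_mul]

end Antenna

/-! ### Path-losses of uniform points in the plane -/

section LossKernel

/-- The derivative of `x ↦ (x / κ) ^ δ`. -/
noncomputable def lossKernel (κ δ x : ℝ) : ℝ := δ * κ ^ (-δ) * x ^ (δ - 1)

theorem measurable_lossKernel (κ δ : ℝ) : Measurable (lossKernel κ δ) := by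
  unfold lossKernel
  fun_prop

variable {κ δ : ℝ}

theorem lossKernel_nonneg (hκ : 0 < κ) (hδ : 0 < δ) {x : ℝ} (hx : 0 ≤ x) :
    0 ≤ lossKernel κ δ x := by
  unfold lossKernel
  positivity

theorem integrableOn_lossKernel (hδ : 0 < δ) {a b : ℝ} (hab : a ≤ b) :
    IntegrableOn (lossKernel κ δ) (Ioc a b) := by
  have : IntervalIntegrable (fun x : ℝ => x ^ (δ - 1)) volume a b :=
    intervalIntegral.intervalIntegrable_rpow' (by linarith)
  exact ((intervalIntegrable_iff_integrableOn_Ioc_of_le hab).1 this).const_mul _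

theorem integral_lossKernel (hκ : 0 < κ) (hδ : 0 < δ) {a b : ℝ} (ha : 0 ≤ a) (hab : a ≤ b) :
    ∫ x in Ioc a b, lossKernel κ δ x = (b / κ) ^ δ - (a / κ) ^ δ := by
  simp only [lossKernel]
  rw [← intervalIntegral.integral_of_le hab, intervalIntegral.integral_const_mul,
    integral_rpow (Or.inl (by linarith)), Real.div_rpow (ha.trans hab) hκ.le,
    Real.div_rpow ha hκ.le, Real.rpow_neg hκ.le, sub_add_cancel]
  have := (Real.rpow_pos_of_pos hκ δ).ne'
  field_simp

theorem integrableOn_lossKernel_div (hδ : δ < 1) {x : ℝ} (hx : 0 < x) :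
    IntegrableOn (fun L => lossKernel κ δ L / L) (Ioi x) := by
  have h : IntegrableOn (fun L : ℝ => δ * κ ^ (-δ) * L ^ (δ - 2)) (Ioi x) :=
    (integrableOn_Ioi_rpow_of_lt (by linarith) hx).const_mul _
  refine h.congr_fun (fun L hL => ?_) measurableSet_Ioi
  simp only
  have hL0 : 0 < L := hx.trans hL
  rw [lossKernel, show δ - 2 = δ - 1 - 1 by ring, Real.rpow_sub_one hL0.ne' (δ - 1), mul_div_assoc]

theorem integral_lossKernel_div (hδ : δ < 1) {x : ℝ} (hx : 0 < x) :
    ∫ L in Ioi x, lossKernel κ δ L / L = δ * κ ^ (-δ) / (1 - δ) * x ^ (δ - 1) := by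
  have h1 : ∫ L in Ioi x, lossKernel κ δ L / L =
      ∫ L in Ioi x, δ * κ ^ (-δ) * L ^ (δ - 2) := by
    refine setIntegral_congr_fun measurableSet_Ioi fun L hL => ?_
    have hL0 : 0 < L := hx.trans hL
    change lossKernel κ δ L / L = _
    rw [lossKernel, show δ - 2 = δ - 1 - 1 by ring, Real.rpow_sub_one hL0.ne' (δ - 1),
      mul_div_assoc]
  rw [h1, integral_const_mul, integral_Ioi_rpow_of_lt (by linarith) hx,
    show δ - 2 + 1 = δ - 1 by ring]
  have : δ - 1 ≠ 0 := by linarith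
  have : 1 - δ ≠ 0 := by linarith
  field_simp
  ring

theorem setOf_mul_norm_rpow_le {E : Type*} [SeminormedAddCommGroup E] {α : ℝ} (hκ : 0 < κ)
    (hα : 0 < α) {x : ℝ} (hx : 0 ≤ x) :
    {y : E | κ * ‖y‖ ^ α ≤ x} = Metric.closedBall 0 ((x / κ) ^ α⁻¹) := by
  ext y
  rw [mem_closedBall_zero_iff, mem_ofPred_eq, ← le_div_iff₀' hκ,
    Real.le_rpow_inv_iff_of_pos (norm_nonneg y) (by positivity) hα]

/-- The path-losses `κ ‖y‖ ^ α` of uniform points in the plane have a density. -/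
theorem map_mul_norm_rpow {α : ℝ} (hκ : 0 < κ) (hα : 0 < α) :
    (volume : Measure (EuclideanSpace ℝ (Fin 2))).map (fun y => κ * ‖y‖ ^ α) =
      (volume.restrict (Ioi 0)).withDensity
        fun x => ENNReal.ofReal (Real.pi * lossKernel κ (2 / α) x) := by
  have hδ : 0 < 2 / α := by positivity
  have hpi := Real.pi_pos
  set μ := (volume : Measure (EuclideanSpace ℝ (Fin 2))).map (fun y => κ * ‖y‖ ^ α) with hμ
  set ν := (volume.restrict (Ioi (0 : ℝ))).withDensity
    fun x => ENNReal.ofReal (Real.pi * lossKernel κ (2 / α) x) with hν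
  have hm : Measurable fun y : EuclideanSpace ℝ (Fin 2) => κ * ‖y‖ ^ α := by fun_prop
  -- The area of the disc of radius `(x / κ) ^ (1 / α)`. Half-lines have finite mass, so agreement
  -- on them determines the measure.
  have hμ1 : ∀ x, 0 ≤ x → μ (Iic x) = ENNReal.ofReal (Real.pi * (x / κ) ^ (2 / α)) := by
    intro x hx
    rw [hμ, Measure.map_apply hm measurableSet_Iic]
    change volume {y : EuclideanSpace ℝ (Fin 2) | κ * ‖y‖ ^ α ≤ x} = _
    rw [setOf_mul_norm_rpow_le hκ hα hx, EuclideanSpace.volume_closedBall_fin_two,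
      ← ENNReal.ofReal_pow (by positivity), ← ENNReal.ofReal_mul (by positivity), mul_comm,
      ← Real.rpow_mul_natCast (by positivity)]
    congr 3
    push_cast
    ring
  have hμ0 : ∀ x, x < 0 → μ (Iic x) = 0 := by
    intro x hx
    rw [hμ, Measure.map_apply hm measurableSet_Iic]
    convert! measure_empty (μ := volume)
    refine eq_empty_of_forall_notMem fun y (hy : κ * ‖y‖ ^ α ≤ x) => ?_
    have : 0 ≤ κ * ‖y‖ ^ α := by positivity
    linarith
  have hν1 : ∀ x, 0 ≤ x → ν (Iic x) = ENNReal.ofReal (Real.pi * (x / κ) ^ (2 / α)) := by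
    intro x hx
    rw [hν, withDensity_apply _ measurableSet_Iic, Measure.restrict_restrict measurableSet_Iic,
      inter_comm, Ioi_inter_Iic, ← ofReal_integral_eq_lintegral_ofReal
        ((integrableOn_lossKernel hδ hx).const_mul _), integral_const_mul,
      integral_lossKernel hκ hδ le_rfl hx, zero_div, Real.zero_rpow hδ.ne', sub_zero]
    filter_upwards [ae_restrict_mem measurableSet_Ioc] with y hy
    exact mul_nonneg hpi.le (lossKernel_nonneg hκ hδ hy.1.le)
  have hν0 : ∀ x, x < 0 → ν (Iic x) = 0 := by
    intro x hx
    rw [hν, withDensity_apply _ measurableSet_Iic, Measure.restrict_restrict measurableSet_Iic,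
      inter_comm, Ioi_inter_Iic, Ioc_eq_empty (by linarith)]
    simp
  have heq : ∀ x, μ (Iic x) = ν (Iic x) := fun x => by
    rcases lt_or_ge x 0 with hx | hx
    · rw [hμ0 x hx, hν0 x hx]
    · rw [hμ1 x hx, hν1 x hx]
  have hfin : ∀ x, μ (Iic x) ≠ ∞ := fun x => by
    rcases lt_or_ge x 0 with hx | hx
    · rw [hμ0 x hx]; exact ENNReal.zero_ne_top
    · rw [hμ1 x hx]; exact ENNReal.ofReal_ne_top
  refine Measure.ext_of_Ioc' μ ν (fun a b _ => ne_top_of_le_ne_top (hfin b)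
    (measure_mono Ioc_subset_Iic_self)) fun a b hab => ?_
  rw [← Iic_sdiff_Iic, measure_sdiff (Iic_subset_Iic.2 hab.le) measurableSet_Iic.nullMeasurableSet
    (hfin a), measure_sdiff (Iic_subset_Iic.2 hab.le) measurableSet_Iic.nullMeasurableSet
    (heq a ▸ hfin a), heq, heq]

end LossKernel

/-! ### The intensity of path-losses in the multi-ball model -/

namespace Network

section Loss

variable {S : Type*} [Fintype S] {B : ℕ} (net : Network S B)

theorem α_pos (s : S) : 0 < net.α s := two_pos.trans (net.two_lt_α s)

theorem delta_pos (s : S) : 0 < 2 / net.α s := div_pos two_pos (net.α_pos s)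

theorem delta_lt_one (s : S) : 2 / net.α s < 1 := (div_lt_one (net.α_pos s)).2 (net.two_lt_α s)

theorem Theta_pos (s : S) : 0 < net.Theta s := Real.exp_pos _

theorem PRB_pos : 0 < net.PRB := div_pos net.PBS_pos (Nat.cast_pos.2 net.NRB_pos)

theorem D_nonneg (b : Fin (B + 1)) : 0 ≤ net.D b :=
  net.D_zero ▸ net.D_strictMono.monotone (Fin.zero_le b)

theorem lossAt_nonneg (s : S) (b : Fin (B + 1)) : 0 ≤ net.lossAt s b :=
  mul_nonneg (net.κ_pos s).le (Real.rpow_nonneg (net.D_nonneg b) _)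

theorem lossAt_mono (s : S) : Monotone (net.lossAt s) := fun _ _ h =>
  mul_le_mul_of_nonneg_left (Real.rpow_le_rpow (net.D_nonneg _) (net.D_strictMono.monotone h)
    (net.α_pos s).le) (net.κ_pos s).le

theorem lossAt_div_rpow (s : S) (b : Fin (B + 1)) :
    (net.lossAt s b / net.κ s) ^ (2 / net.α s) = net.D b ^ 2 := by
  rw [lossAt, mul_div_cancel_left₀ _ (net.κ_pos s).ne', ← Real.rpow_mul (net.D_nonneg b),
    mul_div_cancel₀ _ (net.α_pos s).ne']
  norm_cast

theorem heav_of_le {x y : ℝ} (h : y ≤ x) : heav (x - y) = 1 := if_pos (sub_nonneg.2 h)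

theorem heav_of_lt {x y : ℝ} (h : x < y) : heav (x - y) = 0 :=
  if_neg (not_le.2 (sub_neg.2 h))

theorem heavC_of_le {x y : ℝ} (h : y ≤ x) : heavC (x - y) = 0 := by
  rw [heavC, heav_of_le h, sub_self]

theorem heavC_of_lt {x y : ℝ} (h : x < y) : heavC (x - y) = 1 := by
  rw [heavC, heav_of_lt h, sub_zero]

/-- The indicator of a band as a difference of half-line indicators: an integral over a band becomes
a difference of two tail integrals of the same function. -/
theorem heavC_mul_heav {x a b : ℝ} (hab : a ≤ b) :
    heavC (x - b) * heav (x - a) = heav (x - a) - heav (x - b) := by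
  rcases lt_or_ge x a with h | h
  · rw [heav_of_lt h, heav_of_lt (h.trans_le hab)]; simp
  · rw [heav_of_le h, heavC]; ring

/-- The probability that a link of path-loss `ξ` is in state `s`. -/
noncomputable def lossProb (s : S) (ξ : ℝ) : ℝ :=
  ∑ b : Fin B, net.q s b.castSucc *
      (heav (ξ - net.lossAt s b.castSucc) - heav (ξ - net.lossAt s b.succ))
    + net.q s (Fin.last B) * heav (ξ - net.lossAt s (Fin.last B))

theorem lossProb_eq (s : S) (ξ : ℝ) : net.lossProb s ξ =
    ∑ b : Fin B, net.q s b.castSucc *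
      (heavC (ξ - net.lossAt s b.succ) * heav (ξ - net.lossAt s b.castSucc))
    + net.q s (Fin.last B) * heav (ξ - net.lossAt s (Fin.last B)) := by
  rw [lossProb]
  congr 1
  refine Finset.sum_congr rfl fun b _ => ?_
  rw [heavC_mul_heav (net.lossAt_mono s (Fin.castSucc_lt_succ).le)]

theorem measurable_heav : Measurable heav :=
  Measurable.ite measurableSet_Ici measurable_const measurable_const

theorem measurable_lossProb (s : S) : Measurable (net.lossProb s) := by
  have h : ∀ c, Measurable fun ξ => heav (ξ - c) := fun c =>
    measurable_heav.comp (measurable_id.sub_const c)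
  unfold lossProb
  exact (Finset.measurable_sum _ fun b _ => ((h _).sub (h _)).const_mul _).add ((h _).const_mul _)

theorem heav_nonneg (x : ℝ) : 0 ≤ heav x := by unfold heav; split_ifs <;> norm_num

theorem heav_le_one (x : ℝ) : heav x ≤ 1 := by unfold heav; split_ifs <;> norm_num

theorem lossProb_nonneg (s : S) (ξ : ℝ) : 0 ≤ net.lossProb s ξ := by
  rw [lossProb_eq]
  refine add_nonneg (Finset.sum_nonneg fun b _ => mul_nonneg (net.q_nonneg _ _)
    (mul_nonneg ?_ (heav_nonneg _))) (mul_nonneg (net.q_nonneg _ _) (heav_nonneg _))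
  rw [heavC, sub_nonneg]
  exact heav_le_one _

theorem lossProb_le (s : S) (ξ : ℝ) : net.lossProb s ξ ≤ ∑ b, net.q s b := by
  rw [lossProb, Fin.sum_univ_castSucc]
  refine add_le_add (Finset.sum_le_sum fun b _ => ?_) ?_
  · refine mul_le_of_le_one_right (net.q_nonneg _ _) ?_
    linarith [heav_le_one (ξ - net.lossAt s b.castSucc), heav_nonneg (ξ - net.lossAt s b.succ)]
  · exact mul_le_of_le_one_right (net.q_nonneg _ _) (heav_le_one _)

theorem lossAt_le_iff (s : S) (b : Fin (B + 1)) {r : ℝ} (hr : 0 ≤ r) :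
    net.lossAt s b ≤ net.κ s * r ^ net.α s ↔ net.D b ≤ r := by
  rw [lossAt, mul_le_mul_iff_right₀ (net.κ_pos s),
    Real.rpow_le_rpow_iff (net.D_nonneg b) hr (net.α_pos s)]

theorem stateProb_eq (s : S) {r : ℝ} (hr : 0 ≤ r) :
    net.stateProb s r = net.lossProb s (net.κ s * r ^ net.α s) := by
  have h : ∀ b, heav (net.κ s * r ^ net.α s - net.lossAt s b) =
      (Ici (net.D b)).indicator (fun _ => 1) r := fun b => by
    by_cases hb : net.D b ≤ r
    · rw [heav_of_le ((net.lossAt_le_iff s b hr).2 hb), indicator_of_mem (mem_Ici.2 hb)]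
    · rw [heav_of_lt (not_le.1 fun hl => hb ((net.lossAt_le_iff s b hr).1 hl)),
        indicator_of_notMem (show r ∉ Ici (net.D b) from hb)]
  simp only [stateProb, lossProb, h]
  congr 1
  refine Finset.sum_congr rfl fun b _ => ?_
  congr 1
  have hb : net.D b.castSucc ≤ net.D b.succ := net.D_strictMono.monotone (Fin.castSucc_lt_succ).le
  rw [← Ici_sdiff_Ici, indicator_sdiff (Ici_subset_Ici.2 hb)]
  rfl

theorem LamHat'_eq (s : S) (x : ℝ) : net.LamHat' s x =
    Real.pi * net.lamBS * net.Theta s * lossKernel (net.κ s) (2 / net.α s) x *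
      net.lossProb s x := by
  rw [LamHat', lossProb_eq, lossKernel]
  simp only [mul_assoc]
  ring

theorem measurable_LamHat' (s : S) : Measurable (net.LamHat' s) := by
  rw [show net.LamHat' s = fun x => _ from funext (net.LamHat'_eq s)]
  exact ((measurable_lossKernel _ _).const_mul _).mul (net.measurable_lossProb s)

theorem LamHat'_nonneg (s : S) {x : ℝ} (hx : 0 ≤ x) : 0 ≤ net.LamHat' s x := by
  have h1 := net.lamBS_pos
  have h2 := net.Theta_pos s
  have h3 := Real.pi_pos
  rw [LamHat'_eq]
  exact mul_nonneg (mul_nonneg (by positivity)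
    (lossKernel_nonneg (net.κ_pos s) (net.delta_pos s) hx)) (net.lossProb_nonneg s x)

theorem measurable_loss (s : S) :
    Measurable fun y : EuclideanSpace ℝ (Fin 2) => net.κ s * ‖y‖ ^ net.α s := by
  fun_prop

/-- The path-losses of the base stations in state `s` have the density `LamHat' s`. -/
theorem map_locationIntensity (s : S) :
    (net.locationIntensity s).map (fun y => net.κ s * ‖y‖ ^ net.α s) =
      (volume.restrict (Ioi 0)).withDensity fun x => ENNReal.ofReal (net.LamHat' s x) := by
  have hm := net.measurable_loss s
  have hp : Measurable fun x => ENNReal.ofReal (net.lamBS * net.lossProb s x * net.Theta s) :=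
    (((net.measurable_lossProb s).const_mul _).mul_const _).ennreal_ofReal
  have hk : Measurable fun x =>
      ENNReal.ofReal (Real.pi * lossKernel (net.κ s) (2 / net.α s) x) :=
    ((measurable_lossKernel _ _).const_mul _).ennreal_ofReal
  refine Measure.ext fun A hA => ?_
  rw [Measure.map_apply hm hA, locationIntensity, withDensity_apply _ (hm hA),
    ← lintegral_indicator (hm hA)]
  have h1 : ∀ y : EuclideanSpace ℝ (Fin 2),
      ((fun y => net.κ s * ‖y‖ ^ net.α s) ⁻¹' A).indicator
        (fun y => ENNReal.ofReal (net.lamBS * net.stateProb s ‖y‖ * net.Theta s)) y =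
      A.indicator (fun x => ENNReal.ofReal (net.lamBS * net.lossProb s x * net.Theta s))
        (net.κ s * ‖y‖ ^ net.α s) := fun y => by
    simp only [indicator, mem_preimage, net.stateProb_eq s (norm_nonneg y)]
    rfl
  simp_rw [h1]
  rw [← lintegral_map (μ := volume) (f := A.indicator fun x =>
    ENNReal.ofReal (net.lamBS * net.lossProb s x * net.Theta s)) (hp.indicator hA) hm,
    map_mul_norm_rpow (net.κ_pos s) (net.α_pos s), lintegral_indicator hA,
    setLIntegral_withDensity_eq_setLIntegral_mul _ hk hp hA, withDensity_apply _ hA]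
  refine lintegral_congr_ae ?_
  rw [Measure.restrict_restrict hA]
  filter_upwards [ae_restrict_mem (hA.inter measurableSet_Ioi)] with x hx
  have hx0 : (0 : ℝ) < x := hx.2
  rw [Pi.mul_apply, ← ENNReal.ofReal_mul (mul_nonneg Real.pi_pos.le
    (lossKernel_nonneg (net.κ_pos s) (net.delta_pos s) hx0.le)), LamHat'_eq]
  congr 1
  ring

theorem measurable_pathLoss (s : S) : Measurable (net.pathLoss s) :=
  (net.measurable_loss s).comp measurable_fst

theorem pathLoss_nonneg (s : S) (p : Link) : 0 ≤ net.pathLoss s p :=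
  mul_nonneg (net.κ_pos s).le (Real.rpow_nonneg (norm_nonneg _) _)

instance sigmaFinite_locationIntensity (s : S) : SigmaFinite (net.locationIntensity s) := by
  unfold locationIntensity
  exact SigmaFinite.withDensity_ofReal fun y : EuclideanSpace ℝ (Fin 2) =>
    net.lamBS * net.stateProb s ‖y‖ * net.Theta s

theorem map_linkIntensity (s : S) : (net.linkIntensity s).map (net.pathLoss s) =
    (volume.restrict (Ioi 0)).withDensity fun x => ENNReal.ofReal (net.LamHat' s x) := by
  have h : net.pathLoss s = (fun y => net.κ s * ‖y‖ ^ net.α s) ∘ Prod.fst := rfl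
  rw [h, ← Measure.map_map (net.measurable_loss s) measurable_fst, linkIntensity,
    Measure.map_fst_prod, measure_univ, one_smul, map_locationIntensity]

theorem lintegral_pathLoss (s : S) {g : ℝ → ℝ≥0∞} (hg : Measurable g) :
    ∫⁻ p, g (net.pathLoss s p) ∂net.linkIntensity s =
      ∫⁻ x in Ioi 0, ENNReal.ofReal (net.LamHat' s x) * g x := by
  rw [← lintegral_map hg (net.measurable_pathLoss s), map_linkIntensity,
    lintegral_withDensity_eq_lintegral_mul _ (net.measurable_LamHat' s).ennreal_ofReal hg]
  rfl

section Band

variable {E : Type*} [NormedAddCommGroup E] [NormedSpace ℝ E]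

theorem integral_heav_smul {F : ℝ → E} {x : ℝ} (c : ℝ) :
    ∫ L in Ioi x, heav (L - c) • F L = ∫ L in Ioi (max x c), F L := by
  have h1 : ∀ L, heav (L - c) • F L = (Ici c).indicator F L := fun L => by
    by_cases h : c ≤ L
    · rw [heav_of_le h, one_smul, indicator_of_mem (mem_Ici.2 h)]
    · rw [heav_of_lt (not_le.1 h), zero_smul, indicator_of_notMem (show L ∉ Ici c from h)]
  simp_rw [h1]
  rw [setIntegral_indicator measurableSet_Ici, ← Ioi_inter_Ioi]
  exact setIntegral_congr_set ((ae_eq_refl _).inter Ioi_ae_eq_Ici.symm)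

theorem integrableOn_heav_smul {F : ℝ → E} {x : ℝ} (hF : IntegrableOn F (Ioi x)) (c : ℝ) :
    IntegrableOn (fun L => heav (L - c) • F L) (Ioi x) := by
  refine Integrable.bdd_smul hF 1
    (measurable_heav.comp (measurable_id.sub_const c)).aestronglyMeasurable
    (Filter.Eventually.of_forall fun L => ?_)
  change ‖heav (L - c)‖ ≤ 1
  rw [Real.norm_of_nonneg (heav_nonneg _)]
  exact heav_le_one _

/-- A single antiderivative of `F` evaluates all bands. The maxima of `x` and the band ends are the
source of the Heaviside factors; the identity is used both for `LamHat` and for `calT`. -/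
theorem integral_lossProb_smul (s : S) {F : ℝ → E} {x : ℝ} (hF : IntegrableOn F (Ioi x)) :
    ∫ L in Ioi x, net.lossProb s L • F L =
      ∑ b : Fin B, net.q s b.castSucc • ((∫ L in Ioi (max x (net.lossAt s b.castSucc)), F L) -
        ∫ L in Ioi (max x (net.lossAt s b.succ)), F L)
      + net.q s (Fin.last B) • ∫ L in Ioi (max x (net.lossAt s (Fin.last B))), F L := by
  have hi := fun c => integrableOn_heav_smul hF c
  have hb : ∀ b : Fin B, IntegrableOn (fun L => net.q s b.castSucc •
      (heav (L - net.lossAt s b.castSucc) • F L - heav (L - net.lossAt s b.succ) • F L))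
      (Ioi x) := fun b => ((hi _).sub (hi _)).smul _
  have hl : IntegrableOn (fun L => net.q s (Fin.last B) •
      heav (L - net.lossAt s (Fin.last B)) • F L) (Ioi x) := (hi _).smul _
  simp only [lossProb, add_smul, Finset.sum_smul, mul_smul, sub_smul]
  rw [integral_add (integrable_finsetSum _ fun b _ => hb b) hl,
    integral_finsetSum _ fun b _ => hb b, integral_smul, integral_heav_smul]
  congr 1
  refine Finset.sum_congr rfl fun b _ => ?_
  rw [integral_smul, integral_sub (hi _) (hi _), integral_heav_smul, integral_heav_smul]

end Band

theorem integral_Ioi_indicator_lossKernel {κ δ : ℝ} (hκ : 0 < κ) (hδ : 0 < δ) {c ξ : ℝ} (hc : 0 ≤ c) :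
    ∫ L in Ioi c, (Iic ξ).indicator (lossKernel κ δ) L =
      heavC (c - ξ) * ((ξ / κ) ^ δ - (c / κ) ^ δ) := by
  rw [setIntegral_indicator measurableSet_Iic, Ioi_inter_Iic]
  rcases lt_or_ge c ξ with h | h
  · rw [integral_lossKernel hκ hδ hc h.le, heavC_of_lt h, one_mul]
  · rw [Ioc_eq_empty (not_lt.2 h), setIntegral_empty, heavC_of_le h, zero_mul]

theorem integral_LamHat' (s : S) {ξ : ℝ} (hξ : 0 ≤ ξ) :
    ∫ x in Ioi 0, (Iic ξ).indicator (net.LamHat' s) x = net.LamHat s ξ := by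
  have hκ := net.κ_pos s
  have hδ := net.delta_pos s
  have hF : IntegrableOn ((Iic ξ).indicator (lossKernel (net.κ s) (2 / net.α s))) (Ioi 0) := by
    rw [integrableOn_indicator_iff measurableSet_Iic, inter_comm, Ioi_inter_Iic]
    exact integrableOn_lossKernel hδ hξ
  have h1 : ∀ x, (Iic ξ).indicator (net.LamHat' s) x = (Real.pi * net.lamBS * net.Theta s) *
      (net.lossProb s x • (Iic ξ).indicator (lossKernel (net.κ s) (2 / net.α s)) x) := fun x => by
    by_cases hx : x ∈ Iic ξ
    · rw [indicator_of_mem hx, indicator_of_mem hx, LamHat'_eq, smul_eq_mul]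
      ring
    · rw [indicator_of_notMem hx, indicator_of_notMem hx, smul_zero, mul_zero]
  simp_rw [h1]
  rw [integral_const_mul, net.integral_lossProb_smul s hF, LamHat, mul_add, Finset.mul_sum]
  have hmax : ∀ b, max 0 (net.lossAt s b) = net.lossAt s b := fun b =>
    max_eq_right (net.lossAt_nonneg s b)
  simp only [hmax, integral_Ioi_indicator_lossKernel hκ hδ (net.lossAt_nonneg s _),
    lossAt_div_rpow, smul_eq_mul]
  rw [Finset.mul_sum, Finset.mul_sum, ← Finset.sum_add_distrib]
  -- The two indicators differ only at `ξ` equal to the band end, where the bracket vanishes.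
  have hlast : heavC (net.lossAt s (Fin.last B) - ξ) *
      ((ξ / net.κ s) ^ (2 / net.α s) - net.D (Fin.last B) ^ 2) =
      heav (ξ - net.lossAt s (Fin.last B)) *
        ((ξ / net.κ s) ^ (2 / net.α s) - net.D (Fin.last B) ^ 2) := by
    rcases lt_trichotomy ξ (net.lossAt s (Fin.last B)) with h | h | h
    · rw [heav_of_lt h, heavC_of_le h.le]
    · rw [h, lossAt_div_rpow]; simp
    · rw [heav_of_le h.le, heavC_of_lt h]
  rw [hlast]
  congr 1
  · refine Finset.sum_congr rfl fun b _ => ?_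
    have hb := net.lossAt_mono s (Fin.castSucc_lt_succ (i := b)).le
    -- Three cases: `ξ` before, inside or beyond the band. Equality with a band end needs separate
    -- treatment because the two forms use opposite conventions there.
    rcases lt_or_ge ξ (net.lossAt s b.castSucc) with h | h
    · have h' := h.trans_le hb
      rw [heav_of_lt h, heav_of_lt h', heavC_of_le h.le, heavC_of_le h'.le]
      ring
    · rcases lt_or_ge ξ (net.lossAt s b.succ) with h' | h'
      · rw [heav_of_le h, heav_of_lt h', heavC_of_le h'.le, heavC_of_lt h']
        rcases eq_or_lt_of_le h with h2 | h2
        · rw [← h2, lossAt_div_rpow]; ring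
        · rw [heavC_of_lt h2]; ring
      · rw [heav_of_le h, heav_of_le h', heavC_of_le h']
        rcases eq_or_lt_of_le h' with h3 | h3
        · rw [← h3] at h ⊢
          rw [lossAt_div_rpow, heavC_of_le le_rfl]
          rcases eq_or_lt_of_le h with h2 | h2
          · have := net.lossAt_div_rpow s b.castSucc
            rw [h2, lossAt_div_rpow] at this
            rw [this]; ring
          · rw [heavC_of_lt h2]; ring
        · rw [heavC_of_lt h3, heavC_of_lt (hb.trans_lt h3)]
          ring
  · ring

theorem integrableOn_indicator_LamHat' (s : S) {ξ : ℝ} (hξ : 0 ≤ ξ) :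
    IntegrableOn ((Iic ξ).indicator (net.LamHat' s)) (Ioi 0) := by
  rw [integrableOn_indicator_iff measurableSet_Iic, inter_comm, Ioi_inter_Iic]
  have h1 : IntegrableOn (lossKernel (net.κ s) (2 / net.α s)) (Ioc 0 ξ) :=
    integrableOn_lossKernel (net.delta_pos s) hξ
  have h2 := (h1.const_mul (Real.pi * net.lamBS * net.Theta s)).mul_bdd (c := ∑ b, net.q s b)
    (net.measurable_lossProb s).aestronglyMeasurable (Filter.Eventually.of_forall fun x => by
      rw [Real.norm_of_nonneg (net.lossProb_nonneg s x)]
      exact net.lossProb_le s x)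
  refine h2.congr (Filter.Eventually.of_forall fun x => ?_)
  exact (net.LamHat'_eq s x).symm

theorem linkIntensity_pathLoss_le (s : S) {ξ : ℝ} (hξ : 0 ≤ ξ) :
    net.linkIntensity s {p | net.pathLoss s p ≤ ξ} = ENNReal.ofReal (net.LamHat s ξ) := by
  have h1 : net.linkIntensity s {p | net.pathLoss s p ≤ ξ} =
      (net.linkIntensity s).map (net.pathLoss s) (Iic ξ) :=
    (Measure.map_apply (net.measurable_pathLoss s) measurableSet_Iic).symm
  rw [h1, map_linkIntensity, withDensity_apply _ measurableSet_Iic,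
    Measure.restrict_restrict measurableSet_Iic, inter_comm, ← net.integral_LamHat' s hξ,
    setIntegral_indicator measurableSet_Iic, ofReal_integral_eq_lintegral_ofReal]
  · have := net.integrableOn_indicator_LamHat' s hξ
    rwa [integrableOn_indicator_iff measurableSet_Iic, inter_comm] at this
  · filter_upwards [ae_restrict_mem (measurableSet_Ioi.inter measurableSet_Iic)] with x hx
    exact net.LamHat'_nonneg s (le_of_lt hx.1)

theorem LamHat_nonneg (s : S) {ξ : ℝ} (hξ : 0 ≤ ξ) : 0 ≤ net.LamHat s ξ := by
  rw [← net.integral_LamHat' s hξ]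
  refine setIntegral_nonneg measurableSet_Ioi fun x hx => ?_
  exact indicator_apply_nonneg fun _ => net.LamHat'_nonneg s (le_of_lt hx)

theorem linkIntensity_pathLoss_eq (s : S) (ξ : ℝ) :
    net.linkIntensity s {p | net.pathLoss s p = ξ} = 0 := by
  have h1 : net.linkIntensity s {p | net.pathLoss s p = ξ} =
      (net.linkIntensity s).map (net.pathLoss s) {ξ} :=
    (Measure.map_apply (net.measurable_pathLoss s) (measurableSet_singleton ξ)).symm
  rw [h1, map_linkIntensity]
  exact withDensity_absolutelyContinuous _ _
    (Measure.absolutelyContinuous_of_le Measure.restrict_le_self (measure_singleton ξ))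

end Loss

end Network

/-! ### Tail integrals against the path-loss density as hypergeometric values -/

section ScaledKernel

open Complex

variable {m κ δ : ℝ} {W : ℂ} {c : ℝ}

theorem lossKernel_comp_mul (hc : 0 < c) {t : ℝ} (ht : 0 < t) :
    (lossKernel κ δ (c * t) : ℂ) * ((1 - W / (c * t : ℝ)) ^ (-m : ℂ) - 1) =
      -((κ ^ (-δ) * c ^ (δ - 1) : ℝ) : ℂ) * hypKernel m δ (W / c) t := by
  rw [lossKernel, hypKernel, Real.mul_rpow hc.le ht.le]
  have h1 : W / (c * t : ℝ) = W / c / t := by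
    push_cast
    rw [div_div]
  rw [h1]
  push_cast
  ring

theorem integrableOn_lossKernel_mul (hδ0 : 0 < δ) (hδ : δ < 1) (hc : 0 < c)
    (hW : W / c ∈ cutPlane) :
    IntegrableOn (fun L : ℝ => (lossKernel κ δ L : ℂ) * ((1 - W / L) ^ (-m : ℂ) - 1))
      (Ioi c) := by
  have h := (integrableOn_hypKernel (m := m) hδ0 hδ hW).const_mul
    (-((κ ^ (-δ) * c ^ (δ - 1) : ℝ) : ℂ))
  have h2 := integrableOn_Ioi_comp_mul_left_iff
    (fun L : ℝ => (lossKernel κ δ L : ℂ) * ((1 - W / L) ^ (-m : ℂ) - 1)) 1 hc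
  rw [mul_one] at h2
  refine h2.1 ?_
  refine IntegrableOn.congr_fun h (fun t ht => ?_) measurableSet_Ioi
  exact (lossKernel_comp_mul hc (zero_lt_one.trans ht)).symm

/-- The substitution `L = c t` moves the half-line to `t > 1` and turns the integrand into a
multiple of `hypKernel` at `W / c`. -/
theorem integral_lossKernel_mul (hκ : 0 < κ) (hδ0 : 0 < δ) (hδ : δ < 1) (hc : 0 < c)
    (hW : W / c ∈ cutPlane) :
    ∫ L in Ioi c, (lossKernel κ δ L : ℂ) * ((1 - W / L) ^ (-m : ℂ) - 1) =
      (((c / κ) ^ δ : ℝ) : ℂ) * (1 - gaussHyp m (-δ : ℂ) (1 - δ : ℂ) (W / c)) := by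
  have h2 := integral_comp_mul_left_Ioi
    (fun L : ℝ => (lossKernel κ δ L : ℂ) * ((1 - W / L) ^ (-m : ℂ) - 1)) 1 hc
  rw [mul_one, setIntegral_congr_fun measurableSet_Ioi fun t (ht : 1 < t) =>
    lossKernel_comp_mul hc (zero_lt_one.trans ht), integral_const_mul] at h2
  have hc0 : (c : ℂ) ≠ 0 := ofReal_ne_zero.2 hc.ne'
  rw [gaussHyp_eq_integral hδ0 hδ hW, Real.div_rpow hc.le hκ.le,
    ← smul_inv_smul₀ hc.ne' (∫ L in Ioi c, _), ← h2, Real.rpow_neg hκ.le,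
    Real.rpow_sub_one hc.ne', real_smul]
  push_cast
  field_simp
  ring

end ScaledKernel

/-! ### The exponent of the interference in closed form -/

namespace Network

section Interference

variable {S : Type*} [Fintype S] {B : ℕ} (net : Network S B)

open Complex

/-- The factor of `1 / L` in the Laplace exponent of the gain of an interfering link. -/
noncomputable def lobeRate (s : S) (τ : ℝ) (k : Fin net.antBS.K) (l : Fin net.antMT.K) : ℂ :=
  I * τ * (net.Om s / net.m s) * (net.antBS.γ k * net.antMT.γ l)

/-- The expectation of `exp (i τ G g / L) - 1`. -/
noncomputable def markExponent (s : S) (τ L : ℝ) : ℂ :=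
  ∑ k, ∑ l, ((net.antBS.width k / (2 * Real.pi) : ℝ) : ℂ) *
    ((net.antMT.width l / (2 * Real.pi) : ℝ) : ℂ) *
      ((1 - net.lobeRate s τ k l / L) ^ (-net.m s : ℂ) - 1)

/-- Characteristic functions involve only arguments of real part `0`, away from the cut. -/
theorem I_mul_ofReal_mem_cutPlane (y : ℝ) : I * y ∈ cutPlane := by
  simp only [cutPlane, mem_ofPred_eq, mul_re, I_re, I_im, ofReal_re, ofReal_im]
  rintro ⟨h, -⟩
  norm_num at h

theorem lobeRate_div (s : S) (τ c : ℝ) (k : Fin net.antBS.K) (l : Fin net.antMT.K) :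
    net.lobeRate s τ k l / c =
      I * ((τ * (net.Om s / net.m s) * (net.antBS.γ k * net.antMT.γ l) / c : ℝ) : ℂ) := by
  rw [lobeRate]
  push_cast
  ring

theorem lobeRate_div_mem_cutPlane (s : S) (τ c : ℝ) (k : Fin net.antBS.K)
    (l : Fin net.antMT.K) : net.lobeRate s τ k l / c ∈ cutPlane := by
  rw [lobeRate_div]
  exact I_mul_ofReal_mem_cutPlane _

theorem sum_width_mul_width :
    ∑ k, ∑ l, ((net.antBS.width k / (2 * Real.pi) : ℝ) : ℂ) *
      ((net.antMT.width l / (2 * Real.pi) : ℝ) : ℂ) = 1 := by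
  have h : ∀ A : Antenna, ∑ k, A.width k / (2 * Real.pi) = 1 := fun A => by
    rw [← Finset.sum_div, A.sum_width, div_self (by positivity)]
  simp_rw [← Finset.mul_sum, ← ofReal_sum, h, ofReal_one, mul_one]
  rw [← ofReal_sum, h, ofReal_one]

/-- The lobe weights sum to one, so the leading `1` of `calF` can be distributed over the pairs of
lobes. -/
theorem calF_eq (s : S) (τ c : ℝ) : net.calF s (-(I * τ / c)) =
    ∑ k, ∑ l, ((net.antBS.width k / (2 * Real.pi) : ℝ) : ℂ) *
      ((net.antMT.width l / (2 * Real.pi) : ℝ) : ℂ) *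
        (1 - gaussHyp (net.m s) (-((2 / net.α s : ℝ) : ℂ)) (1 - ((2 / net.α s : ℝ) : ℂ))
          (net.lobeRate s τ k l / c)) := by
  have hz : ∀ k l, -(-(I * τ / c) * ((net.Om s : ℂ) / net.m s) *
      (net.antBS.γ k * net.antMT.γ l)) = net.lobeRate s τ k l / c := fun k l => by
    rw [lobeRate]
    ring
  have hd : ((2 / net.α s : ℝ) : ℂ) = 2 / (net.α s : ℂ) := by push_cast; rfl
  simp only [mul_sub, mul_one, Finset.sum_sub_distrib, sum_width_mul_width, calF, hz, hd]

theorem lossKernel_mul_markExponent (s : S) (τ L : ℝ) :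
    (lossKernel (net.κ s) (2 / net.α s) L : ℂ) * net.markExponent s τ L =
      ∑ k, ∑ l, (((net.antBS.width k / (2 * Real.pi) : ℝ) : ℂ) *
        ((net.antMT.width l / (2 * Real.pi) : ℝ) : ℂ)) *
        ((lossKernel (net.κ s) (2 / net.α s) L : ℂ) *
          ((1 - net.lobeRate s τ k l / L) ^ (-net.m s : ℂ) - 1)) := by
  rw [markExponent, Finset.mul_sum]
  refine Finset.sum_congr rfl fun k _ => ?_
  rw [Finset.mul_sum]
  refine Finset.sum_congr rfl fun l _ => ?_
  ring

theorem integrableOn_markExponent (s : S) (τ : ℝ) {c : ℝ} (hc : 0 < c) :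
    IntegrableOn (fun L : ℝ => (lossKernel (net.κ s) (2 / net.α s) L : ℂ) *
      net.markExponent s τ L) (Ioi c) := by
  simp_rw [lossKernel_mul_markExponent]
  exact integrable_finsetSum _ fun k _ => integrable_finsetSum _ fun l _ =>
    (integrableOn_lossKernel_mul (net.delta_pos s) (net.delta_lt_one s) hc
      (net.lobeRate_div_mem_cutPlane s τ c k l)).const_mul _

theorem integral_markExponent (s : S) (τ : ℝ) {c : ℝ} (hc : 0 < c) :
    ∫ L in Ioi c, (lossKernel (net.κ s) (2 / net.α s) L : ℂ) * net.markExponent s τ L =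
      (((c / net.κ s) ^ (2 / net.α s) : ℝ) : ℂ) * net.calF s (-(I * τ / c)) := by
  have hi := fun k l => (integrableOn_lossKernel_mul (m := net.m s) (κ := net.κ s)
    (net.delta_pos s) (net.delta_lt_one s) hc (net.lobeRate_div_mem_cutPlane s τ c k l)).const_mul
      (((net.antBS.width k / (2 * Real.pi) : ℝ) : ℂ) *
        ((net.antMT.width l / (2 * Real.pi) : ℝ) : ℂ))
  simp_rw [lossKernel_mul_markExponent]
  rw [integral_finsetSum _ fun k _ => integrable_finsetSum _ fun l _ => hi k l, calF_eq,
    Finset.mul_sum]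
  refine Finset.sum_congr rfl fun k _ => ?_
  rw [integral_finsetSum _ fun l _ => hi k l, Finset.mul_sum]
  refine Finset.sum_congr rfl fun l _ => ?_
  rw [integral_const_mul, integral_lossKernel_mul (net.κ_pos s) (net.delta_pos s)
    (net.delta_lt_one s) hc (net.lobeRate_div_mem_cutPlane s τ c k l)]
  ring

/-- The exponent of the moment generating function in terms of one function of the path-loss. -/
theorem calT_eq (r : S) (z : ℂ) {x : ℝ} (hx : 0 < x) {V : ℝ → ℂ}
    (hV : ∀ c, V c = (Real.pi * net.lamI * net.Theta r : ℝ) *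
      ((((c / net.κ r) ^ (2 / net.α r) : ℝ) : ℂ) * net.calF r (x * z / c))) :
    net.calT r z x = ∑ b : Fin B, net.q r b.castSucc •
        (V (max x (net.lossAt r b.castSucc)) - V (max x (net.lossAt r b.succ)))
      + net.q r (Fin.last B) • V (max x (net.lossAt r (Fin.last B))) := by
  have hx0 : (x : ℂ) ≠ 0 := ofReal_ne_zero.2 hx.ne'
  -- The tail starts at `x` if the band end has been passed and at the band end otherwise; this
  -- yields the two kinds of terms of `calT`.
  have hmax : ∀ c, V (max x c) = (heav (x - c) : ℂ) * V x + (heavC (x - c) : ℂ) * V c := by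
    intro c
    rcases lt_or_ge x c with h | h
    · rw [max_eq_right h.le, heav_of_lt h, heavC_of_lt h]; simp
    · rw [max_eq_left h, heav_of_le h, heavC_of_le h]; simp
  have hVx : V x = (Real.pi * net.lamI * net.Theta r : ℝ) *
      ((((x / net.κ r) ^ (2 / net.α r) : ℝ) : ℂ) * net.calF r z) := by
    rw [hV, mul_div_cancel_left₀ _ hx0]
  have hVl : ∀ b, V (net.lossAt r b) = (Real.pi * net.lamI * net.Theta r : ℝ) *
      (((net.D b ^ 2 : ℝ) : ℂ) * net.calF r (x * z / (net.lossAt r b : ℝ))) := fun b => by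
    rw [hV, lossAt_div_rpow]
  have hh : ∀ b : Fin B, ((net.q r b.castSucc * (heavC (x - net.lossAt r b.succ)
      * heav (x - net.lossAt r b.castSucc)) : ℝ) : ℂ) = (net.q r b.castSucc : ℂ) *
      ((heav (x - net.lossAt r b.castSucc) : ℂ) - (heav (x - net.lossAt r b.succ) : ℂ)) :=
    fun b => by
      rw [heavC_mul_heav (net.lossAt_mono r (Fin.castSucc_lt_succ).le)]
      push_cast
      ring
  simp only [hmax, hVx, hVl, calT, hh, real_smul]
  rw [Finset.mul_sum, Finset.mul_sum, ← Finset.sum_add_distrib]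
  congr 1
  · refine Finset.sum_congr rfl fun b _ => ?_
    push_cast
    ring
  · push_cast
    ring

end Interference

end Network

/-! ### Mean and characteristic exponent of the power of interfering links -/

namespace Network

section InterferingPower

variable {S : Type*} [Fintype S] {B : ℕ} (net : Network S B)

open Complex

theorem measurableSet_interferers (x : ℝ) (s : S) :
    MeasurableSet {p : Link | p.2.1 = true ∧ x < net.pathLoss s p} :=
  ((measurable_fst.comp measurable_snd) (measurableSet_singleton true)).inter
    ((net.measurable_pathLoss s) measurableSet_Ioi)

/-- The power received over a link from an active base station. -/
noncomputable def linkPower (s : S) (p : Link) : ℝ :=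
  net.PRB * (net.antBS.gain p.2.2.2.1 * net.antMT.gain p.2.2.2.2) * p.2.2.1 / net.pathLoss s p

theorem measurable_linkPower (s : S) : Measurable (net.linkPower s) := by
  have h1 : Measurable fun p : Link => net.antBS.gain p.2.2.2.1 :=
    net.antBS.measurable_gain.comp (by fun_prop)
  have h2 : Measurable fun p : Link => net.antMT.gain p.2.2.2.2 :=
    net.antMT.measurable_gain.comp (by fun_prop)
  have h3 : Measurable fun p : Link => p.2.2.1 := by fun_prop
  exact (((h1.mul h2).const_mul _).mul h3).div (net.measurable_pathLoss s)

theorem measurable_interferingPower (x : ℝ) (s : S) : Measurable (net.interferingPower x s) :=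
  Measurable.ite (net.measurableSet_interferers x s) (net.measurable_linkPower s).ennreal_ofReal
    measurable_const

theorem ae_markLaw_fading_pos (s : S) : ∀ᵐ k ∂net.markLaw s, 0 < k.2.1 := by
  have := net.isProbabilityMeasure_fadingLaw s
  have h1 : ∀ᵐ k ∂((gammaMeasure (net.m s) (net.m s / net.Om s)).prod
      (angleLaw.prod angleLaw)), 0 < k.1 :=
    Measure.quasiMeasurePreserving_fst.ae ae_pos_gammaMeasure
  exact Measure.quasiMeasurePreserving_snd.ae h1

theorem ae_linkIntensity_fading_pos (s : S) : ∀ᵐ p ∂net.linkIntensity s, 0 < p.2.2.1 :=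
  Measure.quasiMeasurePreserving_snd.ae (net.ae_markLaw_fading_pos s)

theorem ae_linkIntensity_pathLoss_pos (s : S) : ∀ᵐ p ∂net.linkIntensity s,
    0 < net.pathLoss s p := by
  filter_upwards [compl_mem_ae_iff.2 (net.linkIntensity_pathLoss_eq s 0)] with p hp
  exact lt_of_le_of_ne (net.pathLoss_nonneg s p) (Ne.symm hp)

theorem lintegral_fading_markLaw (s : S) : ∫⁻ k, ENNReal.ofReal k.2.1 ∂net.markLaw s =
    ∫⁻ g, ENNReal.ofReal g ∂gammaMeasure (net.m s) (net.m s / net.Om s) := by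
  have := net.isProbabilityMeasure_fadingLaw s
  have h1 : MeasurePreserving Prod.snd (net.markLaw s)
      ((gammaMeasure (net.m s) (net.m s / net.Om s)).prod (angleLaw.prod angleLaw)) :=
    measurePreserving_snd
  have h2 : MeasurePreserving Prod.fst ((gammaMeasure (net.m s) (net.m s / net.Om s)).prod
      (angleLaw.prod angleLaw)) (gammaMeasure (net.m s) (net.m s / net.Om s)) :=
    measurePreserving_fst
  exact (h2.comp h1).lintegral_comp ENNReal.measurable_ofReal

theorem lintegral_fading_ne_top (s : S) : ∫⁻ k, ENNReal.ofReal k.2.1 ∂net.markLaw s ≠ ∞ := by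
  rw [lintegral_fading_markLaw]
  exact (integrable_id_gammaMeasure (net.m_pos s)
    (div_pos (net.m_pos s) (net.Om_pos s))).lintegral_lt_top.ne

/-- The mean interference from the base stations in state `s`. -/
theorem exists_lintegral_interferingPower_le (s : S) : ∃ C : ℝ, 0 ≤ C ∧ ∀ x, 0 < x →
    ∫⁻ p, net.interferingPower x s p ∂net.linkIntensity s ≤
      ENNReal.ofReal (C * x ^ (2 / net.α s - 1)) := by
  have hP := net.PRB_pos
  have hδ := net.delta_lt_one s
  have hδ0 := net.delta_pos s
  have hκ := net.κ_pos s
  have hpi := Real.pi_pos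
  have hl := net.lamBS_pos
  have hT := net.Theta_pos s
  set G : ℝ := (∑ l, net.antBS.γ l) * ∑ l, net.antMT.γ l with hG
  have hGnn : 0 ≤ G := mul_nonneg (Finset.sum_nonneg fun l _ => net.antBS.γ_nonneg l)
    (Finset.sum_nonneg fun l _ => net.antMT.γ_nonneg l)
  have hQ : 0 ≤ ∑ b, net.q s b := Finset.sum_nonneg fun b _ => net.q_nonneg s b
  set M := ∫⁻ k, ENNReal.ofReal k.2.1 ∂net.markLaw s with hM
  have hMt : M ≠ ∞ := net.lintegral_fading_ne_top s
  set c := Real.pi * net.lamBS * net.Theta s * (∑ b, net.q s b) * (net.PRB * G) with hc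
  have hcnn : 0 ≤ c := by positivity
  refine ⟨c * (2 / net.α s * net.κ s ^ (-(2 / net.α s)) / (1 - 2 / net.α s)) * M.toReal, ?_,
    fun x hx => ?_⟩
  · have : 0 ≤ 1 - 2 / net.α s := by linarith
    positivity
  -- The gains are bounded by the sums `G` of lobe gains, so the power is at most a function of the
  -- path-loss times the fading, and location and marks separate. The tail integral of `L ^ (δ - 2)`
  -- converges because `α > 2`.
  set w : ℝ → ℝ≥0∞ := (Ioi x).indicator fun L => ENNReal.ofReal (net.PRB * G / L) with hw
  have hwm : Measurable w :=
    Measurable.indicator (measurable_const.div measurable_id).ennreal_ofReal measurableSet_Ioi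
  have h1 : ∀ p : Link, net.interferingPower x s p ≤
      w (net.κ s * ‖p.1‖ ^ net.α s) * ENNReal.ofReal p.2.2.1 := fun p => by
    unfold interferingPower
    split_ifs with h
    · have hx' : net.κ s * ‖p.1‖ ^ net.α s ∈ Ioi x := h.2
      have hL0 : 0 < net.κ s * ‖p.1‖ ^ net.α s := hx.trans h.2
      rw [hw, indicator_of_mem hx', ← ENNReal.ofReal_mul (by positivity)]
      -- The bound is pointwise, and a link may formally carry a nonpositive fading value;
      -- `ENNReal.ofReal` then gives zero power.
      rcases le_or_gt p.2.2.1 0 with hg | hg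
      · refine (ENNReal.ofReal_of_nonpos ?_).le.trans zero_le
        refine div_nonpos_of_nonpos_of_nonneg (mul_nonpos_of_nonneg_of_nonpos ?_ hg) hL0.le
        exact mul_nonneg hP.le (mul_nonneg (net.antBS.gain_nonneg _) (net.antMT.gain_nonneg _))
      · refine ENNReal.ofReal_le_ofReal ?_
        change _ / (net.κ s * ‖p.1‖ ^ net.α s) ≤ _
        rw [div_mul_eq_mul_div]
        gcongr
        exact mul_le_mul (net.antBS.gain_le _) (net.antMT.gain_le _) (net.antMT.gain_nonneg _)
          (Finset.sum_nonneg fun l _ => net.antBS.γ_nonneg l)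
    · exact zero_le
  have h2 : ∫⁻ y, w (net.κ s * ‖y‖ ^ net.α s) ∂net.locationIntensity s ≤
      ENNReal.ofReal (c * (2 / net.α s * net.κ s ^ (-(2 / net.α s)) / (1 - 2 / net.α s)) *
        x ^ (2 / net.α s - 1)) := by
    rw [← lintegral_map hwm (net.measurable_loss s), map_locationIntensity,
      lintegral_withDensity_eq_lintegral_mul _ (net.measurable_LamHat' s).ennreal_ofReal hwm,
      mul_assoc, ← integral_lossKernel_div hδ hx, ← integral_const_mul,
      ofReal_integral_eq_lintegral_ofReal ((integrableOn_lossKernel_div hδ hx).const_mul c),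
      ← lintegral_indicator measurableSet_Ioi, ← lintegral_indicator measurableSet_Ioi]
    · refine lintegral_mono fun L => ?_
      by_cases hL : L ∈ Ioi x
      · have hL0 : 0 < L := hx.trans hL
        rw [indicator_of_mem hL, indicator_of_mem (mem_Ioi.2 hL0), Pi.mul_apply, hw,
          indicator_of_mem hL, ← ENNReal.ofReal_mul (net.LamHat'_nonneg s hL0.le)]
        refine ENNReal.ofReal_le_ofReal ?_
        rw [LamHat'_eq, hc]
        have hk := lossKernel_nonneg hκ hδ0 hL0.le
        calc _ ≤ Real.pi * net.lamBS * net.Theta s * lossKernel (net.κ s) (2 / net.α s) L *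
              (∑ b, net.q s b) * (net.PRB * G / L) := by
                gcongr
                exact net.lossProb_le s L
          _ = _ := by ring
      · rw [indicator_of_notMem hL]
        refine indicator_apply_le' (fun _ => ?_) fun _ => le_rfl
        rw [Pi.mul_apply, hw, indicator_of_notMem hL, mul_zero]
    · filter_upwards [ae_restrict_mem measurableSet_Ioi] with L hL
      have hL0 : 0 < L := hx.trans hL
      exact mul_nonneg hcnn (div_nonneg (lossKernel_nonneg hκ hδ0 hL0.le) hL0.le)
  calc ∫⁻ p, net.interferingPower x s p ∂net.linkIntensity s
      ≤ ∫⁻ p : Link, w (net.κ s * ‖p.1‖ ^ net.α s) * ENNReal.ofReal p.2.2.1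
          ∂(net.locationIntensity s).prod (net.markLaw s) := lintegral_mono h1
    _ = (∫⁻ y, w (net.κ s * ‖y‖ ^ net.α s) ∂net.locationIntensity s) * M :=
        lintegral_prod_mul (f := fun y : EuclideanSpace ℝ (Fin 2) => w (net.κ s * ‖y‖ ^ net.α s))
          (g := fun k : Bool × ℝ × ℝ × ℝ => ENNReal.ofReal k.2.1)
          (hwm.comp (net.measurable_loss s)).aemeasurable (Measurable.aemeasurable (by fun_prop))
    _ ≤ ENNReal.ofReal (c * (2 / net.α s * net.κ s ^ (-(2 / net.α s)) / (1 - 2 / net.α s)) *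
        x ^ (2 / net.α s - 1)) * ENNReal.ofReal M.toReal := by
        rw [ENNReal.ofReal_toReal hMt]
        gcongr
    _ = _ := by
        rw [← ENNReal.ofReal_mul' ENNReal.toReal_nonneg]
        congr 1
        ring

theorem lintegral_interferingPower_ne_top (s : S) {x : ℝ} (hx : 0 < x) :
    ∫⁻ p, net.interferingPower x s p ∂net.linkIntensity s ≠ ∞ := by
  obtain ⟨C, -, hC⟩ := net.exists_lintegral_interferingPower_le s
  exact ne_top_of_le_ne_top ENNReal.ofReal_ne_top (hC x hx)

theorem norm_cexp_sub_one_le_two (r : ℝ) : ‖cexp (r * I) - 1‖ ≤ 2 := by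
  refine (norm_sub_le _ _).trans ?_
  rw [norm_exp_ofReal_mul_I, norm_one]
  norm_num

/-- Integrating over the angles first gives a finite mixture over pairs of lobes; each term is a
characteristic function of the gamma law. -/
theorem integral_fading_gain (s : S) (t L : ℝ) :
    ∫ k, (cexp ((t * (net.PRB * (net.antBS.gain k.2.1 * net.antMT.gain k.2.2) * k.1 / L) : ℝ) * I)
        - 1) ∂((gammaMeasure (net.m s) (net.m s / net.Om s)).prod (angleLaw.prod angleLaw)) =
      net.markExponent s (t * net.PRB) L := by
  have := net.isProbabilityMeasure_fadingLaw s
  have hm := net.m_pos s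
  have hO := net.Om_pos s
  have hm0 : (net.m s : ℂ) ≠ 0 := ofReal_ne_zero.2 hm.ne'
  have hO0 : (net.Om s : ℂ) ≠ 0 := ofReal_ne_zero.2 hO.ne'
  have h1 : Measurable fun k : ℝ × ℝ × ℝ => net.antBS.gain k.2.1 :=
    net.antBS.measurable_gain.comp (by fun_prop)
  have h2 : Measurable fun k : ℝ × ℝ × ℝ => net.antMT.gain k.2.2 :=
    net.antMT.measurable_gain.comp (by fun_prop)
  have hi : Integrable (fun k : ℝ × ℝ × ℝ => cexp ((t * (net.PRB * (net.antBS.gain k.2.1 *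
      net.antMT.gain k.2.2) * k.1 / L) : ℝ) * I) - 1)
      ((gammaMeasure (net.m s) (net.m s / net.Om s)).prod (angleLaw.prod angleLaw)) :=
    Integrable.of_bound (Measurable.aestronglyMeasurable (by fun_prop)) 2
      (Filter.Eventually.of_forall fun k => norm_cexp_sub_one_le_two _)
  rw [integral_prod _ hi]
  have h3 : ∀ g : ℝ, ∫ θ, (cexp ((t * (net.PRB * (net.antBS.gain θ.1 * net.antMT.gain θ.2) * g / L)
      : ℝ) * I) - 1) ∂(angleLaw.prod angleLaw) =
      ∑ k, ∑ l, ((net.antBS.width k / (2 * Real.pi) : ℝ) : ℂ) *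
        ((net.antMT.width l / (2 * Real.pi) : ℝ) : ℂ) *
        (cexp ((t * (net.PRB * (net.antBS.γ k * net.antMT.γ l) * g / L) : ℝ) * I) - 1) :=
    fun g => net.antBS.integral_gain net.antMT
      fun a b => cexp ((t * (net.PRB * (a * b) * g / L) : ℝ) * I) - 1
  simp_rw [h3]
  have hi2 : ∀ k l, Integrable (fun g : ℝ => ((net.antBS.width k / (2 * Real.pi) : ℝ) : ℂ) *
        ((net.antMT.width l / (2 * Real.pi) : ℝ) : ℂ) *
        (cexp ((t * (net.PRB * (net.antBS.γ k * net.antMT.γ l) * g / L) : ℝ) * I) - 1))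
        (gammaMeasure (net.m s) (net.m s / net.Om s)) := fun k l =>
    (Integrable.of_bound (Measurable.aestronglyMeasurable (by fun_prop)) 2
      (Filter.Eventually.of_forall fun k => norm_cexp_sub_one_le_two _)).const_mul _
  rw [integral_finsetSum _ fun k _ => integrable_finsetSum _ fun l _ => hi2 k l, markExponent]
  refine Finset.sum_congr rfl fun k _ => ?_
  rw [integral_finsetSum _ fun l _ => hi2 k l]
  refine Finset.sum_congr rfl fun l _ => ?_
  rw [integral_const_mul]
  congr 1
  have hi3 : Integrable (fun g : ℝ => cexp ((t * (net.PRB * (net.antBS.γ k * net.antMT.γ l) /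
      L) : ℝ) * g * I)) (gammaMeasure (net.m s) (net.m s / net.Om s)) :=
    Integrable.of_bound (Measurable.aestronglyMeasurable (by fun_prop)) 1
      (Filter.Eventually.of_forall fun g => by
        rw [← ofReal_mul, norm_exp_ofReal_mul_I])
  have h4 : ∀ g : ℝ, ((t * (net.PRB * (net.antBS.γ k * net.antMT.γ l) * g / L) : ℝ) : ℂ) * I =
      (t * (net.PRB * (net.antBS.γ k * net.antMT.γ l) / L) : ℝ) * g * I := fun g => by
    push_cast
    ring
  simp_rw [h4]
  rw [integral_sub hi3 (integrable_const 1), integral_cexp_gammaMeasure hm (div_pos hm hO)]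
  simp only [integral_const, probReal_univ, one_smul]
  congr 3
  rw [lobeRate]
  push_cast
  field_simp

/-- An inactive base station contributes `exp 0 - 1 = 0`, so activity acts as a thinning and enters
through the factor `1 - pOff`. -/
theorem integral_markLaw_interferingPower (s : S) {x t : ℝ} (hx : 0 < x)
    (y : EuclideanSpace ℝ (Fin 2)) :
    ∫ k, (cexp (t * (net.interferingPower x s (y, k)).toReal * I) - 1) ∂net.markLaw s =
      (Ioi x).indicator (fun L : ℝ => ((1 - net.pOff : ℝ) : ℂ) *
        net.markExponent s (t * net.PRB) L) (net.κ s * ‖y‖ ^ net.α s) := by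
  have := net.isProbabilityMeasure_fadingLaw s
  set L := net.κ s * ‖y‖ ^ net.α s with hL
  have hpl : ∀ k, net.pathLoss s (y, k) = L := fun _ => rfl
  by_cases h : x < L
  · have hL0 : 0 < L := hx.trans h
    rw [indicator_of_mem (mem_Ioi.2 h)]
    set ψ : ℝ × ℝ × ℝ → ℂ := fun k => cexp ((t * (net.PRB * (net.antBS.gain k.2.1 *
      net.antMT.gain k.2.2) * k.1 / L) : ℝ) * I) - 1 with hψ
    have h1 : Measurable fun k : ℝ × ℝ × ℝ => net.antBS.gain k.2.1 :=
      net.antBS.measurable_gain.comp (by fun_prop)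
    have h2 : Measurable fun k : ℝ × ℝ × ℝ => net.antMT.gain k.2.2 :=
      net.antMT.measurable_gain.comp (by fun_prop)
    have hψm : Measurable ψ := by fun_prop
    have hae : ∀ᵐ k ∂net.markLaw s, cexp (t * (net.interferingPower x s (y, k)).toReal * I) - 1 =
        (if k.1 = true then (1 : ℂ) else 0) * ψ k.2 := by
      filter_upwards [net.ae_markLaw_fading_pos s] with k hk
      by_cases hb : k.1 = true
      · have : net.interferingPower x s (y, k) = ENNReal.ofReal (net.PRB *
            (net.antBS.gain k.2.2.1 * net.antMT.gain k.2.2.2) * k.2.1 / L) :=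
          if_pos ⟨hb, h⟩
        rw [this, ENNReal.toReal_ofReal, if_pos hb, one_mul, ← ofReal_mul]
        have := net.PRB_pos
        have := net.antBS.gain_nonneg k.2.2.1
        have := net.antMT.gain_nonneg k.2.2.2
        positivity
      · have : net.interferingPower x s (y, k) = 0 := if_neg fun h' => hb h'.1
        rw [this, if_neg hb]
        simp
    rw [integral_congr_ae hae, markLaw, integral_prod_mul
      (f := fun b : Bool => if b = true then (1 : ℂ) else 0), integral_activityLaw,
      net.integral_fading_gain s t L]
    simp
  · rw [indicator_of_notMem (show L ∉ Ioi x from h)]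
    have : ∀ k, net.interferingPower x s (y, k) = 0 := fun k => if_neg fun h' => h h'.2
    simp [this]

/-- The logarithm of the characteristic function of the interference from the state `r`. -/
theorem integral_interferingPower_eq_calT (r : S) {x t z T : ℝ} (hx : 0 < x)
    (ht : t * net.PRB = z * x * T / net.G0) :
    ∫ p, (cexp (t * (net.interferingPower x r p).toReal * I) - 1) ∂net.linkIntensity r =
      net.calT r (-(I * (z * T / net.G0 : ℝ))) x := by
  have hP := net.PRB_pos
  have hf := net.lintegral_interferingPower_ne_top r hx
  have hfm := net.measurable_interferingPower x r
  have hi : Integrable (fun p => cexp (t * (net.interferingPower x r p).toReal * I) - 1)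
      (net.linkIntensity r) := by
    refine ((integrable_toReal_of_lintegral_ne_top hfm.aemeasurable hf).const_mul |t|).mono'
      (Measurable.aestronglyMeasurable (by fun_prop)) (Filter.Eventually.of_forall fun p => ?_)
    have := IsPoissonProcess.norm_cexp_sub_one_le (t * (net.interferingPower x r p).toReal)
    rw [ofReal_mul] at this
    refine this.trans ?_
    rw [abs_mul, abs_of_nonneg ENNReal.toReal_nonneg]
  set τ := t * net.PRB with hτ
  set k : ℝ → ℂ := (Ioi x).indicator fun L : ℝ =>
    ((1 - net.pOff : ℝ) : ℂ) * net.markExponent r τ L with hk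
  set F : ℝ → ℂ := fun L => ((1 - net.pOff : ℝ) : ℂ) *
    (((Real.pi * net.lamBS * net.Theta r : ℝ) : ℂ) *
      ((lossKernel (net.κ r) (2 / net.α r) L : ℂ) * net.markExponent r τ L)) with hF
  have hFi : ∀ c, 0 < c → IntegrableOn F (Ioi c) := fun c hc =>
    ((net.integrableOn_markExponent r τ hc).const_mul _).const_mul _
  have hkm : Measurable k := by
    refine Measurable.indicator ?_ measurableSet_Ioi
    unfold markExponent
    fun_prop
  rw [linkIntensity, integral_prod _ (by exact hi)]
  simp_rw [net.integral_markLaw_interferingPower r hx]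
  rw [← integral_map (μ := net.locationIntensity r) (φ := fun y => net.κ r * ‖y‖ ^ net.α r)
    (f := k) (net.measurable_loss r).aemeasurable hkm.aestronglyMeasurable,
    map_locationIntensity, integral_withDensity_eq_integral_toReal_smul
      (net.measurable_LamHat' r).ennreal_ofReal
      (Filter.Eventually.of_forall fun _ => ENNReal.ofReal_lt_top)]
  -- Only path-losses beyond `x` interfere, and the density is the path-loss kernel times the band
  -- indicator `lossProb`.
  have h1 : ∫ L in Ioi 0, (ENNReal.ofReal (net.LamHat' r L)).toReal • k L =
      ∫ L in Ioi x, net.lossProb r L • F L := by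
    rw [← integral_indicator measurableSet_Ioi, ← integral_indicator measurableSet_Ioi]
    congr 1
    ext1 L
    by_cases hL : L ∈ Ioi x
    · have hL0 : 0 < L := hx.trans hL
      rw [indicator_of_mem (mem_Ioi.2 hL0), indicator_of_mem hL, hk, indicator_of_mem hL,
        ENNReal.toReal_ofReal (net.LamHat'_nonneg r hL0.le), LamHat'_eq, hF, real_smul, real_smul]
      push_cast
      ring
    · rw [indicator_of_notMem hL]
      refine indicator_apply_eq_zero.2 fun _ => ?_
      rw [hk, indicator_of_notMem hL, smul_zero]
  rw [h1, net.integral_lossProb_smul r (hFi x hx)]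
  set V : ℝ → ℂ := fun c => (Real.pi * net.lamI * net.Theta r : ℝ) *
      ((((c / net.κ r) ^ (2 / net.α r) : ℝ) : ℂ) *
        net.calF r (x * (-(I * (z * T / net.G0 : ℝ))) / c)) with hV
  have hVF : ∀ c, 0 < c → ∫ L in Ioi c, F L = V c := fun c hc => by
    simp only [hF, hV]
    rw [integral_const_mul, integral_const_mul, net.integral_markExponent r τ hc, lamI, ht]
    have : (x : ℂ) * (-(I * (z * T / net.G0 : ℝ))) / c = -(I * (z * x * T / net.G0 : ℝ) / c) := by
      push_cast
      ring
    rw [this]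
    push_cast
    ring
  rw [net.calT_eq r _ hx (V := V) fun c => rfl]
  simp only [hVF _ (lt_max_of_lt_left hx)]

end InterferingPower

end Network

/-! ### Comparison of two independent random variables -/

section Difference

open Complex

variable {Ω : Type*} [MeasurableSpace Ω] {P : Measure Ω} [IsProbabilityMeasure P]
  {γ : Measure ℝ} [IsProbabilityMeasure γ] {X : Ω → ℝ}

theorem charFun_map_sub (hX : Measurable X) (z : ℝ) :
    charFun ((P.prod γ).map fun p => X p.1 - p.2) z =
      (∫ ω, cexp (z * X ω * I) ∂P) * ∫ g, cexp (-z * g * I) ∂γ := by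
  have hm : Measurable fun p : Ω × ℝ => X p.1 - p.2 :=
    (hX.comp measurable_fst).sub measurable_snd
  rw [charFun_apply_real, integral_map hm.aemeasurable
    (Measurable.aestronglyMeasurable (by fun_prop)), ← integral_prod_mul]
  refine integral_congr_ae (Filter.Eventually.of_forall fun p => ?_)
  simp only
  rw [← Complex.exp_add]
  push_cast
  ring_nf

/-- From `|sin u| ≤ |u|`. It removes the singularity of `1 / z` at the origin in the inversion
formula. -/
theorem abs_im_charFun_le {ν : Measure ℝ} [IsProbabilityMeasure ν] (hν : Integrable id ν) (z : ℝ) :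
    |(charFun ν z).im| ≤ |z| * ∫ x, |x| ∂ν := by
  rw [im_charFun, ← integral_const_mul, ← Real.norm_eq_abs]
  refine norm_integral_le_of_norm_le (hν.abs.const_mul _) (Filter.Eventually.of_forall fun x => ?_)
  rw [Real.norm_eq_abs]
  change _ ≤ |z| * |x|
  rw [← abs_mul]
  exact Real.abs_sin_le_abs

theorem integrable_id_map_sub (hX : Measurable X) (hXi : Integrable X P) (hγ : Integrable id γ) :
    Integrable id ((P.prod γ).map fun p => X p.1 - p.2) := by
  have hm : Measurable fun p : Ω × ℝ => X p.1 - p.2 :=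
    (hX.comp measurable_fst).sub measurable_snd
  rw [integrable_map_measure measurable_id.aestronglyMeasurable hm.aemeasurable]
  exact (hXi.comp_fst γ).sub (hγ.comp_snd P)

theorem integral_abs_map_sub_le (hX : Measurable X) (hXi : Integrable X P)
    (hγ : Integrable id γ) :
    ∫ x, |x| ∂((P.prod γ).map fun p => X p.1 - p.2) ≤ ∫ ω, |X ω| ∂P + ∫ g, |g| ∂γ := by
  have hm : Measurable fun p : Ω × ℝ => X p.1 - p.2 :=
    (hX.comp measurable_fst).sub measurable_snd
  rw [integral_map hm.aemeasurable (by fun_prop)]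
  have h1 : Integrable (fun p : Ω × ℝ => |X p.1|) (P.prod γ) := hXi.abs.comp_fst γ
  have h2 : Integrable (fun p : Ω × ℝ => |p.2|) (P.prod γ) := hγ.abs.comp_snd P
  calc ∫ p, |X p.1 - p.2| ∂P.prod γ ≤ ∫ p, (|X p.1| + |p.2|) ∂P.prod γ :=
        integral_mono ((hXi.comp_fst γ).sub (hγ.comp_snd P)).abs (h1.add h2)
          fun p => abs_sub _ _
    _ = _ := by
        rw [integral_add h1 h2, integral_fun_fst fun ω => |X ω|, integral_fun_snd fun g => |g|]
        simp

/-- The probability that a random variable is at most an independent one with law `γ`. -/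
theorem lintegral_measure_le (hX : Measurable X) (hXi : Integrable X P) (hγ : Integrable id γ)
    (hat : ∀ x, γ {x} = 0) {φ : ℝ → ℂ} (hφ : ∀ z, φ z =
      (∫ ω, cexp (z * X ω * I) ∂P) * ∫ g, cexp (-z * g * I) ∂γ)
    (hint : IntegrableOn (fun z => (φ z).im / z) (Ioi 0)) :
    ∫⁻ g, P {ω | X ω ≤ g} ∂γ =
      ENNReal.ofReal (1 / 2 - (∫ z in Ioi (0 : ℝ), (φ z).im / z) / Real.pi) ∧
    0 ≤ 1 / 2 - (∫ z in Ioi (0 : ℝ), (φ z).im / z) / Real.pi := by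
  have hm : Measurable fun p : Ω × ℝ => X p.1 - p.2 :=
    (hX.comp measurable_fst).sub measurable_snd
  set ν := (P.prod γ).map fun p => X p.1 - p.2 with hν
  have : IsProbabilityMeasure ν := Measure.isProbabilityMeasure_map hm.aemeasurable
  have hφν : ∀ z, φ z = charFun ν z := fun z => by rw [hφ, charFun_map_sub hX]
  simp_rw [hφν] at hint ⊢
  -- The difference has no atom at `0`: for each `ω` it vanishes for a single value of `g`, of
  -- `γ`-measure zero.
  have h0 : ν {0} = 0 := by
    rw [hν, Measure.map_apply hm (measurableSet_singleton 0),
      Measure.prod_apply (hm (measurableSet_singleton 0)), lintegral_eq_zero_iff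
        (measurable_measure_prodMk_left (hm (measurableSet_singleton 0)))]
    refine Filter.Eventually.of_forall fun ω => measure_mono_null (fun g hg => ?_) (hat (X ω))
    have : X ω - g = 0 := hg
    exact (sub_eq_zero.1 this).symm
  rw [← gilPelaez (integrable_id_map_sub hX hXi hγ) hint h0, ofReal_measureReal]
  refine ⟨?_, measureReal_nonneg⟩
  rw [Measure.map_apply hm measurableSet_Iic,
    Measure.prod_apply_symm (hm measurableSet_Iic)]
  refine lintegral_congr fun g => ?_
  congr 1
  ext ω
  exact (sub_nonpos (a := X ω) (b := g)).symm

end Difference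

theorem integral_mergedMeasure {S E : Type*} [Fintype S] [MeasurableSpace S] [MeasurableSpace E]
    (μ : S → Measure E) {f : S × E → ℂ} (hf : Integrable f (mergedMeasure μ)) :
    ∫ p, f p ∂mergedMeasure μ = ∑ s, ∫ x, f (s, x) ∂μ s := by
  rw [mergedMeasure] at hf ⊢
  rw [integral_sum_measure hf, tsum_fintype]
  refine Finset.sum_congr rfl fun s _ => integral_map measurable_prodMk_left.aemeasurable ?_
  exact hf.aestronglyMeasurable.mono_measure (Measure.le_sum _ s)

/-! ### The superposed process of all links -/

namespace Network

section Joint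

open Complex

variable {S : Type*} [Fintype S] {B : ℕ} (net : Network S B)

/-- The path-loss of a link of any state. -/
noncomputable def jointLoss (q : S × Link) : ℝ := net.pathLoss q.1 q.2

theorem jointLoss_nonneg (q : S × Link) : 0 ≤ net.jointLoss q := net.pathLoss_nonneg _ _

/-- The power received over a link of any state, if its base station is active. -/
noncomputable def jointPower (q : S × Link) : ℝ≥0∞ :=
  if q.2.2.1 = true then ENNReal.ofReal (net.linkPower q.1 q.2) else 0

theorem indicator_jointPower (x : ℝ) (s : S) (p : Link) :
    {q | x < net.jointLoss q}.indicator net.jointPower (s, p) = net.interferingPower x s p := by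
  by_cases hx : x < net.pathLoss s p
  · rw [indicator_of_mem (show (s, p) ∈ {q | x < net.jointLoss q} from hx)]
    simp [jointPower, interferingPower, hx, linkPower]
  · rw [indicator_of_notMem (show (s, p) ∉ {q | x < net.jointLoss q} from hx)]
    simp [interferingPower, hx]

/-- All bands contribute nonnegatively, so only the unbounded last one is kept; before it begins,
the left side is nonpositive. The second alternative sets aside negative arguments. -/
theorem LamHat_lower_bound (s : S) (x : ℝ) :
    Real.pi * net.lamBS * net.Theta s * net.q s (Fin.last B) *
      ((x / net.κ s) ^ (2 / net.α s) - net.D (Fin.last B) ^ 2) ≤ net.LamHat s x ∨ x < 0 := by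
  refine or_iff_not_imp_right.2 fun hx => ?_
  have hx0 := not_lt.1 hx
  have hpi := Real.pi_pos
  have hl := net.lamBS_pos
  have hT := net.Theta_pos s
  have hκ := net.κ_pos s
  have hmono : ∀ b, net.lossAt s b ≤ x → 0 ≤ (x / net.κ s) ^ (2 / net.α s) - net.D b ^ 2 := by
    intro b hb
    rw [← net.lossAt_div_rpow s b, sub_nonneg]
    exact Real.rpow_le_rpow (div_nonneg (net.lossAt_nonneg s b) hκ.le) (by gcongr)
      (net.delta_pos s).le
  have hC : ∀ y, 0 ≤ heavC y := fun y => sub_nonneg.2 (heav_le_one y)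
  rw [LamHat]
  have h1 : 0 ≤ ∑ b : Fin B, net.q s b.castSucc * heavC (x - net.lossAt s b.succ) *
      heav (x - net.lossAt s b.castSucc) *
        ((x / net.κ s) ^ (2 / net.α s) - net.D b.castSucc ^ 2) := by
    refine Finset.sum_nonneg fun b _ => ?_
    rw [mul_assoc]
    refine mul_nonneg (mul_nonneg (net.q_nonneg _ _) (hC _)) ?_
    rcases lt_or_ge x (net.lossAt s b.castSucc) with h | h
    · rw [heav_of_lt h, zero_mul]
    · exact mul_nonneg (heav_nonneg _) (hmono _ h)
  have h2 : 0 ≤ ∑ b : Fin B, net.q s b.castSucc * heav (x - net.lossAt s b.succ) *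
      (net.D b.succ ^ 2 - net.D b.castSucc ^ 2) := by
    refine Finset.sum_nonneg fun b _ => mul_nonneg (mul_nonneg (net.q_nonneg _ _) (heav_nonneg _))
      (sub_nonneg.2 ?_)
    exact pow_le_pow_left₀ (net.D_nonneg _)
      (net.D_strictMono.monotone (Fin.castSucc_lt_succ).le) 2
  have h3 : (x / net.κ s) ^ (2 / net.α s) - net.D (Fin.last B) ^ 2 ≤
      heav (x - net.lossAt s (Fin.last B)) *
        ((x / net.κ s) ^ (2 / net.α s) - net.D (Fin.last B) ^ 2) := by
    rcases lt_or_ge x (net.lossAt s (Fin.last B)) with h | h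
    · rw [heav_of_lt h, zero_mul, ← net.lossAt_div_rpow s, sub_nonpos]
      exact Real.rpow_le_rpow (by positivity) (by gcongr) (net.delta_pos s).le
    · rw [heav_of_le h, one_mul]
  have hA : 0 ≤ Real.pi * net.lamBS * net.Theta s := by positivity
  have hq := net.q_nonneg s (Fin.last B)
  calc _ ≤ 0 + 0 + Real.pi * net.lamBS * net.Theta s * net.q s (Fin.last B) *
        (heav (x - net.lossAt s (Fin.last B)) *
          ((x / net.κ s) ^ (2 / net.α s) - net.D (Fin.last B) ^ 2)) := by
        rw [zero_add, zero_add]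
        exact mul_le_mul_of_nonneg_left h3 (mul_nonneg hA hq)
    _ ≤ _ := by
        rw [← mul_assoc]
        exact add_le_add_left (add_le_add (mul_nonneg hA h1) (mul_nonneg hA h2)) _

theorem exists_q_last_pos : ∃ s, 0 < net.q s (Fin.last B) := by
  by_contra! h
  exact absurd net.q_last_pos (not_lt.2 (Finset.sum_nonpos fun s _ => h s))

/-- The intensity of the path-losses grows at least like a power. -/
theorem exists_LamHat_lower_bound : ∃ δ c C : ℝ, 0 < δ ∧ 0 < c ∧
    ∀ x, 0 ≤ x → c * x ^ δ - C ≤ ∑ r, net.LamHat r x := by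
  obtain ⟨s, hs⟩ := net.exists_q_last_pos
  have hpi := Real.pi_pos
  have hl := net.lamBS_pos
  have hT := net.Theta_pos s
  have hκ := net.κ_pos s
  set A := Real.pi * net.lamBS * net.Theta s * net.q s (Fin.last B) with hA
  refine ⟨2 / net.α s, A / net.κ s ^ (2 / net.α s), A * net.D (Fin.last B) ^ 2, net.delta_pos s,
    by positivity, fun x hx => ?_⟩
  refine le_trans ?_ (Finset.single_le_sum (f := fun r => net.LamHat r x)
    (fun r _ => net.LamHat_nonneg r hx) (Finset.mem_univ s))
  have := (net.LamHat_lower_bound s x).resolve_right (not_lt.2 hx)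
  rw [← hA, mul_sub, Real.div_rpow hx hκ.le, mul_div_assoc'] at this
  rwa [div_mul_eq_mul_div]

variable [MeasurableSpace S]

/-- The intensity measure of the links of all states. -/
noncomputable def jointIntensity : Measure (S × Link) := mergedMeasure net.linkIntensity

variable [MeasurableSingletonClass S]

theorem measurable_jointLoss : Measurable net.jointLoss :=
  measurable_from_prod_countable_right fun s => net.measurable_pathLoss s

theorem measurable_jointPower : Measurable net.jointPower :=
  measurable_from_prod_countable_right fun s => Measurable.ite
    ((measurable_fst.comp measurable_snd) (measurableSet_singleton true))
    (net.measurable_linkPower s).ennreal_ofReal measurable_const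

theorem measurable_indicator_jointPower (x : ℝ) :
    Measurable ({q | x < net.jointLoss q}.indicator net.jointPower) :=
  net.measurable_jointPower.indicator (net.measurable_jointLoss measurableSet_Ioi)

theorem jointIntensity_le {x : ℝ} (hx : 0 ≤ x) :
    net.jointIntensity {q | net.jointLoss q ≤ x} = ENNReal.ofReal (∑ r, net.LamHat r x) := by
  have hm : MeasurableSet {q | net.jointLoss q ≤ x} := net.measurable_jointLoss measurableSet_Iic
  rw [jointIntensity, mergedMeasure_apply _ hm,
    ENNReal.ofReal_sum_of_nonneg fun r _ => net.LamHat_nonneg r hx]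
  exact Finset.sum_congr rfl fun r _ => net.linkIntensity_pathLoss_le r hx

theorem jointIntensity_real_le {x : ℝ} (hx : 0 ≤ x) :
    net.jointIntensity.real {q | net.jointLoss q ≤ x} = ∑ r, net.LamHat r x := by
  rw [measureReal_def, jointIntensity_le _ hx,
    ENNReal.toReal_ofReal (Finset.sum_nonneg fun r _ => net.LamHat_nonneg r hx)]

theorem jointIntensity_le_ne_top (x : ℝ) :
    net.jointIntensity {q | net.jointLoss q ≤ x} ≠ ∞ := by
  have hsub : {q | net.jointLoss q ≤ x} ⊆ {q | net.jointLoss q ≤ max x 0} :=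
    fun q (hq : net.jointLoss q ≤ x) => hq.trans (le_max_left _ _)
  refine ne_top_of_le_ne_top ?_ (measure_mono hsub)
  rw [jointIntensity_le _ (le_max_right _ _)]
  exact ENNReal.ofReal_ne_top

theorem jointIntensity_eq (x : ℝ) : net.jointIntensity {q | net.jointLoss q = x} = 0 := by
  have hm : MeasurableSet {q | net.jointLoss q = x} :=
    net.measurable_jointLoss (measurableSet_singleton x)
  rw [jointIntensity, mergedMeasure_apply _ hm]
  exact Finset.sum_eq_zero fun r _ => net.linkIntensity_pathLoss_eq r x

/-- The power growth comes from a state of positive probability at large distances; it guarantees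
that some base station serves almost surely. -/
theorem jointIntensity_univ : net.jointIntensity univ = ∞ := by
  obtain ⟨δ, c, C, hδ, hc, h⟩ := net.exists_LamHat_lower_bound
  by_contra hne
  have h1 : ∀ x, 0 ≤ x → c * x ^ δ - C ≤ (net.jointIntensity univ).toReal := fun x hx => by
    refine (h x hx).trans ?_
    rw [← net.jointIntensity_real_le hx]
    exact ENNReal.toReal_mono hne (measure_mono (subset_univ _))
  have h2 := (Filter.tendsto_atTop_add_const_right _ (-C)
    ((tendsto_rpow_atTop hδ).const_mul_atTop hc)).eventually_gt_atTop
      (net.jointIntensity univ).toReal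
  obtain ⟨x, hx, hx0⟩ := (h2.and (Filter.eventually_ge_atTop 0)).exists
  linarith [h1 x hx0]

theorem lintegral_jointPower (x : ℝ) :
    ∫⁻ q, {q | x < net.jointLoss q}.indicator net.jointPower q ∂net.jointIntensity =
      ∑ s, ∫⁻ p, net.interferingPower x s p ∂net.linkIntensity s := by
  rw [jointIntensity, lintegral_mergedMeasure _ (net.measurable_indicator_jointPower x)]
  simp_rw [indicator_jointPower]

/-- For exponents `δ` in `(0, 1)`, `x ^ δ ≤ 1 + x`, which gives one bound for all states. After
multiplication by the serving path-loss `x` it grows linearly. -/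
theorem exists_lintegral_jointPower_le : ∃ C : ℝ, 0 ≤ C ∧ ∀ x, 0 < x →
    ∫⁻ q, {q | x < net.jointLoss q}.indicator net.jointPower q ∂net.jointIntensity ≤
      ENNReal.ofReal (C * (1 + x) / x) := by
  choose C hC0 hC using net.exists_lintegral_interferingPower_le
  refine ⟨∑ s, C s, Finset.sum_nonneg fun s _ => hC0 s, fun x hx => ?_⟩
  rw [lintegral_jointPower, Finset.sum_mul, Finset.sum_div, ENNReal.ofReal_sum_of_nonneg]
  · refine Finset.sum_le_sum fun s _ => (hC s x hx).trans (ENNReal.ofReal_le_ofReal ?_)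
    rw [mul_div_assoc, Real.rpow_sub_one hx.ne']
    have : x ^ (2 / net.α s) ≤ 1 + x := by
      rcases le_total x 1 with h | h
      · exact (Real.rpow_le_one hx.le h (net.delta_pos s).le).trans (by linarith)
      · exact (Real.rpow_le_rpow_of_exponent_le h (net.delta_lt_one s).le).trans (by
          rw [Real.rpow_one]; linarith)
    have := hC0 s
    gcongr
  · intro s _
    have := hC0 s
    positivity

theorem lintegral_jointPower_ne_top {x : ℝ} (hx : 0 < x) :
    ∫⁻ q, {q | x < net.jointLoss q}.indicator net.jointPower q ∂net.jointIntensity ≠ ∞ := by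
  obtain ⟨C, -, hC⟩ := net.exists_lintegral_jointPower_le
  exact ne_top_of_le_ne_top ENNReal.ofReal_ne_top (hC x hx)

variable {Ω : Type*}

/-- The interference if the serving link has path-loss `x`. -/
noncomputable def totalPower (Φ : S → Ω → Set Link) (x : ℝ) (ω : Ω) : ℝ≥0∞ :=
  ∫⁻ q, {q | x < net.jointLoss q}.indicator net.jointPower q ∂pointMeasure (mergedSet Φ ω)

theorem totalPower_eq (Φ : S → Ω → Set Link) (x : ℝ) (ω : Ω) :
    net.totalPower Φ x ω = net.interference (fun s => Φ s ω) x := by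
  rw [totalPower, lintegral_pointMeasure _ (net.measurable_indicator_jointPower x),
    tsum_mergedSet, interference]
  simp_rw [indicator_jointPower]

variable [MeasurableSpace Ω] {P : Measure Ω} [IsProbabilityMeasure P] {Φ : S → Ω → Set Link}

theorem IsRealization.merged {net : Network S B} (hΦ : net.IsRealization P Φ) :
    IsPoissonProcess (mergedSet Φ) net.jointIntensity P :=
  isPoissonProcess_mergedSet hΦ.poisson hΦ.indep

theorem IsRealization.measurable_totalPower {net : Network S B} (hΦ : net.IsRealization P Φ)
    (x : ℝ) : Measurable (net.totalPower Φ x) :=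
  hΦ.merged.measurable_lintegral (net.measurable_indicator_jointPower x)

theorem IsRealization.lintegral_totalPower {net : Network S B} (hΦ : net.IsRealization P Φ)
    (x : ℝ) : ∫⁻ ω, net.totalPower Φ x ω ∂P =
      ∫⁻ q, {q | x < net.jointLoss q}.indicator net.jointPower q ∂net.jointIntensity :=
  hΦ.merged.lintegral_lintegral (net.measurable_indicator_jointPower x)

/-- The characteristic function of the interference. -/
theorem IsRealization.integral_cexp_totalPower {net : Network S B} (hΦ : net.IsRealization P Φ)
    {x t z T : ℝ} (hx : 0 < x) (ht : t * net.PRB = z * x * T / net.G0) :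
    ∫ ω, cexp (t * (net.totalPower Φ x ω).toReal * I) ∂P =
      net.interferenceMGF (-(I * (z * T / net.G0 : ℝ))) x := by
  have hfm : Measurable ({q | x < net.jointLoss q}.indicator net.jointPower) :=
    net.measurable_indicator_jointPower x
  have hf := net.lintegral_jointPower_ne_top hx
  have h1 := hΦ.merged.integral_cexp_lintegral hfm hf t
  have hi : Integrable (fun q => cexp (t * (({q | x < net.jointLoss q}.indicator
      net.jointPower q)).toReal * I) - 1) net.jointIntensity := by
    refine ((integrable_toReal_of_lintegral_ne_top hfm.aemeasurable hf).const_mul |t|).mono'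
      (Measurable.aestronglyMeasurable (by fun_prop)) (Filter.Eventually.of_forall fun p => ?_)
    have := IsPoissonProcess.norm_cexp_sub_one_le
      (t * ({q | x < net.jointLoss q}.indicator net.jointPower p).toReal)
    rw [ofReal_mul] at this
    refine this.trans ?_
    rw [abs_mul, abs_of_nonneg ENNReal.toReal_nonneg]
  refine h1.trans ?_
  rw [interferenceMGF]
  congr 1
  rw [jointIntensity, integral_mergedMeasure _ hi]
  refine Finset.sum_congr rfl fun r _ => ?_
  simp_rw [indicator_jointPower]
  exact net.integral_interferingPower_eq_calT r hx ht

end Joint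

end Network

/-! ### Bounds for the integrand and absolute convergence -/

namespace Network

section Bounds

open Complex

variable {S : Type*} [Fintype S] {B : ℕ} (net : Network S B)

/-- The complex factor of the integrand. -/
noncomputable def sinrFactor (T : ℝ) (s : S) (x z : ℝ) : ℂ :=
  cexp (I * (z * x * net.noise * T / (net.G0 * net.PRB) : ℝ)) * net.fadingMGF s (I * z) *
    net.interferenceMGF (-(I * (z * T / net.G0 : ℝ))) x

theorem integrand_eq (T : ℝ) (s : S) (x z : ℝ) :
    net.integrand T s x z = net.ell s x * ((net.sinrFactor T s x z).im / z) := by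
  rw [integrand, sinrFactor]
  ring

/-- Nothing is known of `gaussHyp` on the cut, but the arguments stay on the imaginary axis, where
it is continuous. -/
theorem measurable_calF (s : S) : Measurable fun y : ℝ => net.calF s (-(I * y)) := by
  have h : Continuous fun y : ℝ => net.calF s (-(I * y)) := by
    have he : ∀ y : ℝ, net.calF s (-(I * y)) = net.calF s (-(I * y / (1 : ℝ))) := fun y => by simp
    simp_rw [he, net.calF_eq s]
    refine continuous_finsetSum _ fun k _ => continuous_finsetSum _ fun l _ =>
      continuous_const.mul (continuous_const.sub ?_)
    refine (continuousOn_gaussHyp (net.delta_pos s) (net.delta_lt_one s)).comp_continuous ?_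
      fun y => net.lobeRate_div_mem_cutPlane s y 1 k l
    unfold lobeRate
    fun_prop
  exact h.measurable

theorem measurable_calF_comp (s : S) {α : Type*} [MeasurableSpace α] {f : α → ℝ}
    (hf : Measurable f) : Measurable fun y => net.calF s (-(I * f y)) :=
  (net.measurable_calF s).comp hf

theorem measurable_heav_sub (c : ℝ) : Measurable fun p : ℝ × ℝ => heav (p.1 - c) :=
  measurable_heav.comp (measurable_fst.sub_const c)

theorem measurable_heavC_sub (c : ℝ) : Measurable fun p : ℝ × ℝ => heavC (p.1 - c) :=
  (measurable_heav_sub c).const_sub 1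

theorem measurable_calT (r : S) (T : ℝ) : Measurable fun p : ℝ × ℝ =>
    net.calT r (-(I * (p.2 * T / net.G0 : ℝ))) p.1 := by
  have h1 : ∀ (p : ℝ × ℝ) (c : ℝ), (p.1 : ℂ) * (-(I * (p.2 * T / net.G0 : ℝ))) / c =
      -(I * (p.1 * (p.2 * T / net.G0) / c : ℝ)) := fun p c => by
    push_cast
    ring
  simp only [calT, h1]
  have h2 : ∀ c : ℝ, Measurable fun p : ℝ × ℝ =>
      net.calF r (-(I * (p.1 * (p.2 * T / net.G0) / c : ℝ))) := fun c =>
    net.measurable_calF_comp r (by fun_prop)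
  have h3 : Measurable fun p : ℝ × ℝ => net.calF r (-(I * (p.2 * T / net.G0 : ℝ))) :=
    net.measurable_calF_comp r (by fun_prop)
  have h4 := measurable_heav_sub
  have h5 := measurable_heavC_sub
  fun_prop

theorem measurable_sinrFactor (T : ℝ) (s : S) :
    Measurable fun p : ℝ × ℝ => net.sinrFactor T s p.1 p.2 := by
  have h1 := fun r => net.measurable_calT r T
  simp only [sinrFactor, interferenceMGF, fadingMGF]
  fun_prop

theorem measurable_LamHat (s : S) : Measurable (net.LamHat s) := by
  have h4 : ∀ c, Measurable fun x : ℝ => heav (x - c) := fun c =>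
    measurable_heav.comp (measurable_id.sub_const c)
  have h5 : ∀ c, Measurable fun x : ℝ => heavC (x - c) := fun c => (h4 c).const_sub 1
  unfold LamHat
  fun_prop

theorem measurable_ell (s : S) : Measurable (net.ell s) := by
  have h1 := net.measurable_LamHat' s
  have h2 := net.measurable_LamHat
  unfold ell
  fun_prop

theorem ell_nonneg (s : S) {x : ℝ} (hx : 0 ≤ x) : 0 ≤ net.ell s x :=
  mul_nonneg (net.LamHat'_nonneg s hx) (Real.exp_pos _).le

/-- The exponential factor is at most a constant times `exp (-c x ^ δ)`, which beats the linear
weight at infinity. At `0` the power `x ^ (2 / α - 1)` is integrable. -/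
theorem integrableOn_one_add_mul_ell (s : S) :
    IntegrableOn (fun x => (1 + x) * net.ell s x) (Ioi 0) := by
  obtain ⟨δ, c, C, hδ, hc, h⟩ := net.exists_LamHat_lower_bound
  have hpi := Real.pi_pos
  have hl := net.lamBS_pos
  have hT := net.Theta_pos s
  have hκ := net.κ_pos s
  have hδs := net.delta_pos s
  have hQ : 0 ≤ ∑ b, net.q s b := Finset.sum_nonneg fun b _ => net.q_nonneg s b
  set A := Real.pi * net.lamBS * net.Theta s * (2 / net.α s * net.κ s ^ (-(2 / net.α s))) *
    (∑ b, net.q s b) * Real.exp C with hA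
  have hA0 : 0 ≤ A := by positivity
  have hi : IntegrableOn (fun x : ℝ => A * (x ^ (2 / net.α s - 1) * Real.exp (-c * x ^ δ) +
      x ^ (2 / net.α s) * Real.exp (-c * x ^ δ))) (Ioi 0) :=
    ((integrableOn_rpow_mul_exp_neg_mul_rpow (by linarith) hδ hc).add
      (integrableOn_rpow_mul_exp_neg_mul_rpow (by linarith) hδ hc)).const_mul A
  refine Integrable.mono' hi (Measurable.aestronglyMeasurable
    ((measurable_id.const_add 1).mul (net.measurable_ell s))) ?_
  filter_upwards [ae_restrict_mem measurableSet_Ioi] with x hx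
  have hx0 : (0 : ℝ) < x := hx
  have hk := lossKernel_nonneg hκ hδs hx0.le
  have h1 : net.ell s x ≤ A * (x ^ (2 / net.α s - 1) * Real.exp (-c * x ^ δ)) := by
    have e1 : Real.exp (-∑ r, net.LamHat r x) ≤ Real.exp C * Real.exp (-c * x ^ δ) := by
      rw [← Real.exp_add]
      exact Real.exp_le_exp.2 (by linarith [h x hx0.le])
    calc net.ell s x = Real.pi * net.lamBS * net.Theta s *
          lossKernel (net.κ s) (2 / net.α s) x * net.lossProb s x *
            Real.exp (-∑ r, net.LamHat r x) := by rw [ell, LamHat'_eq]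
      _ ≤ Real.pi * net.lamBS * net.Theta s * lossKernel (net.κ s) (2 / net.α s) x *
            (∑ b, net.q s b) * (Real.exp C * Real.exp (-c * x ^ δ)) := by
          gcongr
          exact net.lossProb_le s x
      _ = _ := by
          rw [lossKernel, hA]
          ring
  have h2 : x ^ (2 / net.α s) = x * x ^ (2 / net.α s - 1) := by
    rw [Real.rpow_sub_one hx0.ne']
    field_simp
  rw [Real.norm_of_nonneg (mul_nonneg (by linarith) (net.ell_nonneg s hx0.le)), h2]
  calc (1 + x) * net.ell s x ≤ (1 + x) * (A * (x ^ (2 / net.α s - 1) * Real.exp (-c * x ^ δ))) := by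
        gcongr
    _ = _ := by ring

theorem integrableOn_ell (s : S) : IntegrableOn (net.ell s) (Ioi 0) := by
  refine Integrable.mono' (net.integrableOn_one_add_mul_ell s)
    (net.measurable_ell s).aestronglyMeasurable ?_
  filter_upwards [ae_restrict_mem measurableSet_Ioi] with x hx
  have hx0 : (0 : ℝ) < x := hx
  have := net.ell_nonneg s hx0.le
  rw [Real.norm_of_nonneg this]
  nlinarith

/-- The decay of the integrand in the frequency. -/
noncomputable def frequencyBound (s : S) (z : ℝ) : ℝ :=
  (Iic 1).indicator (fun _ => 1) z + (Ioi 1).indicator (fun z => z ^ (-net.m s - 1)) z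

theorem integrableOn_frequencyBound (s : S) : IntegrableOn (net.frequencyBound s) (Ioi 0) := by
  have hm := net.m_pos s
  have h1 : IntegrableOn ((Iic (1 : ℝ)).indicator (fun _ => (1 : ℝ))) (Ioi 0) := by
    rw [integrableOn_indicator_iff measurableSet_Iic, inter_comm, Ioi_inter_Iic]
    exact integrableOn_const (by simp)
  have h2 : IntegrableOn ((Ioi (1 : ℝ)).indicator fun z : ℝ => z ^ (-net.m s - 1)) (Ioi 0) := by
    rw [integrableOn_indicator_iff measurableSet_Ioi]
    exact (integrableOn_Ioi_rpow_of_lt (by linarith) one_pos).mono_set inter_subset_left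
  exact h1.add h2

/-- The modulus of `1 + I y` is at least its imaginary part `y`, and the exponent `-m` is negative.
-/
theorem norm_fadingMGF_le (s : S) {z : ℝ} (hz : 0 < z) :
    ‖net.fadingMGF s (I * z)‖ ≤ (net.Om s / net.m s) ^ (-net.m s) * z ^ (-net.m s) := by
  have hm := net.m_pos s
  have hO := net.Om_pos s
  rw [fadingMGF, ← ofReal_neg, norm_cpow_real, ← Real.mul_rpow (by positivity) hz.le]
  refine Real.rpow_le_rpow_of_nonpos (by positivity) ?_ (by linarith)
  have h1 : (1 + I * z * net.Om s / net.m s : ℂ).im = net.Om s / net.m s * z := by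
    have : (1 + I * z * net.Om s / net.m s : ℂ) = (1 : ℝ) + (net.Om s / net.m s * z : ℝ) * I := by
      push_cast
      ring
    rw [this]
    simp
  rw [← h1]
  exact (le_abs_self _).trans (abs_im_le_norm _)

variable [MeasurableSpace S] [MeasurableSingletonClass S] {Ω : Type*} [MeasurableSpace Ω]
  {P : Measure Ω} [IsProbabilityMeasure P] {Φ : S → Ω → Set Link} {net}

/-- The noise and the interference, in units of the gain that is required of the serving link. -/
noncomputable def requiredGain (net : Network S B) (Φ : S → Ω → Set Link) (T x : ℝ) (ω : Ω) : ℝ :=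
  x * T / (net.G0 * net.PRB) * (net.noise + (net.totalPower Φ x ω).toReal)

theorem IsRealization.measurable_requiredGain (hΦ : net.IsRealization P Φ) (T x : ℝ) :
    Measurable (net.requiredGain Φ T x) :=
  ((hΦ.measurable_totalPower x).ennreal_toReal.const_add _).const_mul _

theorem IsRealization.integrable_totalPower (hΦ : net.IsRealization P Φ) {x : ℝ} (hx : 0 < x) :
    Integrable (fun ω => (net.totalPower Φ x ω).toReal) P := by
  refine integrable_toReal_of_lintegral_ne_top (hΦ.measurable_totalPower x).aemeasurable ?_
  rw [hΦ.lintegral_totalPower]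
  exact net.lintegral_jointPower_ne_top hx

theorem IsRealization.integrable_requiredGain (hΦ : net.IsRealization P Φ) (T : ℝ) {x : ℝ}
    (hx : 0 < x) : Integrable (net.requiredGain Φ T x) P :=
  ((integrable_const _).add (hΦ.integrable_totalPower hx)).const_mul _

/-- The noise is deterministic and gives the phase; the scaling of `requiredGain` turns the
frequency `z` into `z x T / (G0 * PRB)` for the interference. The product is the characteristic
function of required gain minus fading. -/
theorem IsRealization.sinrFactor_eq (hΦ : net.IsRealization P Φ) (T : ℝ) (s : S) {x : ℝ}
    (hx : 0 < x) (z : ℝ) : net.sinrFactor T s x z =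
      (∫ ω, cexp (z * net.requiredGain Φ T x ω * I) ∂P) *
        ∫ g, cexp (-z * g * I) ∂gammaMeasure (net.m s) (net.m s / net.Om s) := by
  have hG := net.G0_pos.ne'
  have hP := net.PRB_pos.ne'
  have h1 : ∀ ω, cexp (z * net.requiredGain Φ T x ω * I) =
      cexp (I * (z * x * net.noise * T / (net.G0 * net.PRB) : ℝ)) *
        cexp ((z * x * T / (net.G0 * net.PRB) : ℝ) * (net.totalPower Φ x ω).toReal * I) := by
    intro ω
    rw [← Complex.exp_add, requiredGain]
    congr 1
    push_cast
    ring
  simp_rw [h1]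
  rw [integral_const_mul, hΦ.integral_cexp_totalPower (T := T) (z := z) hx (by field_simp),
    ← fadingMGF_eq, sinrFactor]
  ring

theorem IsRealization.norm_sinrFactor_le (hΦ : net.IsRealization P Φ) (T : ℝ) (s : S) {x : ℝ}
    (hx : 0 < x) (z : ℝ) : ‖net.sinrFactor T s x z‖ ≤ ‖net.fadingMGF s (I * z)‖ := by
  rw [hΦ.sinrFactor_eq T s hx, ← fadingMGF_eq, norm_mul]
  refine mul_le_of_le_one_left (norm_nonneg _) ?_
  refine (norm_integral_le_integral_norm _).trans ?_
  have : ∀ ω, ‖cexp (z * net.requiredGain Φ T x ω * I)‖ = 1 := fun ω => by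
    rw [← ofReal_mul, norm_exp_ofReal_mul_I]
  simp [this]

theorem IsRealization.exists_integral_requiredGain_le (hΦ : net.IsRealization P Φ) {T : ℝ}
    (hT : 0 < T) : ∃ K, 0 ≤ K ∧ ∀ x, 0 < x → ∫ ω, |net.requiredGain Φ T x ω| ∂P ≤ K * (1 + x) := by
  obtain ⟨C, hC0, hC⟩ := net.exists_lintegral_jointPower_le
  have hG := net.G0_pos
  have hP := net.PRB_pos
  have hN := net.noise_nonneg
  refine ⟨T / (net.G0 * net.PRB) * (net.noise + C), by positivity, fun x hx => ?_⟩
  have h1 : ∀ ω, |net.requiredGain Φ T x ω| = x * T / (net.G0 * net.PRB) *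
      (net.noise + (net.totalPower Φ x ω).toReal) := fun ω =>
    abs_of_nonneg (by unfold requiredGain; positivity)
  have h2 : ∫ ω, (net.totalPower Φ x ω).toReal ∂P ≤ C * (1 + x) / x := by
    rw [integral_toReal (hΦ.measurable_totalPower x).aemeasurable, hΦ.lintegral_totalPower]
    · exact ENNReal.toReal_le_of_le_ofReal (by positivity) (hC x hx)
    · refine ae_lt_top (hΦ.measurable_totalPower x) ?_
      rw [hΦ.lintegral_totalPower]
      exact net.lintegral_jointPower_ne_top hx
  simp_rw [h1]
  rw [integral_const_mul, integral_add (integrable_const _) (hΦ.integrable_totalPower hx)]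
  simp only [integral_const, probReal_univ, one_smul]
  calc x * T / (net.G0 * net.PRB) * (net.noise + ∫ ω, (net.totalPower Φ x ω).toReal ∂P)
      ≤ x * T / (net.G0 * net.PRB) * (net.noise + C * (1 + x) / x) := by gcongr
    _ = T / (net.G0 * net.PRB) * (net.noise * x + C * (1 + x)) := by
        field_simp
    _ ≤ T / (net.G0 * net.PRB) * (net.noise * (1 + x) + C * (1 + x)) := by
        gcongr
        linarith
    _ = _ := by ring

/-- For `z ≤ 1` the first absolute moment of the difference is used, for `z > 1` the decay of
`fadingMGF`. The constant adds those of both regimes. -/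
theorem IsRealization.exists_abs_im_sinrFactor_le (hΦ : net.IsRealization P Φ) {T : ℝ}
    (hT : 0 < T) (s : S) : ∃ K, 0 ≤ K ∧ ∀ x, 0 < x → ∀ z, 0 < z →
      |(net.sinrFactor T s x z).im / z| ≤ K * (1 + x) * net.frequencyBound s z := by
  obtain ⟨K, hK0, hK⟩ := hΦ.exists_integral_requiredGain_le hT
  have := net.isProbabilityMeasure_fadingLaw s
  have hm := net.m_pos s
  have hO := net.Om_pos s
  have hγ := integrable_id_gammaMeasure hm (div_pos hm hO)
  set M := ∫ g, |g| ∂gammaMeasure (net.m s) (net.m s / net.Om s) with hM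
  have hM0 : 0 ≤ M := integral_nonneg fun g => abs_nonneg g
  have hR : 0 ≤ (net.Om s / net.m s) ^ (-net.m s) := by positivity
  refine ⟨K + M + (net.Om s / net.m s) ^ (-net.m s), by positivity, fun x hx z hz => ?_⟩
  rw [abs_div, abs_of_pos hz, frequencyBound]
  rcases le_or_gt z 1 with h1 | h1
  · rw [indicator_of_mem (mem_Iic.2 h1), indicator_of_notMem (notMem_Ioi.2 h1), add_zero, mul_one]
    have hXm := hΦ.measurable_requiredGain T x
    have hXi := hΦ.integrable_requiredGain T hx
    have hp : IsProbabilityMeasure ((P.prod (gammaMeasure (net.m s) (net.m s / net.Om s))).map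
        fun p => net.requiredGain Φ T x p.1 - p.2) :=
      Measure.isProbabilityMeasure_map
        ((hXm.comp measurable_fst).sub measurable_snd).aemeasurable
    rw [hΦ.sinrFactor_eq T s hx, ← charFun_map_sub hXm, div_le_iff₀ hz]
    refine (abs_im_charFun_le (integrable_id_map_sub hXm hXi hγ) z).trans ?_
    rw [abs_of_pos hz, mul_comm]
    refine mul_le_mul_of_nonneg_right ?_ hz.le
    refine (integral_abs_map_sub_le hXm hXi hγ).trans ?_
    rw [← hM]
    have := hK x hx
    nlinarith [mul_nonneg hR hx.le, mul_nonneg hM0 hx.le]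
  · rw [indicator_of_notMem (notMem_Iic.2 h1), indicator_of_mem (mem_Ioi.2 h1), zero_add]
    have h2 := (abs_im_le_norm (net.sinrFactor T s x z)).trans
      ((hΦ.norm_sinrFactor_le T s hx z).trans (net.norm_fadingMGF_le s hz))
    rw [Real.rpow_sub_one hz.ne', mul_div_assoc']
    refine div_le_div_of_nonneg_right (h2.trans ?_) hz.le
    refine mul_le_mul_of_nonneg_right ?_ (Real.rpow_nonneg hz.le _)
    nlinarith [mul_nonneg hR hx.le, mul_nonneg (add_nonneg hK0 hM0) hx.le]

theorem IsRealization.integrableOn_im_sinrFactor (hΦ : net.IsRealization P Φ) {T : ℝ}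
    (hT : 0 < T) (s : S) {x : ℝ} (hx : 0 < x) :
    IntegrableOn (fun z => (net.sinrFactor T s x z).im / z) (Ioi 0) := by
  obtain ⟨K, -, hK⟩ := hΦ.exists_abs_im_sinrFactor_le hT s
  refine ((net.integrableOn_frequencyBound s).const_mul (K * (1 + x))).mono' ?_ ?_
  · have h : Measurable fun z => net.sinrFactor T s x z :=
      Measurable.comp (g := fun p : ℝ × ℝ => net.sinrFactor T s p.1 p.2) (f := fun z => (x, z))
        (net.measurable_sinrFactor T s) measurable_prodMk_left
    exact ((Complex.measurable_im.comp h).div measurable_id).aestronglyMeasurable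
  · filter_upwards [ae_restrict_mem measurableSet_Ioi] with z hz
    exact hK x hx z hz

/-- The majorant factorizes into a function of `x` and a function of `z`, each integrable. -/
theorem IsRealization.integrableOn_integrand (hΦ : net.IsRealization P Φ) {T : ℝ}
    (hT : 0 < T) (s : S) : IntegrableOn (fun p : ℝ × ℝ => net.integrand T s p.1 p.2)
      (Ioi (0 : ℝ) ×ˢ Ioi (0 : ℝ)) := by
  obtain ⟨K, -, hK⟩ := hΦ.exists_abs_im_sinrFactor_le hT s
  have h1 : Integrable (fun p : ℝ × ℝ => K * ((1 + p.1) * net.ell s p.1 *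
      net.frequencyBound s p.2)) ((volume.restrict (Ioi 0)).prod (volume.restrict (Ioi 0))) :=
    (Integrable.mul_prod (f := fun x => (1 + x) * net.ell s x) (g := net.frequencyBound s)
      (net.integrableOn_one_add_mul_ell s) (net.integrableOn_frequencyBound s)).const_mul K
  rw [Measure.prod_restrict] at h1
  refine Integrable.mono' h1 (Measurable.aestronglyMeasurable ?_) ?_
  · simp_rw [integrand_eq]
    exact ((net.measurable_ell s).comp measurable_fst).mul
      ((Complex.measurable_im.comp (net.measurable_sinrFactor T s)).div measurable_snd)
  · have := ae_restrict_mem (μ := (volume : Measure (ℝ × ℝ)))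
      ((measurableSet_Ioi (a := (0 : ℝ))).prod (measurableSet_Ioi (a := (0 : ℝ))))
    filter_upwards [this] with p hp
    have hx : 0 < p.1 := hp.1
    rw [integrand_eq, norm_mul, Real.norm_of_nonneg (net.ell_nonneg s hx.le)]
    have h2 := mul_le_mul_of_nonneg_left (hK p.1 hx p.2 hp.2) (net.ell_nonneg s hx.le)
    rw [Real.norm_eq_abs]
    refine h2.trans_eq ?_
    ring

end Bounds

end Network

/-! ### The coverage probability -/

namespace Network

section Coverage

variable {S : Type*} [Fintype S] {B : ℕ} (net : Network S B)

theorem lintegral_pathLoss_fading (s : S) {H : ℝ × ℝ → ℝ≥0∞} (hH : Measurable H) :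
    ∫⁻ p, H (net.pathLoss s p, p.2.2.1) ∂net.linkIntensity s =
      ∫⁻ x in Ioi 0, ENNReal.ofReal (net.LamHat' s x) *
        ∫⁻ g, H (x, g) ∂gammaMeasure (net.m s) (net.m s / net.Om s) := by
  have := net.isProbabilityMeasure_fadingLaw s
  have h1 : MeasurePreserving Prod.snd (net.markLaw s)
      ((gammaMeasure (net.m s) (net.m s / net.Om s)).prod (angleLaw.prod angleLaw)) :=
    measurePreserving_snd
  have h2 : MeasurePreserving Prod.fst ((gammaMeasure (net.m s) (net.m s / net.Om s)).prod
      (angleLaw.prod angleLaw)) (gammaMeasure (net.m s) (net.m s / net.Om s)) :=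
    measurePreserving_fst
  have h3 : ∀ x, ∫⁻ k, H (x, k.2.1) ∂net.markLaw s =
      ∫⁻ g, H (x, g) ∂gammaMeasure (net.m s) (net.m s / net.Om s) := fun x =>
    (h2.comp h1).lintegral_comp (f := fun g => H (x, g)) (hH.comp measurable_prodMk_left)
  have hm : Measurable fun p : Link => H (net.pathLoss s p, p.2.2.1) :=
    hH.comp ((net.measurable_pathLoss s).prodMk (by fun_prop))
  have hi : Measurable fun x => ∫⁻ g, H (x, g) ∂gammaMeasure (net.m s) (net.m s / net.Om s) :=
    hH.lintegral_prod_right'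
  have h4 : ∀ (y : EuclideanSpace ℝ (Fin 2)), ∫⁻ k, H (net.pathLoss s (y, k), k.2.1)
      ∂net.markLaw s = ∫⁻ g, H (net.κ s * ‖y‖ ^ net.α s, g)
        ∂gammaMeasure (net.m s) (net.m s / net.Om s) := fun y =>
      h3 (net.κ s * ‖y‖ ^ net.α s)
  rw [linkIntensity, lintegral_prod _ hm.aemeasurable]
  simp_rw [h4]
  rw [← lintegral_map (f := fun x => ∫⁻ g, H (x, g) ∂gammaMeasure (net.m s) (net.m s / net.Om s))
    hi (net.measurable_loss s), map_locationIntensity,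
    lintegral_withDensity_eq_lintegral_mul _ (net.measurable_LamHat' s).ennreal_ofReal hi]
  rfl

/-- The largest power of interference and noise that allows for the decoding threshold `T`. -/
noncomputable def tolerance (T : ℝ) (v : ℝ × ℝ) : ℝ≥0∞ :=
  ENNReal.ofReal (net.PRB * net.G0 * v.2 / v.1) / ENNReal.ofReal T

theorem measurable_tolerance (T : ℝ) : Measurable (net.tolerance T) := by
  unfold tolerance
  fun_prop

/-- The conditional probability of coverage for the serving path-loss `x`. -/
noncomputable def coverage (T : ℝ) (s : S) (x : ℝ) : ℝ :=
  1 / 2 - (∫ z in Ioi (0 : ℝ), (net.sinrFactor T s x z).im / z) / Real.pi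

variable [MeasurableSpace S] [MeasurableSingletonClass S] {Ω : Type*} {Φ : S → Ω → Set Link} {net}

/-- The signal and the threshold are positive and finite, so the division in `[0, ∞]` can be cleared
even when noise and interference vanish or are infinite. -/
theorem le_linkSINR_iff {T : ℝ} (hT : 0 < T) {s : S} {p : Link} (hg : 0 < p.2.2.1)
    (hL : 0 < net.pathLoss s p) (ω : Ω) :
    ENNReal.ofReal T ≤ net.linkSINR (fun r => Φ r ω) s p ↔
      ENNReal.ofReal net.noise + net.totalPower Φ (net.pathLoss s p) ω ≤
        net.tolerance T (net.pathLoss s p, p.2.2.1) := by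
  have hG := net.G0_pos
  have hP := net.PRB_pos
  have hS : ENNReal.ofReal (net.PRB * net.G0 * p.2.2.1 / net.pathLoss s p) ≠ 0 := by
    rw [ne_eq, ENNReal.ofReal_eq_zero, not_le]
    positivity
  have hT0 : ENNReal.ofReal T ≠ 0 := by
    rwa [ne_eq, ENNReal.ofReal_eq_zero, not_le]
  rw [linkSINR, tolerance, ← totalPower_eq, ENNReal.le_div_iff_mul_le (Or.inr hS)
    (Or.inr ENNReal.ofReal_ne_top), ENNReal.le_div_iff_mul_le (Or.inl hT0)
    (Or.inl ENNReal.ofReal_ne_top), mul_comm]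

variable [MeasurableSpace Ω] {P : Measure Ω} [IsProbabilityMeasure P]

/-- Where the interference is finite, which is almost everywhere, the tolerance condition says
`requiredGain ≤ g`; the inversion formula then evaluates the average over the gamma law of `g`. -/
theorem IsRealization.lintegral_tailProb (hΦ : net.IsRealization P Φ) {T : ℝ} (hT : 0 < T)
    (s : S) {x : ℝ} (hx : 0 < x) :
    ∫⁻ g, tailProb (mergedSet Φ) P net.jointLoss net.jointPower (ENNReal.ofReal net.noise) x
        (net.tolerance T (x, g)) ∂gammaMeasure (net.m s) (net.m s / net.Om s) =
      ENNReal.ofReal (net.coverage T s x) ∧ 0 ≤ net.coverage T s x := by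
  have := net.isProbabilityMeasure_fadingLaw s
  have hm := net.m_pos s
  have hO := net.Om_pos s
  have hG := net.G0_pos
  have hP := net.PRB_pos
  have hN := net.noise_nonneg
  have h1 := lintegral_measure_le (hΦ.measurable_requiredGain T x)
    (hΦ.integrable_requiredGain T hx) (integrable_id_gammaMeasure hm (div_pos hm hO))
    gammaMeasure_singleton (hΦ.sinrFactor_eq T s hx) (hΦ.integrableOn_im_sinrFactor hT s hx)
  refine ⟨?_, h1.2⟩
  rw [coverage, ← h1.1]
  refine lintegral_congr_ae ?_
  filter_upwards [ae_pos_gammaMeasure] with g hg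
  have hfin : ∀ᵐ ω ∂P, net.totalPower Φ x ω ≠ ∞ :=
    hΦ.merged.ae_lintegral_ne_top (net.measurable_indicator_jointPower x)
      (net.lintegral_jointPower_ne_top hx)
  refine measure_congr ?_
  filter_upwards [hfin] with ω hω
  refine propext ?_
  change ENNReal.ofReal net.noise + net.totalPower Φ x ω ≤ net.tolerance T (x, g) ↔
    net.requiredGain Φ T x ω ≤ g
  rw [tolerance, ← ENNReal.ofReal_div_of_pos hT, requiredGain, ← ENNReal.ofReal_toReal hω,
    ← ENNReal.ofReal_add hN ENNReal.toReal_nonneg, ENNReal.ofReal_le_ofReal_iff (by positivity),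
    ENNReal.toReal_ofReal ENNReal.toReal_nonneg, div_div, le_div_iff₀ (by positivity),
    div_mul_eq_mul_div, div_le_iff₀ (by positivity)]
  constructor <;> intro h <;> linarith

/-- Almost surely there is a unique first point, so the supremum defining `SINR` has a single term;
positivity of its fading and path-loss holds off a null set. -/
theorem IsRealization.ae_SINR (hΦ : net.IsRealization P Φ) {T : ℝ} (hT : 0 < T) :
    {ω | ENNReal.ofReal T ≤ net.SINR fun s => Φ s ω} =ᵐ[P]
    {ω | ∃ q ∈ mergedSet Φ ω, (∀ q' ∈ mergedSet Φ ω, net.jointLoss q ≤ net.jointLoss q') ∧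
      ENNReal.ofReal net.noise + ∫⁻ y, {q' | net.jointLoss q < net.jointLoss q'}.indicator
        net.jointPower y ∂pointMeasure (mergedSet Φ ω) ≤
          net.tolerance T (net.jointLoss q, q.2.2.2.1)} := by
  have h1 := ae_exists_first hΦ.merged net.measurable_jointLoss net.jointLoss_nonneg
    net.jointIntensity_le_ne_top net.jointIntensity_eq net.jointIntensity_univ
  have h2 : ∀ᵐ ω ∂P, ∀ s, ∀ p ∈ Φ s ω, 0 < p.2.2.1 := ae_all_iff.2 fun s =>
    (hΦ.poisson s).ae_forall_mem (measurableSet_lt measurable_const (by fun_prop))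
      (net.ae_linkIntensity_fading_pos s)
  have h3 : ∀ᵐ ω ∂P, ∀ s, ∀ p ∈ Φ s ω, 0 < net.pathLoss s p := ae_all_iff.2 fun s =>
    (hΦ.poisson s).ae_forall_mem (measurableSet_lt measurable_const (net.measurable_pathLoss s))
      (net.ae_linkIntensity_pathLoss_pos s)
  filter_upwards [h1, h2, h3] with ω ⟨⟨s, p⟩, hp, hfirst⟩ hg hL
  refine propext ?_
  change ENNReal.ofReal T ≤ net.SINR (fun s => Φ s ω) ↔ ∃ q ∈ mergedSet Φ ω, _
  have hp' : p ∈ Φ s ω := hp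
  have hserving : net.IsServing (fun s => Φ s ω) s p := fun r p' hp'' => by
    by_cases h : (r, p') = (s, p)
    · obtain ⟨rfl, rfl⟩ := Prod.mk.inj h
      exact le_rfl
    · exact (hfirst (r, p') hp'' h).le
  have huniq : ∀ q ∈ mergedSet Φ ω, (∀ q' ∈ mergedSet Φ ω, net.jointLoss q ≤ net.jointLoss q') →
      q = (s, p) := fun q hq hmin => by
    by_contra h
    exact absurd (hfirst q hq h) (not_lt.2 (hmin (s, p) hp))
  have hSINR : net.SINR (fun s => Φ s ω) = net.linkSINR (fun s => Φ s ω) s p := by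
    refine le_antisymm (iSup_le fun r => iSup₂_le fun p' hp'' => iSup_le fun hs => ?_) ?_
    · obtain ⟨rfl, rfl⟩ := Prod.mk.inj (huniq (r, p') hp'' fun q' hq' => hs q'.1 q'.2 hq')
      exact le_rfl
    · exact le_iSup_of_le s (le_iSup₂_of_le p hp' (le_iSup_of_le hserving le_rfl))
  rw [hSINR, le_linkSINR_iff hT (hg s p hp') (hL s p hp')]
  constructor
  · intro h
    exact ⟨(s, p), hp, fun q' hq' => hserving q'.1 q'.2 hq', h⟩
  · rintro ⟨q, hq, hmin, h⟩
    obtain rfl := huniq q hq hmin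
    exact h

theorem ofReal_ell (net : Network S B) (s : S) {x : ℝ} (hx : 0 ≤ x) :
    ENNReal.ofReal (net.ell s x) = ENNReal.ofReal (net.LamHat' s x) *
      ENNReal.ofReal (Real.exp (-net.jointIntensity.real {q | net.jointLoss q ≤ x})) := by
  rw [ell, ENNReal.ofReal_mul (net.LamHat'_nonneg s hx), net.jointIntensity_real_le hx]

/-- The normalization of the law of the first point of the superposed process, split according to
its state. It produces the constant `1/2` in the final formula. -/
theorem sum_integral_ell (net : Network S B) : ∑ s, ∫ x in Ioi 0, net.ell s x = 1 := by
  have h := lintegral_exp_neg_eq_one net.measurable_jointLoss net.jointLoss_nonneg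
    net.jointIntensity_le_ne_top net.jointIntensity_eq net.jointIntensity_univ
  have hm := measurable_exp_neg net.jointIntensity_le_ne_top
  replace h := (lintegral_mergedMeasure net.linkIntensity (f := fun q => ENNReal.ofReal
    (Real.exp (-net.jointIntensity.real {q' | net.jointLoss q' ≤ net.jointLoss q})))
    (hm.comp net.measurable_jointLoss)).symm.trans h
  have h1 : ∀ s, ∫⁻ p, ENNReal.ofReal (Real.exp (-net.jointIntensity.real
      {q | net.jointLoss q ≤ net.jointLoss (s, p)})) ∂net.linkIntensity s =
      ENNReal.ofReal (∫ x in Ioi 0, net.ell s x) := fun s => by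
    rw [ofReal_integral_eq_lintegral_ofReal (net.integrableOn_ell s)]
    · refine (net.lintegral_pathLoss s hm).trans (setLIntegral_congr_fun measurableSet_Ioi ?_)
      intro x hx
      exact (net.ofReal_ell s (le_of_lt hx)).symm
    · filter_upwards [ae_restrict_mem measurableSet_Ioi] with x hx
      exact net.ell_nonneg s (le_of_lt hx)
  have h0 : ∀ s, 0 ≤ ∫ x in Ioi 0, net.ell s x := fun s =>
    setIntegral_nonneg measurableSet_Ioi fun x hx => net.ell_nonneg s (le_of_lt hx)
  simp_rw [h1] at h
  rw [← ENNReal.ofReal_sum_of_nonneg fun s _ => h0 s, ENNReal.ofReal_eq_one] at h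
  exact h

/-- The law of the first point, with received power as summand and tolerance as threshold. The
integrand depends on a link only through its path-loss and fading, so integrating out the fading
leaves `coverage`. -/
theorem IsRealization.measure_SINR (hΦ : net.IsRealization P Φ) {T : ℝ} (hT : 0 < T) :
    P {ω | ENNReal.ofReal T ≤ net.SINR fun s => Φ s ω} =
      ∑ s, ∫⁻ x in Ioi 0, ENNReal.ofReal (net.ell s x * net.coverage T s x) := by
  have hm := measurable_exp_neg net.jointIntensity_le_ne_top
  have hmax : ∀ q : S × Link, max (net.jointLoss q) 0 = net.jointLoss q := fun q =>
    max_eq_left (net.jointLoss_nonneg q)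
  have hmark : Measurable fun q : S × Link => q.2.2.2.1 := by fun_prop
  set H : ℝ × ℝ → ℝ≥0∞ := fun v =>
    ENNReal.ofReal (Real.exp (-net.jointIntensity.real {q | net.jointLoss q ≤ v.1})) *
      tailProb (mergedSet Φ) P net.jointLoss net.jointPower (ENNReal.ofReal net.noise)
        (max v.1 0) (net.tolerance T v) with hH
  have hHm : Measurable H := by
    refine (hm.comp measurable_fst).mul ?_
    exact Measurable.comp (g := fun q : ℝ × ℝ≥0∞ => tailProb (mergedSet Φ) P net.jointLoss
      net.jointPower (ENNReal.ofReal net.noise) (max q.1 0) q.2)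
      (f := fun v : ℝ × ℝ => (v.1, net.tolerance T v))
      (measurable_tailProb hΦ.merged net.measurable_jointLoss net.measurable_jointPower _)
      (measurable_fst.prodMk (net.measurable_tolerance T))
  refine (measure_congr (hΦ.ae_SINR hT)).trans ((measure_first hΦ.merged net.measurable_jointLoss
    net.jointLoss_nonneg net.jointIntensity_le_ne_top net.jointIntensity_eq
    net.jointIntensity_univ net.measurable_jointPower
    (a := fun q => net.tolerance T (net.jointLoss q, q.2.2.2.1))
    ((net.measurable_tolerance T).comp (net.measurable_jointLoss.prodMk hmark)) _).trans ?_)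
  have h1 : ∀ q : S × Link, ENNReal.ofReal (Real.exp (-net.jointIntensity.real
      {q' | net.jointLoss q' ≤ net.jointLoss q})) * tailProb (mergedSet Φ) P net.jointLoss
      net.jointPower (ENNReal.ofReal net.noise) (net.jointLoss q)
      (net.tolerance T (net.jointLoss q, q.2.2.2.1)) = H (net.jointLoss q, q.2.2.2.1) :=
    fun q => by simp only [hH, hmax]
  refine (lintegral_congr h1).trans ((lintegral_mergedMeasure net.linkIntensity
    (f := fun q => H (net.jointLoss q, q.2.2.2.1))
    (hHm.comp (net.measurable_jointLoss.prodMk hmark))).trans ?_)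
  refine Finset.sum_congr rfl fun s _ => ?_
  refine (net.lintegral_pathLoss_fading s hHm).trans
    (setLIntegral_congr_fun measurableSet_Ioi fun x hx => ?_)
  have hx0 : (0 : ℝ) < x := hx
  obtain ⟨h2, -⟩ := hΦ.lintegral_tailProb hT s hx0
  simp only [hH, max_eq_left hx0.le]
  have hmx : Measurable fun g => tailProb (mergedSet Φ) P net.jointLoss net.jointPower
      (ENNReal.ofReal net.noise) x (net.tolerance T (x, g)) :=
    (tailProb_mono net.jointLoss net.jointPower (ENNReal.ofReal net.noise) x).measurable.comp
      ((net.measurable_tolerance T).comp measurable_prodMk_left)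
  rw [lintegral_const_mul _ hmx, h2, ← mul_assoc, ← net.ofReal_ell s hx0.le,
    ← ENNReal.ofReal_mul (net.ell_nonneg s hx0.le)]

theorem IsRealization.integrableOn_integral_integrand (hΦ : net.IsRealization P Φ) {T : ℝ}
    (hT : 0 < T) (s : S) :
    IntegrableOn (fun x => ∫ z in Ioi (0 : ℝ), net.integrand T s x z) (Ioi 0) := by
  have h : Integrable (fun p : ℝ × ℝ => net.integrand T s p.1 p.2)
      ((volume.restrict (Ioi 0)).prod (volume.restrict (Ioi 0))) := by
    rw [Measure.prod_restrict]
    exact hΦ.integrableOn_integrand hT s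
  exact h.integral_prod_left

theorem IsRealization.measureReal_SINR (hΦ : net.IsRealization P Φ) {T : ℝ} (hT : 0 < T) :
    P.real {ω | ENNReal.ofReal T ≤ net.SINR fun s => Φ s ω} =
      1 / 2 - net.Cbar T / Real.pi := by
  have h1 : ∀ s x, net.ell s x * net.coverage T s x = net.ell s x * (1 / 2) -
      (∫ z in Ioi (0 : ℝ), net.integrand T s x z) / Real.pi := fun s x => by
    simp_rw [integrand_eq]
    rw [integral_const_mul, coverage]
    ring
  have hi1 : ∀ s, IntegrableOn (fun x => net.ell s x * (1 / 2)) (Ioi 0) := fun s =>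
    (net.integrableOn_ell s).mul_const _
  have hi2 : ∀ s, IntegrableOn (fun x => (∫ z in Ioi (0 : ℝ), net.integrand T s x z) / Real.pi)
      (Ioi 0) := fun s => (hΦ.integrableOn_integral_integrand hT s).div_const _
  have hi : ∀ s, IntegrableOn (fun x => net.ell s x * net.coverage T s x) (Ioi 0) := fun s => by
    simp_rw [h1]
    exact (hi1 s).sub (hi2 s)
  have h0 : ∀ s, ∀ x ∈ Ioi (0 : ℝ), 0 ≤ net.ell s x * net.coverage T s x := fun s x hx =>
    mul_nonneg (net.ell_nonneg s (le_of_lt hx)) (hΦ.lintegral_tailProb hT s hx).2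
  have h2 : ∀ s, ∫⁻ x in Ioi 0, ENNReal.ofReal (net.ell s x * net.coverage T s x) =
      ENNReal.ofReal (∫ x in Ioi 0, net.ell s x * net.coverage T s x) := fun s => by
    rw [ofReal_integral_eq_lintegral_ofReal (hi s)]
    filter_upwards [ae_restrict_mem measurableSet_Ioi] with x hx
    exact h0 s x hx
  have h3 : ∀ s, 0 ≤ ∫ x in Ioi 0, net.ell s x * net.coverage T s x := fun s =>
    setIntegral_nonneg measurableSet_Ioi (h0 s)
  rw [measureReal_def, hΦ.measure_SINR hT]
  simp_rw [h2]
  rw [← ENNReal.ofReal_sum_of_nonneg fun s _ => h3 s,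
    ENNReal.toReal_ofReal (Finset.sum_nonneg fun s _ => h3 s)]
  have h4 : ∀ s, ∫ x in Ioi 0, net.ell s x * net.coverage T s x =
      (∫ x in Ioi 0, net.ell s x) * (1 / 2) -
        (∫ x in Ioi (0 : ℝ), ∫ z in Ioi (0 : ℝ), net.integrand T s x z) / Real.pi := fun s => by
    simp_rw [h1]
    rw [integral_sub (hi1 s) (hi2 s), integral_mul_const, integral_div]
  simp_rw [h4]
  rw [Finset.sum_sub_distrib, ← Finset.sum_mul, sum_integral_ell, one_mul, ← Finset.sum_div, Cbar]

end Coverage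

end Network

end Cellular

/-- Potential throughput of the cellular network with the approximated (multi-ball) intensity
measure; the integrability makes the two-fold integral absolutely convergent. -/
theorem proposition2 {S : Type*} [Fintype S] {B : ℕ} (net : Cellular.Network S B)
    {Ω : Type*} [MeasurableSpace Ω] (P : Measure Ω) [IsProbabilityMeasure P]
    (Φ : S → Ω → Set Cellular.Network.Link) (hΦ : net.IsRealization P Φ)
    (T : ℝ) (hT : 0 < T) :
    (∀ s, IntegrableOn (fun p : ℝ × ℝ => net.integrand T s p.1 p.2)
      (Ioi (0 : ℝ) ×ˢ Ioi (0 : ℝ))) ∧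
    net.potentialThroughput P Φ T =
      net.lamMT * net.pSel * Real.logb 2 (1 + T) * (1 / 2 - net.Cbar T / Real.pi) := by
  -- The finite set of states receives the discrete σ-algebra, under which singletons are
  -- measurable; the statement itself involves no measurable structure on `S`.
  let _ : MeasurableSpace S := ⊤
  refine ⟨hΦ.integrableOn_integrand hT, ?_⟩
  rw [Cellular.Network.potentialThroughput, hΦ.measureReal_SINR hT]
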